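/- Let $c:\mathbb R^d\times\mathbb R^d\to[0,\infty)$ be continuous with $c(x,y)=0$ if and only if $x=y$, and suppose that for some $p\ge 1$ and some constants $A,B>0$, $c(x,y)\le A+B(|x|^p+|y|^p)$ as $|x|,|y|\to\infty$. Let $\rho_0,\rho_1$ be probability densities on $\mathbb R^d$ with finite $p$-th moments, and let $\epsilon>0$. Let $a_\epsilon\in L^1(\rho_0)$ and $b_\epsilon\in L^1(\rho_1)$ be Schrödinger potentials, that is, measurable functions such that, with $$\xi(x,y)=\exp\Big(-\tfrac1\epsilon\big(c(x,y)-a_\epsilon(x)-b_\epsilon(y)\big)\Big),$$ the measure $\mu_\epsilon(dx\,dy)=\xi(x,y)\rho_0(x)\rho_1(y)\,dx\,dy$ is a coupling of $\rho_0$ and $\rho_1$ (the static Schrödinger bridge at temperature $\epsilon$). Assume moreover that $\xi\in L^2(\rho_0\otimes\rho_1)$. Let $(X_i,Y_i)_{i\ge1}$ be i.i.d. with law $\rho_0\otimes\rho_1$. For $N\ge1$ let $\mathcal S_N$ be the set of permutations of $\{1,\dots,N\}$ and define the random measure (the discrete Schrödinger bridge) $$\hat\mu^N_\epsilon=\sum_{\sigma\in\mathcal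 S_N}q^*_\epsilon(\sigma)\,\frac1N\sum_{i=1}^N\delta_{(X_i,Y_{\sigma_i})},\qquad q^*_\epsilon(\sigma)=\frac{\exp\big(-\frac1\epsilon\sum_{i=1}^N c(X_i,Y_{\sigma_i})\big)}{\sum_{\tau\in\mathcal S_N}\exp\big(-\frac1\epsilon\sum_{i=1}^N c(X_i,Y_{\tau_i})\big)}.$$ Then for every $\eta\in L^1(\mu_\epsilon)$, as $N\to\infty$, $$T_N=\int\eta\,d\hat\mu^N_\epsilon\ \longrightarrow\ \theta=\int\eta\,d\mu_\epsilon\quad\text{in probability.}$$ -/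

import Mathlib

open MeasureTheory ProbabilityTheory Filter Topology

noncomputable section

/-- A transport cost on `ℝ^d`: a continuous nonnegative function which vanishes exactly on the
diagonal and satisfies `c(x,y) ≤ A + B (|x|^p + |y|^p)` as `|x|, |y| → ∞`. -/
structure IsTransportCost {d : ℕ} (p : ℝ)
    (c : EuclideanSpace ℝ (Fin d) → EuclideanSpace ℝ (Fin d) → ℝ) : Prop where
  continuous : Continuous (Function.uncurry c)
  nonneg : ∀ x y, 0 ≤ c x y
  eq_zero_iff : ∀ x y, c x y = 0 ↔ x = y
  growth : ∃ A B R : ℝ, 0 < A ∧ 0 < B ∧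
    ∀ x y, R ≤ ‖x‖ → R ≤ ‖y‖ → c x y ≤ A + B * (‖x‖ ^ p + ‖y‖ ^ p)

/-- The set `Π(ρ₀, ρ₁)` of couplings of two measures. -/
def couplings {d : ℕ} (ρ₀ ρ₁ : Measure (EuclideanSpace ℝ (Fin d))) :
    Set (Measure (EuclideanSpace ℝ (Fin d) × EuclideanSpace ℝ (Fin d))) :=
  {ν | ν.map Prod.fst = ρ₀ ∧ ν.map Prod.snd = ρ₁}

/-- `ξ(x,y) = exp(-(c(x,y) - a(x) - b(y)) / ε)`. -/
def schrodingerXi {d : ℕ} (c : EuclideanSpace ℝ (Fin d) → EuclideanSpace ℝ (Fin d) → ℝ)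
    (ε : ℝ) (a b : EuclideanSpace ℝ (Fin d) → ℝ)
    (z : EuclideanSpace ℝ (Fin d) × EuclideanSpace ℝ (Fin d)) : ℝ :=
  Real.exp (-(1 / ε) * (c z.1 z.2 - a z.1 - b z.2))

/-- The measure `ξ(x,y) ρ₀(dx) ρ₁(dy)`. -/
def schrodingerMeasure {d : ℕ} (c : EuclideanSpace ℝ (Fin d) → EuclideanSpace ℝ (Fin d) → ℝ)
    (ε : ℝ) (ρ₀ ρ₁ : Measure (EuclideanSpace ℝ (Fin d)))
    (a b : EuclideanSpace ℝ (Fin d) → ℝ) :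
    Measure (EuclideanSpace ℝ (Fin d) × EuclideanSpace ℝ (Fin d)) :=
  (ρ₀.prod ρ₁).withDensity (fun z => ENNReal.ofReal (schrodingerXi c ε a b z))

/-- `a` and `b` are Schrödinger potentials for `(ρ₀, ρ₁)` at temperature `ε`: measurable functions
for which `ξ(x,y) ρ₀(dx) ρ₁(dy)` is a coupling of `ρ₀` and `ρ₁`. That coupling is then the static
Schrödinger bridge connecting `ρ₀` to `ρ₁`. -/
structure IsSchrodingerPotentials {d : ℕ}
    (c : EuclideanSpace ℝ (Fin d) → EuclideanSpace ℝ (Fin d) → ℝ)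
    (ε : ℝ) (ρ₀ ρ₁ : Measure (EuclideanSpace ℝ (Fin d)))
    (a b : EuclideanSpace ℝ (Fin d) → ℝ) : Prop where
  measurable_left : Measurable a
  measurable_right : Measurable b
  mem_couplings : schrodingerMeasure c ε ρ₀ ρ₁ a b ∈ couplings ρ₀ ρ₁

/-- The unnormalised weight `exp(-(1/ε) ∑ᵢ c(xᵢ, y_{σ(i)}))` of a permutation. -/
def permWeight {d N : ℕ} (c : EuclideanSpace ℝ (Fin d) → EuclideanSpace ℝ (Fin d) → ℝ)
    (ε : ℝ) (x y : Fin N → EuclideanSpace ℝ (Fin d)) (σ : Equiv.Perm (Fin N)) : ℝ :=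
  Real.exp (-(1 / ε) * ∑ i, c (x i) (y (σ i)))

/-- The Gibbs probability of a permutation. -/
def gibbsProb {d N : ℕ} (c : EuclideanSpace ℝ (Fin d) → EuclideanSpace ℝ (Fin d) → ℝ)
    (ε : ℝ) (x y : Fin N → EuclideanSpace ℝ (Fin d)) (σ : Equiv.Perm (Fin N)) : ℝ :=
  permWeight c ε x y σ / ∑ τ : Equiv.Perm (Fin N), permWeight c ε x y τ

/-- The discrete Schrödinger bridge `∑_σ q(σ) (1/N) ∑ᵢ δ_{(xᵢ, y_{σ(i)})}` of two point clouds,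
where `q` is the Gibbs probability. -/
def discreteBridge {d N : ℕ} (c : EuclideanSpace ℝ (Fin d) → EuclideanSpace ℝ (Fin d) → ℝ)
    (ε : ℝ) (x y : Fin N → EuclideanSpace ℝ (Fin d)) :
    Measure (EuclideanSpace ℝ (Fin d) × EuclideanSpace ℝ (Fin d)) :=
  ∑ σ : Equiv.Perm (Fin N), ENNReal.ofReal (gibbsProb c ε x y σ) •
    ((N : ENNReal)⁻¹ • ∑ i, Measure.dirac (x i, y (σ i)))

end

/-!
Write `D_N = (1/N!) ∑_σ ∏ᵢ ξ(Xᵢ, Y_{σ i})`; this is the density with respect to `(ρ₀ ⊗ ρ₁)^N` of an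
`N`-sample of the coupling `μ = ξ ρ₀ ⊗ ρ₁` whose second coordinates have been shuffled. The weights
of `T_N` are proportional to `∏ᵢ ξ(Xᵢ, Y_{σ i})`, so `D_N |T_N - θ|` has expectation at most
`E_{μ^N} |N⁻¹ ∑ᵢ η(Zᵢ) - θ|`, which tends to `0` by the law of large numbers, and the point is that
`D_N` stays away from `0` in probability.

Positivity of `ξ` makes the correlation of `f(X)` and `g(Y)` under `μ` at most `s < 1`. Hence the
orthogonal (chaos) expansion of `D_N` is dominated by a geometric series, uniformly in `N`, and
`D_N` is `L²`-close to the same average for a block approximation of `ξ`. For a block kernel, `D_N`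
is a ratio of multinomial probabilities: a typical contingency table is moved to any other typical
pair of margins by its least-squares correction, which changes the probability by a factor bounded
uniformly in `N` and in the number of blocks.
-/

/-! ### Multinomial probabilities -/

section Multinomial

/-- The logarithm of the Poisson weight `x ^ n / n!`, corrected by its Gaussian approximation;
it varies slowly in `n` on windows of size `√x` around `x`. -/
noncomputable def logPoissonCorrection (x : ℝ) (n : ℕ) : ℝ :=
  n * Real.log x - Real.log n.factorial + (n - x) ^ 2 / (2 * x)

theorem abs_logPoissonCorrection_succ_sub_le {x : ℝ} (hx : 0 < x) {n : ℕ}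
    (hn : |(n + 1 : ℕ) - x| ≤ x / 2) :
    |logPoissonCorrection x (n + 1) - logPoissonCorrection x n|
      ≤ 2 * (((n + 1 : ℕ) - x) / x) ^ 2 + 1 / (2 * x) := by
  set u : ℝ := ((n + 1 : ℕ) - x) / x with hu
  have hux : (n + 1 : ℕ) = x * (1 + u) := by rw [hu]; field_simp; ring
  have hu2 : -(1 / 2) ≤ u := by
    rw [hu, le_div_iff₀ hx]
    linarith [(abs_le.1 hn).1]
  have hlog : Real.log (n + 1 : ℕ) = Real.log x + Real.log (1 + u) := by
    rw [hux, Real.log_mul hx.ne' (by linarith)]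
  have hdiff : logPoissonCorrection x (n + 1) - logPoissonCorrection x n
      = u - Real.log (1 + u) - 1 / (2 * x) := by
    have hn1 : (n : ℝ) = x * (1 + u) - 1 := by rw [← hux]; push_cast; ring
    have hfact : Real.log (n + 1).factorial
        = Real.log x + Real.log (1 + u) + Real.log n.factorial := by
      rw [← hlog, Nat.factorial_succ, Nat.cast_mul, Real.log_mul (by positivity) (by positivity)]
    rw [logPoissonCorrection, logPoissonCorrection, hfact, hux, hn1]
    field_simp
    ring
  have h1u : 0 < 1 + u := by linarith
  have hle : Real.log (1 + u) ≤ u := (Real.log_le_sub_one_of_pos h1u).trans_eq (by ring)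
  have hge : u - 2 * u ^ 2 ≤ Real.log (1 + u) := by
    refine le_trans ?_ (Real.one_sub_inv_le_log_of_pos h1u)
    have h : 1 - (1 + u)⁻¹ - (u - 2 * u ^ 2) = u ^ 2 * (1 + 2 * u) / (1 + u) := by
      field_simp
      ring
    rw [← sub_nonneg, h]
    exact div_nonneg (mul_nonneg (sq_nonneg u) (by linarith)) h1u.le
  have hx2 : 0 < 1 / (2 * x) := by positivity
  rw [hdiff, abs_le]
  constructor <;> nlinarith [sq_nonneg u]

theorem eventually_mul_sqrt_le_mul_half {x : ℝ} (hx : 0 < x) (K : ℝ) :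
    ∀ᶠ N : ℕ in atTop, K * √N ≤ N * x / 2 := by
  have hs : Tendsto (fun N : ℕ => √(N : ℝ)) atTop atTop :=
    Real.tendsto_sqrt_atTop.comp tendsto_natCast_atTop_atTop
  filter_upwards [hs.eventually_ge_atTop (2 * K / x)] with N hN
  rw [div_le_iff₀ hx] at hN
  nlinarith [Real.mul_self_sqrt (N.cast_nonneg (α := ℝ)), Real.sqrt_nonneg (N : ℝ)]

theorem eventually_abs_logPoissonCorrection_sub_le {x : ℝ} (hx : 0 < x) (K : ℝ) {ε : ℝ}
    (hε : 0 < ε) : ∀ᶠ N : ℕ in atTop, ∀ m n : ℕ, |m - N * x| ≤ K * √N → |n - N * x| ≤ K * √N →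
      |logPoissonCorrection (N * x) m - logPoissonCorrection (N * x) n| ≤ ε := by
  have hlim : Tendsto (fun N : ℕ => 2 * K * (2 * K ^ 2 / x ^ 2 + 1 / (2 * x)) / √(N : ℝ))
      atTop (𝓝 0) :=
    tendsto_const_nhds.div_atTop (Real.tendsto_sqrt_atTop.comp tendsto_natCast_atTop_atTop)
  filter_upwards [hlim.eventually_le_const hε, eventually_mul_sqrt_le_mul_half hx K,
    eventually_gt_atTop 0] with N hεN hK hN m n hm hn
  wlog hmn : m ≤ n generalizing m n
  · rw [abs_sub_comm]
    exact this n m hn hm (le_of_not_ge hmn)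
  have : (0 : ℝ) < √N := by positivity
  have hNs : √(N : ℝ) ^ 2 = N := Real.sq_sqrt N.cast_nonneg
  have hstep : ∀ {k}, m ≤ k → k < n → dist (logPoissonCorrection (N * x) k)
      (logPoissonCorrection (N * x) (k + 1)) ≤ (2 * K ^ 2 / x ^ 2 + 1 / (2 * x)) / N := by
    intro k hmk hkn
    have hmk' : (m : ℝ) ≤ (k + 1 : ℕ) := by exact_mod_cast hmk.trans k.le_succ
    have hkn' : ((k + 1 : ℕ) : ℝ) ≤ n := by exact_mod_cast hkn
    have hk : |(k + 1 : ℕ) - N * x| ≤ K * √N :=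
      abs_le.2 ⟨by linarith [(abs_le.1 hm).1], by linarith [(abs_le.1 hn).2]⟩
    rw [dist_comm, Real.dist_eq]
    refine (abs_logPoissonCorrection_succ_sub_le (by positivity) (hk.trans hK)).trans ?_
    calc 2 * (((k + 1 : ℕ) - N * x) / (N * x)) ^ 2 + 1 / (2 * (N * x))
        ≤ 2 * ((K * √N) ^ 2 / (N * x) ^ 2) + 1 / (2 * (N * x)) := by
          rw [div_pow, ← sq_abs (_ - _)]
          gcongr
      _ = (2 * K ^ 2 / x ^ 2 + 1 / (2 * x)) / N := by
          rw [mul_pow, hNs]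
          field_simp
  have hcard : ((n - m : ℕ) : ℝ) ≤ 2 * K * √N := by
    rw [Nat.cast_sub hmn]
    linarith [(abs_le.1 hm).1, (abs_le.1 hn).2]
  calc |logPoissonCorrection (N * x) m - logPoissonCorrection (N * x) n|
      ≤ (n - m : ℕ) * ((2 * K ^ 2 / x ^ 2 + 1 / (2 * x)) / N) := by
        have h := dist_le_Ico_sum_of_dist_le hmn hstep
        rwa [Real.dist_eq, Finset.sum_const, Nat.card_Ico, nsmul_eq_mul] at h
    _ ≤ 2 * K * √N * ((2 * K ^ 2 / x ^ 2 + 1 / (2 * x)) / N) := by gcongr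
    _ = 2 * K * (2 * K ^ 2 / x ^ 2 + 1 / (2 * x)) / √N := by
        nth_rw 2 [← hNs]
        field_simp
    _ ≤ ε := hεN

variable {Z : Type*} [Fintype Z]

/-- The probability that `∑ n` independent draws from the weights `w` hit each `a` exactly `n a`
times. -/
noncomputable def multinomialProb (w : Z → ℝ) (n : Z → ℕ) : ℝ :=
  Nat.multinomial Finset.univ n * ∏ a, w a ^ n a

/-- Pearson's statistic: the squared distance, in the metric of the local limit theorem, between
the counts `x` of `N` draws and their means under the weights `w`. The counts may be any real
numbers, so that they can be shifted freely. -/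
noncomputable def chiSq (w : Z → ℝ) (N : ℕ) (x : Z → ℝ) : ℝ :=
  ∑ a, (x a - N * w a) ^ 2 / (N * w a)

variable {w : Z → ℝ} {n : Z → ℕ} {N : ℕ}

theorem multinomialProb_nonneg (hw : ∀ a, 0 ≤ w a) (n : Z → ℕ) : 0 ≤ multinomialProb w n :=
  mul_nonneg (Nat.cast_nonneg _) (Finset.prod_nonneg fun a _ => pow_nonneg (hw a) _)

theorem multinomialProb_pos (hw : ∀ a, 0 < w a) (n : Z → ℕ) : 0 < multinomialProb w n :=
  mul_pos (by exact_mod_cast Nat.multinomial_pos _ _)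
    (Finset.prod_pos fun a _ => pow_pos (hw a) _)

theorem multinomialProb_eq_mul_exp (hw : ∀ a, 0 < w a) (hN : 0 < N) (hn : ∑ a, n a = N) :
    multinomialProb w n = N.factorial / N ^ N *
      Real.exp (∑ a, logPoissonCorrection (N * w a) (n a) - chiSq w N (fun a => n a) / 2) := by
  have hN' : (0 : ℝ) < N := by exact_mod_cast hN
  have hspec := Nat.multinomial_spec Finset.univ n
  rw [hn] at hspec
  have hexp : ∀ a, Real.exp (logPoissonCorrection (N * w a) (n a)
      - (n a - N * w a) ^ 2 / (N * w a) / 2) = (N * w a) ^ n a / (n a).factorial := fun a => by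
    have hNw : 0 < N * w a := mul_pos hN' (hw a)
    rw [logPoissonCorrection, div_div, mul_comm (N * w a) 2, add_sub_cancel_right, Real.exp_sub,
      Real.exp_nat_mul, Real.exp_log hNw, Real.exp_log (by positivity)]
  rw [chiSq, Finset.sum_div, ← Finset.sum_sub_distrib, Real.exp_sum, Finset.prod_congr rfl
    fun a _ => hexp a, Finset.prod_div_distrib, multinomialProb, ← hspec]
  simp only [mul_pow, Finset.prod_mul_distrib, Finset.prod_pow_eq_pow_sum, hn]
  have hfact : ∏ a, ((n a).factorial : ℝ) ≠ 0 :=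
    Finset.prod_ne_zero_iff.2 fun a _ => by positivity
  push_cast
  field_simp

theorem eventually_multinomialProb_le (hw : ∀ a, 0 < w a) (K : ℝ) {ε : ℝ} (hε : 0 < ε) :
    ∀ᶠ N : ℕ in atTop, ∀ m n : Z → ℕ, ∑ a, m a = N → ∑ a, n a = N →
      (∀ a, |m a - N * w a| ≤ K * √N) → (∀ a, |n a - N * w a| ≤ K * √N) →
      multinomialProb w m
        ≤ Real.exp ((chiSq w N (fun a => n a) - chiSq w N (fun a => m a)) / 2 + ε) *
          multinomialProb w n := by
  have hε' : 0 < ε / (Fintype.card Z + 1) := by positivity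
  filter_upwards [eventually_all.2 fun a =>
    eventually_abs_logPoissonCorrection_sub_le (hw a) K hε', eventually_gt_atTop 0]
    with N hN hN0 m n hm hn hmK hnK
  have hsum : ∑ a, logPoissonCorrection (N * w a) (m a)
      - ∑ a, logPoissonCorrection (N * w a) (n a) ≤ ε := by
    rw [← Finset.sum_sub_distrib]
    calc ∑ a, (logPoissonCorrection (N * w a) (m a) - logPoissonCorrection (N * w a) (n a))
        ≤ ∑ _a : Z, ε / (Fintype.card Z + 1) :=
          Finset.sum_le_sum fun a _ => (le_abs_self _).trans (hN a _ _ (hmK a) (hnK a))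
      _ = ε * (Fintype.card Z / (Fintype.card Z + 1)) := by
          rw [Finset.sum_const, nsmul_eq_mul, Finset.card_univ]
          ring
      _ ≤ ε := mul_le_of_le_one_right hε.le (div_le_one_of_le₀ (by linarith) (by positivity))
  rw [multinomialProb_eq_mul_exp hw hN0 hm, multinomialProb_eq_mul_exp hw hN0 hn, mul_left_comm,
    ← Real.exp_add]
  gcongr
  linarith

theorem eventually_chiSq_le_add (hw : ∀ a, 0 < w a) (K R : ℝ) {ε : ℝ} (hε : 0 < ε) :
    ∀ᶠ N : ℕ in atTop, ∀ x y : Z → ℝ, (∀ a, |x a - N * w a| ≤ K * √N) → (∀ a, |y a - x a| ≤ R) →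
      chiSq w N y ≤ chiSq w N x + ε := by
  have hε' : 0 < ε / (Fintype.card Z + 1) := by positivity
  have hlim : ∀ a, ∀ᶠ N : ℕ in atTop, (2 * K * R + R ^ 2) * √N
      ≤ N * (2 * (w a * (ε / (Fintype.card Z + 1)))) / 2 := fun a =>
    eventually_mul_sqrt_le_mul_half (mul_pos two_pos (mul_pos (hw a) hε')) _
  filter_upwards [eventually_all.2 hlim, eventually_ge_atTop 1] with N hN hN1 x y hx hy
  have hN' : (1 : ℝ) ≤ √N := Real.one_le_sqrt.2 (by exact_mod_cast hN1)
  have hterm : ∀ a, (y a - N * w a) ^ 2 / (N * w a)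
      ≤ (x a - N * w a) ^ 2 / (N * w a) + ε / (Fintype.card Z + 1) := fun a => by
    have hNw : 0 < N * w a := mul_pos (by exact_mod_cast hN1) (hw a)
    have : 0 ≤ R := (abs_nonneg _).trans (hy a)
    rw [← sub_le_iff_le_add', ← sub_div, div_le_iff₀ hNw]
    calc (y a - N * w a) ^ 2 - (x a - N * w a) ^ 2
        = 2 * ((x a - N * w a) * (y a - x a)) + (y a - x a) ^ 2 := by ring
      _ ≤ 2 * (K * √N * R) + R ^ 2 := by
          gcongr ?_ + ?_
          · exact mul_le_mul_of_nonneg_left ((le_abs_self _).trans ((abs_mul _ _).trans_le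
              (mul_le_mul (hx a) (hy a) (abs_nonneg _) ((abs_nonneg _).trans (hx a))))) two_pos.le
          · exact sq_le_sq.2 ((hy a).trans (le_abs_self R))
      _ ≤ (2 * K * R + R ^ 2) * √N := by nlinarith [sq_nonneg R]
      _ ≤ ε / (Fintype.card Z + 1) * (N * w a) := (hN a).trans_eq (by ring)
  calc chiSq w N y ≤ ∑ a, ((x a - N * w a) ^ 2 / (N * w a) + ε / (Fintype.card Z + 1)) :=
        Finset.sum_le_sum fun a _ => hterm a
    _ = chiSq w N x + ε * (Fintype.card Z / (Fintype.card Z + 1)) := by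
        rw [Finset.sum_add_distrib, Finset.sum_const, nsmul_eq_mul, Finset.card_univ, chiSq]
        ring
    _ ≤ chiSq w N x + ε := by
        gcongr
        exact mul_le_of_le_one_right hε.le (div_le_one_of_le₀ (by linarith) (by positivity))

end Multinomial

/-! ### Expectations over finite samples -/

/-- The expectation of `Φ (z₁, …, z_N)` for independent `zᵢ` drawn from the weights `w`. -/
noncomputable def iidExp {Z : Type*} [Fintype Z] (w : Z → ℝ) (N : ℕ) (Φ : (Fin N → Z) → ℝ) : ℝ :=
  ∑ z : Fin N → Z, (∏ i, w (z i)) * Φ z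

/-- The expectation of `Φ (k, l)` for independent samples `k` and `l` of size `N`, drawn from the
weights `p` and `q`. -/
noncomputable def pairExp {I J : Type*} [Fintype I] [Fintype J] (p : I → ℝ) (q : J → ℝ) (N : ℕ)
    (Φ : (Fin N → I) → (Fin N → J) → ℝ) : ℝ :=
  iidExp p N fun k => iidExp q N fun l => Φ k l

/-- The number of times each label occurs in a sample. -/
def labelCount {Z : Type*} [DecidableEq Z] {N : ℕ} (z : Fin N → Z) (a : Z) : ℕ :=
  Finset.card {i | z i = a}

section IidExp

variable {Z Z' : Type*} [Fintype Z] [Fintype Z'] {w : Z → ℝ} {N : ℕ}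

theorem iidExp_add (Φ Ψ : (Fin N → Z) → ℝ) :
    iidExp w N (fun z => Φ z + Ψ z) = iidExp w N Φ + iidExp w N Ψ := by
  simp [iidExp, mul_add, Finset.sum_add_distrib]

theorem iidExp_const_mul (c : ℝ) (Φ : (Fin N → Z) → ℝ) :
    iidExp w N (fun z => c * Φ z) = c * iidExp w N Φ := by
  simp only [iidExp, Finset.mul_sum]
  exact Finset.sum_congr rfl fun z _ => by ring

theorem iidExp_sum {A : Type*} (s : Finset A) (Φ : A → (Fin N → Z) → ℝ) :
    iidExp w N (fun z => ∑ a ∈ s, Φ a z) = ∑ a ∈ s, iidExp w N (Φ a) := by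
  simp only [iidExp, Finset.mul_sum]
  exact Finset.sum_comm

theorem iidExp_prod (F : Fin N → Z → ℝ) :
    iidExp w N (fun z => ∏ i, F i (z i)) = ∏ i, ∑ a, w a * F i a := by
  classical
  simp only [iidExp, ← Finset.prod_mul_distrib]
  rw [Finset.prod_univ_sum, Fintype.piFinset_univ]

theorem iidExp_const (hw : ∑ a, w a = 1) (c : ℝ) : iidExp w N (fun _ => c) = c := by
  have h : iidExp w N (fun _ => 1) = 1 := by
    simpa [hw] using iidExp_prod (w := w) (N := N) fun _ _ => 1
  simpa [h] using iidExp_const_mul (w := w) (N := N) c fun _ => 1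

theorem iidExp_mono (hw : ∀ a, 0 ≤ w a) {Φ Ψ : (Fin N → Z) → ℝ} (h : ∀ z, Φ z ≤ Ψ z) :
    iidExp w N Φ ≤ iidExp w N Ψ :=
  Finset.sum_le_sum fun z _ =>
    mul_le_mul_of_nonneg_left (h z) (Finset.prod_nonneg fun _ _ => hw _)

theorem iidExp_nonneg (hw : ∀ a, 0 ≤ w a) {Φ : (Fin N → Z) → ℝ} (h : ∀ z, 0 ≤ Φ z) :
    0 ≤ iidExp w N Φ :=
  Finset.sum_nonneg fun z _ => mul_nonneg (Finset.prod_nonneg fun _ _ => hw _) (h z)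

theorem iidExp_succ (Φ : (Fin (N + 1) → Z) → ℝ) :
    iidExp w (N + 1) Φ = ∑ a, w a * iidExp w N (fun z => Φ (Fin.cons a z)) := by
  simp only [iidExp, Finset.mul_sum]
  rw [← (Fin.consEquiv fun _ => Z).sum_comp, Fintype.sum_prod_type]
  refine Finset.sum_congr rfl fun a _ => Finset.sum_congr rfl fun z _ => ?_
  rw [Fin.prod_univ_succ]
  simp [Fin.consEquiv, mul_assoc]

theorem iidExp_comp_perm (σ : Equiv.Perm (Fin N)) (Φ : (Fin N → Z) → ℝ) :
    iidExp w N (fun z => Φ (z ∘ σ)) = iidExp w N Φ := by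
  simp only [iidExp]
  rw [← (Equiv.arrowCongr σ (Equiv.refl Z)).sum_comp]
  refine Finset.sum_congr rfl fun z _ => congrArg₂ _ (Equiv.prod_comp σ.symm fun i => w (z i)) ?_
  congr 1
  funext i
  simp [Equiv.arrowCongr]

theorem iidExp_map [DecidableEq Z'] (c : Z → Z') (Φ : (Fin N → Z') → ℝ) :
    iidExp w N (fun z => Φ (c ∘ z)) = iidExp (fun z' => ∑ z with c z = z', w z) N Φ := by
  classical
  have h : ∀ z' : Fin N → Z', (∏ i, ∑ z with c z = z' i, w z)
      = ∑ z : Fin N → Z with c ∘ z = z', ∏ i, w (z i) := fun z' => by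
    rw [Finset.prod_univ_sum]
    refine Finset.sum_congr ?_ fun _ _ => rfl
    ext z
    simp [Fintype.mem_piFinset, funext_iff]
  simp_rw [iidExp, h, Finset.sum_mul]
  rw [← Finset.sum_fiberwise Finset.univ (fun z : Fin N → Z => c ∘ z)]
  refine Finset.sum_congr rfl fun z' _ => Finset.sum_congr rfl fun z hz => ?_
  rw [(Finset.mem_filter.1 hz).2]

theorem iidExp_sum_apply (hw : ∑ a, w a = 1) (h : Z → ℝ) (h0 : ∑ a, w a * h a = 0) :
    iidExp w N (fun z => ∑ i, h (z i)) = 0 := by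
  induction N with
  | zero => simp [iidExp]
  | succ N ih =>
    rw [iidExp_succ]
    simp only [Fin.sum_univ_succ, Fin.cons_zero, Fin.cons_succ]
    simp_rw [iidExp_add, iidExp_const hw, ih, add_zero, h0]

theorem iidExp_sum_apply_sq (hw : ∑ a, w a = 1) (h : Z → ℝ) (h0 : ∑ a, w a * h a = 0) :
    iidExp w N (fun z => (∑ i, h (z i)) ^ 2) = N * ∑ a, w a * h a ^ 2 := by
  induction N with
  | zero => simp [iidExp]
  | succ N ih =>
    rw [iidExp_succ]
    simp only [Fin.sum_univ_succ, Fin.cons_zero, Fin.cons_succ, add_sq]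
    simp_rw [iidExp_add, iidExp_const hw, ih, iidExp_const_mul, iidExp_sum_apply hw h h0,
      mul_zero, add_zero, mul_add, Finset.sum_add_distrib, ← Finset.sum_mul, hw]
    push_cast
    ring

end IidExp

section LabelCount

variable {Z : Type*} [DecidableEq Z] {N : ℕ}

theorem sum_labelCount [Fintype Z] (z : Fin N → Z) : ∑ a, labelCount z a = N := by
  simpa [labelCount] using
    (Finset.card_eq_sum_card_fiberwise (s := (Finset.univ : Finset (Fin N))) (f := z)
      (t := Finset.univ) fun _ _ => Finset.mem_univ _).symm

theorem labelCount_comp_perm (z : Fin N → Z) (σ : Equiv.Perm (Fin N)) :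
    labelCount (z ∘ σ) = labelCount z :=
  funext fun _ => Finset.card_equiv σ fun i => by simp

theorem exists_perm_comp_eq {y z : Fin N → Z} (h : labelCount y = labelCount z) :
    ∃ σ : Equiv.Perm (Fin N), z ∘ σ = y := by
  have hc : ∀ a, Nonempty ({i // y i = a} ≃ {i // z i = a}) := fun a => by
    rw [← Fintype.card_eq, Fintype.card_subtype, Fintype.card_subtype]
    exact congrFun h a
  exact ⟨Equiv.ofFiberEquiv fun a => (hc a).some, funext fun i => Equiv.ofFiberEquiv_map _ i⟩

theorem labelCount_fst {I J : Type*} [DecidableEq I] [DecidableEq J] [Fintype J]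
    (z : Fin N → I × J) (k : I) :
    labelCount (Prod.fst ∘ z) k = ∑ l, labelCount z (k, l) := by
  simp only [labelCount, Function.comp_apply, Prod.ext_iff]
  rw [Finset.card_eq_sum_card_fiberwise (f := fun i => (z i).2) (t := Finset.univ)
    fun _ _ => Finset.mem_univ _]
  simp only [Finset.filter_filter]

theorem labelCount_snd {I J : Type*} [DecidableEq I] [DecidableEq J] [Fintype I]
    (z : Fin N → I × J) (l : J) :
    labelCount (Prod.snd ∘ z) l = ∑ k, labelCount z (k, l) := by
  simp only [labelCount, Function.comp_apply, Prod.ext_iff]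
  rw [Finset.card_eq_sum_card_fiberwise (f := fun i => (z i).1) (t := Finset.univ)
    fun _ _ => Finset.mem_univ _]
  simp only [Finset.filter_filter, and_comm]

variable [Fintype Z]

-- Both sides are coefficients of `(∑ a, w a X_a) ^ N`, expanded in two ways.
theorem iidExp_labelCount_eq (w : Z → ℝ) {n : Z → ℕ} (hN : ∑ a, n a = N) :
    iidExp w N (fun z => if labelCount z = n then 1 else 0) = multinomialProb w n := by
  let s : Z →₀ ℕ := Finsupp.equivFunOnFinite.symm n
  have hs : s.sum (fun _ m => m) = N := by simp [s, Finsupp.sum_fintype, hN]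
  have hcoeff := MvPolynomial.coeff_linearCombination_X_pow_of_fintype w s N
  have hmult : s.multinomial = Nat.multinomial Finset.univ n := by
    simp [Finsupp.multinomial_eq_of_support_subset (Finset.subset_univ s.support), s]
  rw [if_pos hs, hmult, Finsupp.prod_fintype _ _ fun _ => pow_zero _] at hcoeff
  have hexpand : (∑ a, w a • MvPolynomial.X a : MvPolynomial Z ℝ) ^ N
      = ∑ z : Fin N → Z, MvPolynomial.monomial (∑ i, Finsupp.single (z i) 1) (∏ i, w (z i)) := by
    simp_rw [MvPolynomial.monomial_sum_prod]
    rw [← Fintype.piFinset_univ, ← Finset.prod_univ_sum (fun _ => Finset.univ)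
      fun (_ : Fin N) a => MvPolynomial.monomial (Finsupp.single a 1) (w a)]
    simp [MvPolynomial.X, MvPolynomial.smul_monomial]
  have hcount : ∀ z : Fin N → Z, (∑ i, Finsupp.single (z i) 1) = s ↔ labelCount z = n := fun z => by
    simp [DFunLike.ext_iff, funext_iff, s, labelCount, Finsupp.finsetSum_apply,
      Finsupp.single_apply]
  rw [multinomialProb]
  refine Eq.trans ?_ hcoeff
  simp [hexpand, iidExp, MvPolynomial.coeff_sum, MvPolynomial.coeff_monomial, hcount]

theorem iidExp_labelCount_sub_sq_le {w : Z → ℝ} (hw : ∀ a, 0 ≤ w a) (hw1 : ∑ a, w a = 1) (a : Z) :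
    iidExp w N (fun z => (labelCount z a - N * w a) ^ 2) ≤ N := by
  let h : Z → ℝ := fun b => (if b = a then 1 else 0) - w a
  have h0 : ∑ b, w b * h b = 0 := by
    simp [h, mul_sub, Finset.sum_sub_distrib, ← Finset.sum_mul, hw1]
  have hsq : ∑ b, w b * h b ^ 2 ≤ 1 := by
    rw [← hw1]
    refine Finset.sum_le_sum fun b _ => mul_le_of_le_one_right (hw b) ?_
    have hwa : w a ≤ 1 := hw1 ▸ Finset.single_le_sum (fun b _ => hw b) (Finset.mem_univ a)
    simp only [h]
    split_ifs <;> nlinarith [hw a]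
  have hcount : ∀ z : Fin N → Z, labelCount z a - N * w a = ∑ i, h (z i) := fun z => by
    simp [h, labelCount, Finset.sum_sub_distrib]
  simp_rw [hcount]
  rw [iidExp_sum_apply_sq hw1 h h0]
  exact mul_le_of_le_one_right N.cast_nonneg hsq

end LabelCount

/-! ### Averages over permutations -/

/-- The average over permutations `σ` of `∏ᵢ M(kᵢ, l_{σ(i)})`. -/
noncomputable def permAvg {I J : Type*} {N : ℕ} (M : I → J → ℝ) (k : Fin N → I) (l : Fin N → J) :
    ℝ :=
  (N.factorial : ℝ)⁻¹ * ∑ σ : Equiv.Perm (Fin N), ∏ i, M (k i) (l (σ i))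

section PermAvg

variable {I J I' J' : Type*} {N : ℕ}

theorem permAvg_nonneg {M : I → J → ℝ} (hM : ∀ k l, 0 ≤ M k l) (k : Fin N → I) (l : Fin N → J) :
    0 ≤ permAvg M k l :=
  mul_nonneg (by positivity) (Finset.sum_nonneg fun _ _ => Finset.prod_nonneg fun _ _ => hM _ _)

theorem permAvg_comp_right (M : I → J → ℝ) (k : Fin N → I) (l : Fin N → J)
    (τ : Equiv.Perm (Fin N)) : permAvg M k (l ∘ τ) = permAvg M k l := by
  simp only [permAvg]
  rw [← Equiv.sum_comp (Equiv.mulLeft τ) (fun σ : Equiv.Perm (Fin N) => ∏ i, M (k i) (l (σ i)))]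
  rfl

theorem permAvg_comp_left (M : I → J → ℝ) (k : Fin N → I) (l : Fin N → J)
    (τ : Equiv.Perm (Fin N)) : permAvg M (k ∘ τ) l = permAvg M k l := by
  simp only [permAvg]
  rw [← Equiv.sum_comp (Equiv.mulRight τ) (fun σ : Equiv.Perm (Fin N) => ∏ i, M _ (l (σ i)))]
  congr 1
  refine Finset.sum_congr rfl fun σ _ => ?_
  exact Equiv.prod_comp τ fun i => M (k i) (l (σ i))

variable [Fintype I] [Fintype J] [Fintype I'] [Fintype J'] {p : I → ℝ} {q : J → ℝ}

theorem pairExp_eq_iidExp (Φ : (Fin N → I) → (Fin N → J) → ℝ) :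
    pairExp p q N Φ = iidExp (fun z : I × J => p z.1 * q z.2) N
      (fun z => Φ (Prod.fst ∘ z) (Prod.snd ∘ z)) := by
  simp only [pairExp, iidExp, Finset.mul_sum]
  rw [← (Equiv.arrowProdEquivProdArrow (Fin N) (fun _ => I) (fun _ => J)).symm.sum_comp,
    Fintype.sum_prod_type]
  refine Finset.sum_congr rfl fun k _ => Finset.sum_congr rfl fun l _ => ?_
  simp [Finset.prod_mul_distrib, Equiv.arrowProdEquivProdArrow, mul_assoc, Function.comp_def]

theorem pairExp_prod_perm_mul (M : I → J → ℝ) {Ψ : (Fin N → I) → (Fin N → J) → ℝ}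
    (hΨ : ∀ k l (σ : Equiv.Perm (Fin N)), Ψ k (l ∘ σ) = Ψ k l) (σ : Equiv.Perm (Fin N)) :
    pairExp p q N (fun k l => (∏ i, M (k i) (l (σ i))) * Ψ k l) =
      iidExp (fun z : I × J => p z.1 * q z.2 * M z.1 z.2) N
        (fun z => Ψ (Prod.fst ∘ z) (Prod.snd ∘ z)) := by
  calc pairExp p q N (fun k l => (∏ i, M (k i) (l (σ i))) * Ψ k l)
      = pairExp p q N (fun k l => (∏ i, M (k i) (l i)) * Ψ k l) := by
        refine congrArg (iidExp p N) (funext fun k => ?_)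
        rw [← iidExp_comp_perm σ fun l => (∏ i, M (k i) (l i)) * Ψ k l]
        simp only [hΨ, Function.comp_apply]
    _ = _ := by
        simp only [pairExp_eq_iidExp, iidExp, ← mul_assoc, ← Finset.prod_mul_distrib,
          Function.comp_apply]

-- `permAvg M` is the density of the shuffled pair sample drawn from `p q M`.
theorem pairExp_permAvg_mul (M : I → J → ℝ) {Ψ : (Fin N → I) → (Fin N → J) → ℝ}
    (hΨ : ∀ k l (σ : Equiv.Perm (Fin N)), Ψ k (l ∘ σ) = Ψ k l) :
    pairExp p q N (fun k l => permAvg M k l * Ψ k l) =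
      iidExp (fun z : I × J => p z.1 * q z.2 * M z.1 z.2) N
        (fun z => Ψ (Prod.fst ∘ z) (Prod.snd ∘ z)) := by
  have h : pairExp p q N (fun k l => permAvg M k l * Ψ k l) = (N.factorial : ℝ)⁻¹ *
      ∑ σ : Equiv.Perm (Fin N), pairExp p q N (fun k l => (∏ i, M (k i) (l (σ i))) * Ψ k l) := by
    simp only [pairExp, permAvg, ← iidExp_sum, ← iidExp_const_mul, mul_assoc, Finset.sum_mul]
  rw [h, Finset.sum_congr rfl fun σ _ => pairExp_prod_perm_mul M hΨ σ, Finset.sum_const,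
    Finset.card_univ, Fintype.card_perm, Fintype.card_fin, nsmul_eq_mul, ← mul_assoc,
    inv_mul_cancel₀ (by positivity), one_mul]

variable [DecidableEq I'] [DecidableEq J']

theorem iidExp_prodMap (w : I × J → ℝ) (c : I → I') (d : J → J')
    (Φ : (Fin N → I') → (Fin N → J') → ℝ) :
    iidExp w N (fun z => Φ (c ∘ Prod.fst ∘ z) (d ∘ Prod.snd ∘ z))
      = iidExp (fun z' : I' × J' => ∑ k with c k = z'.1, ∑ l with d l = z'.2, w (k, l)) N
        (fun z' => Φ (Prod.fst ∘ z') (Prod.snd ∘ z')) := by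
  have h := iidExp_map (w := w) (Prod.map c d)
    fun z' : Fin N → I' × J' => Φ (Prod.fst ∘ z') (Prod.snd ∘ z')
  refine h.trans (congrArg (fun v => iidExp v N _) (funext fun z' => ?_))
  rw [← Finset.sum_product']
  refine Finset.sum_congr ?_ fun _ _ => rfl
  ext z
  simp [Prod.ext_iff]

theorem pairExp_map (c : I → I') (d : J → J') (Φ : (Fin N → I') → (Fin N → J') → ℝ) :
    pairExp p q N (fun k l => Φ (c ∘ k) (d ∘ l))
      = pairExp (fun k' => ∑ k with c k = k', p k) (fun l' => ∑ l with d l = l', q l) N Φ := by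
  simp only [pairExp]
  rw [← iidExp_map c fun k' => iidExp _ N fun l' => Φ k' l']
  simp only [← iidExp_map d]

theorem pairExp_permAvg_mul_permAvg_comp {p' : I' → ℝ} {q' : J' → ℝ} {M : I → J → ℝ}
    {M' : I' → J' → ℝ} (c : I → I') (d : J → J')
    (hM : ∀ k' l', p' k' * q' l' * M' k' l'
      = ∑ k with c k = k', ∑ l with d l = l', p k * q l * M k l) :
    pairExp p q N (fun k l => permAvg M k l * permAvg M' (c ∘ k) (d ∘ l))
      = pairExp p' q' N (fun k l => permAvg M' k l ^ 2) := by
  simp_rw [pow_two]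
  rw [pairExp_permAvg_mul M fun k l σ => permAvg_comp_right M' (c ∘ k) (d ∘ l) σ,
    pairExp_permAvg_mul M' fun k l σ => permAvg_comp_right M' k l σ]
  simp only [hM]
  exact iidExp_prodMap (fun z : I × J => p z.1 * q z.2 * M z.1 z.2) c d (permAvg M')

-- Pythagoras: the coarse permutation average is a conditional expectation of the fine one.
theorem pairExp_permAvg_sub_sq {p' : I' → ℝ} {q' : J' → ℝ} {M : I → J → ℝ} {M' : I' → J' → ℝ}
    (c : I → I') (d : J → J') (hp : ∀ k', p' k' = ∑ k with c k = k', p k)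
    (hq : ∀ l', q' l' = ∑ l with d l = l', q l)
    (hM : ∀ k' l', p' k' * q' l' * M' k' l'
      = ∑ k with c k = k', ∑ l with d l = l', p k * q l * M k l) :
    pairExp p q N (fun k l => (permAvg M k l - permAvg M' (c ∘ k) (d ∘ l)) ^ 2)
      = pairExp p q N (fun k l => permAvg M k l ^ 2)
        - pairExp p' q' N (fun k l => permAvg M' k l ^ 2) := by
  have hexp : pairExp p q N (fun k l => (permAvg M k l - permAvg M' (c ∘ k) (d ∘ l)) ^ 2)
      = pairExp p q N (fun k l => permAvg M k l ^ 2)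
        + -2 * pairExp p q N (fun k l => permAvg M k l * permAvg M' (c ∘ k) (d ∘ l))
        + pairExp p q N (fun k l => permAvg M' (c ∘ k) (d ∘ l) ^ 2) := by
    simp only [pairExp, ← iidExp_const_mul, ← iidExp_add]
    refine congrArg _ (funext fun k => congrArg _ (funext fun l => ?_))
    ring
  rw [hexp, pairExp_permAvg_mul_permAvg_comp c d hM,
    pairExp_map c d fun k' l' => permAvg M' k' l' ^ 2, ← funext hp, ← funext hq]
  ring

end PermAvg

/-! ### Second moments of permutation averages -/

section HomogSum

variable {R : Type*} [Fintype R] [DecidableEq R]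

/-- The complete homogeneous symmetric polynomial of degree `n`, evaluated at `a`. -/
def homogSum (a : R → ℝ) (n : ℕ) : ℝ :=
  ∑ k ∈ Finset.piAntidiag Finset.univ n, ∏ r, a r ^ k r

theorem homogSum_option_elim_one (a : R → ℝ) (n : ℕ) :
    homogSum (fun o : Option R => o.elim 1 a) n = ∑ m ∈ Finset.range (n + 1), homogSum a m := by
  simp only [homogSum]
  rw [Finset.sum_sigma']
  refine Finset.sum_bij' (fun k _ => ⟨∑ r, k (some r), fun r => k (some r)⟩)
    (fun x _ o => o.elim (n - x.1) x.2) (fun k hk => ?_) (fun x hx => ?_) (fun k hk => ?_)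
    (fun x hx => ?_) (fun k _ => ?_)
  · simp only [Finset.mem_piAntidiag, Fintype.sum_option] at hk
    simp only [Finset.mem_sigma, Finset.mem_range, Finset.mem_piAntidiag, Finset.mem_univ,
      implies_true, and_true]
    lia
  · simp only [Finset.mem_sigma, Finset.mem_range, Finset.mem_piAntidiag] at hx
    simp only [Finset.mem_piAntidiag, Fintype.sum_option, Option.elim_none, Option.elim_some,
      hx.2.1, Finset.mem_univ, implies_true, and_true]
    lia
  · simp only [Finset.mem_piAntidiag, Fintype.sum_option] at hk
    funext o
    cases o
    · simp only [Option.elim_none]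
      lia
    · rfl
  · simp only [Finset.mem_sigma, Finset.mem_piAntidiag] at hx
    simp [hx.2.1]
  · simp [Fintype.prod_option]

theorem sum_homogSum_le {a : R → ℝ} (h0 : ∀ r, 0 ≤ a r) (h1 : ∀ r, a r < 1) (n : ℕ) :
    ∑ m ∈ Finset.range (n + 1), homogSum a m ≤ ∏ r, (1 - a r)⁻¹ := by
  let S : Finset (R → ℕ) := Fintype.piFinset fun _ => Finset.range (n + 1)
  have hS : ∀ m ∈ Finset.range (n + 1), Finset.piAntidiag Finset.univ m
      = {k ∈ S | ∑ r, k r ∈ Finset.range (n + 1)}.filter fun k => ∑ r, k r = m := fun m hm => by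
    ext k
    simp only [S, Finset.mem_piAntidiag, Finset.mem_univ, implies_true, and_true,
      Finset.mem_filter, Fintype.mem_piFinset, Finset.mem_range]
    refine ⟨fun h => ⟨⟨fun r => ?_, h ▸ Finset.mem_range.1 hm⟩, h⟩, fun h => h.2⟩
    exact (Finset.single_le_sum (fun r _ => Nat.zero_le (k r)) (Finset.mem_univ r)).trans_lt
      (h ▸ Finset.mem_range.1 hm)
  have hprod0 : ∀ k : R → ℕ, 0 ≤ ∏ r, a r ^ k r := fun k =>
    Finset.prod_nonneg fun r _ => pow_nonneg (h0 r) _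
  calc ∑ m ∈ Finset.range (n + 1), homogSum a m
      = ∑ k ∈ S with ∑ r, k r ∈ Finset.range (n + 1), ∏ r, a r ^ k r := by
        rw [← Finset.sum_fiberwise_of_maps_to fun k hk => (Finset.mem_filter.1 hk).2]
        exact Finset.sum_congr rfl fun m hm => by rw [homogSum, hS m hm]
    _ ≤ ∑ k ∈ S, ∏ r, a r ^ k r :=
        Finset.sum_le_sum_of_subset_of_nonneg (Finset.filter_subset _ _) fun k _ _ => hprod0 k
    _ = ∏ r, ∑ j ∈ Finset.range (n + 1), a r ^ j := (Finset.prod_univ_sum _ _).symm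
    _ ≤ ∏ r, (1 - a r)⁻¹ := by
        refine Finset.prod_le_prod (fun r _ => Finset.sum_nonneg fun j _ => pow_nonneg (h0 r) j)
          fun r _ => ?_
        rw [← tsum_geometric_of_lt_one (h0 r) (h1 r)]
        exact (summable_geometric_of_lt_one (h0 r) (h1 r)).sum_le_tsum _
          fun j _ => pow_nonneg (h0 r) j

theorem iidExp_comp_labelCount (w : R → ℝ) (N : ℕ) (Φ : (R → ℕ) → ℝ) :
    iidExp w N (fun z => Φ (labelCount z))
      = ∑ n ∈ Finset.piAntidiag Finset.univ N, multinomialProb w n * Φ n := by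
  have h : ∀ z : Fin N → R, Φ (labelCount z) = ∑ n ∈ Finset.piAntidiag Finset.univ N,
      Φ n * if labelCount z = n then 1 else 0 := fun z => by
    simp [sum_labelCount z]
  simp only [h, iidExp_sum, iidExp_const_mul]
  refine Finset.sum_congr rfl fun n hn => ?_
  rw [iidExp_labelCount_eq w (Finset.mem_piAntidiag.1 hn).1, mul_comm]

theorem sum_multinomialProb {w : R → ℝ} (hw : ∑ a, w a = 1) (N : ℕ) :
    ∑ n ∈ Finset.piAntidiag Finset.univ N, multinomialProb w n = 1 := by
  simpa [iidExp_const hw] using (iidExp_comp_labelCount w N fun _ => 1).symm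

theorem card_filter_comp_eq_self {N : ℕ} (g : Fin N → R) :
    Finset.card {σ : Equiv.Perm (Fin N) | g ∘ σ = g} = ∏ r, (labelCount g r).factorial := by
  rw [← Fintype.card_subtype, DomMulAct.stabilizer_card g]
  simp only [labelCount, Fintype.card_subtype]

theorem sum_sum_comp_eq_self (a : R → ℝ) (N : ℕ) :
    ∑ σ : Equiv.Perm (Fin N), ∑ g : Fin N → R, (if g ∘ σ = g then ∏ i, a (g i) else 0)
      = N.factorial * homogSum a N := by
  rw [Finset.sum_comm]
  calc ∑ g : Fin N → R, ∑ σ : Equiv.Perm (Fin N), (if g ∘ σ = g then ∏ i, a (g i) else 0)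
      = iidExp a N (fun g => ((∏ r, (labelCount g r).factorial : ℕ) : ℝ)) := by
        refine Finset.sum_congr rfl fun g _ => ?_
        beta_reduce
        rw [← card_filter_comp_eq_self, ← Finset.sum_filter, Finset.sum_const, nsmul_eq_mul,
          mul_comm]
    _ = N.factorial * homogSum a N := by
        rw [iidExp_comp_labelCount a N fun n => ((∏ r, (n r).factorial : ℕ) : ℝ), homogSum,
          Finset.mul_sum]
        refine Finset.sum_congr rfl fun n hn => ?_
        rw [← (Finset.mem_piAntidiag.1 hn).1, ← Nat.multinomial_spec, multinomialProb]
        push_cast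
        ring

end HomogSum

section Gram

variable {I J R : Type*} [Fintype I] [Fintype J] [Fintype R] [DecidableEq R]

/-- The matrix of `M Mᵀ`, where `M` acts from `L²(q)` to `L²(p)`, in the orthonormal basis of
normalized indicators of `L²(p)`. -/
noncomputable def gram (p : I → ℝ) (q : J → ℝ) (M : I → J → ℝ) : Matrix I I ℝ :=
  Matrix.of fun k k' => √(p k) * √(p k') * ∑ l, q l * (M k l * M k' l)

variable {p : I → ℝ} {q : J → ℝ}

theorem pairExp_permAvg_sq_eq_sum_gram (hp : ∀ k, 0 ≤ p k) (M : I → J → ℝ) (N : ℕ) :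
    pairExp p q N (fun k l => permAvg M k l ^ 2) = (N.factorial : ℝ)⁻¹ *
      ∑ σ : Equiv.Perm (Fin N), ∑ k : Fin N → I, ∏ i, gram p q M (k i) (k (σ i)) := by
  have hσ : ∀ σ : Equiv.Perm (Fin N), pairExp p q N
      (fun k l => (∏ i, M (k i) (l i)) * ∏ i, M (k i) (l (σ.symm i)))
      = ∑ k : Fin N → I, ∏ i, gram p q M (k i) (k (σ i)) := fun σ => by
    refine Finset.sum_congr rfl fun k _ => ?_
    have hl : ∀ l : Fin N → J, (∏ i, M (k i) (l i)) * ∏ i, M (k i) (l (σ.symm i))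
        = ∏ i, M (k i) (l i) * M (k (σ i)) (l i) := fun l => by
      rw [← Equiv.prod_comp σ fun i => M (k i) (l (σ.symm i)), ← Finset.prod_mul_distrib]
      simp only [Equiv.symm_apply_apply]
    have hpk : ∏ i, p (k i) = ∏ i, √(p (k i)) * √(p (k (σ i))) := by
      rw [Finset.prod_mul_distrib, Equiv.prod_comp σ fun i => √(p (k i)),
        ← Finset.prod_mul_distrib]
      simp only [Real.mul_self_sqrt (hp _)]
    simp only [hl]
    rw [iidExp_prod fun i l => M (k i) l * M (k (σ i)) l, hpk, ← Finset.prod_mul_distrib]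
    rfl
  simp only [pow_two]
  rw [pairExp_permAvg_mul M (permAvg_comp_right M),
    ← pairExp_prod_perm_mul M (permAvg_comp_right M) 1]
  simp only [← hσ, pairExp, ← iidExp_sum, ← iidExp_const_mul]
  congr! 4 with k l
  rw [permAvg, ← Equiv.sum_comp (Equiv.inv (Equiv.Perm (Fin N)))]
  simp only [Finset.mul_sum, Equiv.inv_apply, Equiv.Perm.inv_def, Equiv.Perm.one_apply,
    mul_left_comm]

/-- A decomposition of the symmetric matrix `A` along the orthonormal eigenvectors `u`, with
eigenvalues `a`. -/
structure IsSpectralDecomp (A : Matrix I I ℝ) (a : R → ℝ) (u : R → I → ℝ) : Prop where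
  orthonormal : ∀ r t, ∑ k, u r k * u t k = if r = t then 1 else 0
  eq_sum : ∀ k k', A k k' = ∑ r, a r * (u r k * u r k')

theorem exists_isSpectralDecomp [DecidableEq I] {A : Matrix I I ℝ} (hA : A.IsHermitian) :
    ∃ (s : Finset I) (a : s → ℝ) (u : s → I → ℝ), IsSpectralDecomp A a u ∧ ∀ r, a r ≠ 0 := by
  let a := hA.eigenvalues
  let u : I → I → ℝ := fun r k => hA.eigenvectorBasis r k
  have hu : ∀ r t, ∑ k, u r k * u t k = if r = t then 1 else 0 := fun r t => by
    rw [← hA.eigenvectorBasis.inner_eq_ite r t, PiLp.inner_apply]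
    exact Finset.sum_congr rfl fun k _ => mul_comm _ _
  have hAu : ∀ k k', A k k' = ∑ r, a r * (u r k * u r k') := fun k k' => by
    conv_lhs => rw [hA.spectral_theorem, Unitary.conjStarAlgAut_apply]
    rw [Matrix.mul_apply]
    refine Finset.sum_congr rfl fun r _ => ?_
    simp only [Matrix.mul_diagonal, Matrix.IsHermitian.eigenvectorUnitary_apply,
      Matrix.star_apply, Function.comp, RCLike.ofReal_real_eq_id, id, star_trivial]
    ring
  refine ⟨({r | a r ≠ 0} : Finset I), fun r => a r, fun r => u r, ⟨fun r t => ?_, fun k k' => ?_⟩,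
    fun r => (Finset.mem_filter.1 r.2).2⟩
  · rw [hu]
    simp only [Subtype.ext_iff]
  · rw [hAu, Finset.sum_coe_sort _ fun r => a r * (u r k * u r k'), Finset.sum_filter_of_ne]
    exact fun r _ => left_ne_zero_of_mul

namespace IsSpectralDecomp

variable {A : Matrix I I ℝ} {a : R → ℝ} {u : R → I → ℝ} (h : IsSpectralDecomp A a u)
include h

theorem sum_mul (r : R) (v : I → ℝ) :
    ∑ k, u r k * ∑ k', A k k' * v k' = a r * ∑ k, u r k * v k := by
  calc ∑ k, u r k * ∑ k', A k k' * v k'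
      = ∑ k', ∑ t, (∑ k, u r k * u t k) * (a t * (u t k' * v k')) := by
        simp only [h.eq_sum, Finset.sum_mul, Finset.mul_sum]
        rw [Finset.sum_comm]
        refine Finset.sum_congr rfl fun k' _ => ?_
        rw [Finset.sum_comm]
        exact Finset.sum_congr rfl fun t _ => Finset.sum_congr rfl fun k _ => by ring
    _ = a r * ∑ k, u r k * v k := by
        simp only [h.orthonormal, ite_mul, one_mul, zero_mul, Finset.sum_ite_eq, Finset.mem_univ,
          if_true, Finset.mul_sum]

theorem sum_eq_trace : ∑ r, a r = A.trace := by
  simp only [Matrix.trace, Matrix.diag_apply, h.eq_sum]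
  rw [Finset.sum_comm]
  simp only [← Finset.mul_sum, h.orthonormal, if_true, mul_one]

theorem sum_prod_comp_perm {N : ℕ} (σ : Equiv.Perm (Fin N)) :
    ∑ k : Fin N → I, ∏ i, A (k i) (k (σ i))
      = ∑ g : Fin N → R, if g ∘ σ = g then ∏ i, a (g i) else 0 := by
  classical
  have hg : ∀ g : Fin N → R, ∑ k : Fin N → I, ∏ i, u (g i) (k i) * u (g i) (k (σ i))
      = if g ∘ σ = g then 1 else 0 := fun g => by
    have hk : ∀ k : Fin N → I, ∏ i, u (g i) (k i) * u (g i) (k (σ i))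
        = ∏ i, u (g (σ i)) (k (σ i)) * u (g i) (k (σ i)) := fun k => by
      rw [Finset.prod_mul_distrib, ← Equiv.prod_comp σ fun i => u (g i) (k i),
        ← Finset.prod_mul_distrib]
    simp only [hk]
    refine (Equiv.sum_comp (Equiv.arrowCongr σ.symm (Equiv.refl I))
      fun k : Fin N → I => ∏ i, u (g (σ i)) (k i) * u (g i) (k i)).trans ?_
    rw [← Fintype.piFinset_univ,
      ← Finset.prod_univ_sum (fun _ => Finset.univ) fun i k => u (g (σ i)) k * u (g i) k]
    simp only [h.orthonormal, Finset.prod_ite_zero, Finset.prod_const_one, Finset.mem_univ,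
      true_implies, funext_iff, Function.comp_apply]
  simp_rw [h.eq_sum, Finset.prod_univ_sum, Fintype.piFinset_univ]
  rw [Finset.sum_comm]
  refine Finset.sum_congr rfl fun g _ => ?_
  simp only [Finset.prod_mul_distrib (f := fun i => a (g i)), ← Finset.mul_sum, hg, mul_ite,
    mul_one, mul_zero]

end IsSpectralDecomp

omit [Fintype I] in
theorem isHermitian_gram (p : I → ℝ) (q : J → ℝ) (M : I → J → ℝ) : (gram p q M).IsHermitian :=
  Matrix.IsHermitian.ext fun k k' => by
    simp only [gram, Matrix.of_apply, star_trivial, mul_comm]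

theorem trace_gram (hp : ∀ k, 0 ≤ p k) (M : I → J → ℝ) :
    (gram p q M).trace = ∑ k, ∑ l, p k * q l * M k l ^ 2 := by
  simp only [Matrix.trace, Matrix.diag_apply, gram, Matrix.of_apply, Real.mul_self_sqrt (hp _)]
  simp only [Finset.mul_sum, mul_assoc, pow_two]

theorem sum_mul_gram_mul (M : I → J → ℝ) (x y : I → ℝ) :
    ∑ k, x k * ∑ k', gram p q M k k' * y k'
      = ∑ l, q l * ((∑ k, √(p k) * x k * M k l) * ∑ k, √(p k) * y k * M k l) := by
  simp only [gram, Matrix.of_apply, Finset.sum_mul_sum]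
  simp only [Finset.mul_sum, Finset.sum_mul]
  rw [Finset.sum_comm (s := (Finset.univ : Finset J))]
  refine Finset.sum_congr rfl fun k _ => ?_
  rw [Finset.sum_comm]
  exact Finset.sum_congr rfl fun l _ => Finset.sum_congr rfl fun k' _ => by ring

theorem pairExp_permAvg_sq {M : I → J → ℝ} {a : R → ℝ} {u : R → I → ℝ} (hp : ∀ k, 0 ≤ p k)
    (h : IsSpectralDecomp (gram p q M) a u) (N : ℕ) :
    pairExp p q N (fun k l => permAvg M k l ^ 2) = homogSum a N := by
  rw [pairExp_permAvg_sq_eq_sum_gram hp]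
  simp only [h.sum_prod_comp_perm, sum_sum_comp_eq_self]
  exact inv_mul_cancel_left₀ (by positivity) _

end Gram

/-! ### Kernels on finite spaces with unit marginals -/

/-- A positive kernel on a product of two finite probability spaces, with both marginals equal
to one: the density of a coupling of `p` and `q` with respect to their product. -/
structure BlockKernel (I J : Type*) [Fintype I] [Fintype J] where
  p : I → ℝ
  q : J → ℝ
  M : I → J → ℝ
  p_nonneg : ∀ k, 0 ≤ p k
  q_nonneg : ∀ l, 0 ≤ q l
  sum_p : ∑ k, p k = 1
  sum_q : ∑ l, q l = 1
  M_pos : ∀ k l, 0 < M k l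
  row : ∀ k, ∑ l, q l * M k l = 1
  col : ∀ l, ∑ k, p k * M k l = 1

namespace BlockKernel

variable {I J : Type*} [Fintype I] [Fintype J] (B : BlockKernel I J)

/-- The centred kernel, which acts as the conditional expectation operator on functions of mean
zero and kills the constants. -/
def ctr (k : I) (l : J) : ℝ := B.M k l - 1

/-- The squared Hilbert–Schmidt norm of the centred kernel. -/
noncomputable def hs : ℝ := ∑ k, ∑ l, B.p k * B.q l * B.ctr k l ^ 2

/-- A spectral gap: the centred kernel has operator norm at most `s` from `L²(q)` to `L²(p)`. -/
def HasGap (s : ℝ) : Prop := ∀ (f : I → ℝ) (g : J → ℝ),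
  (∑ k, ∑ l, B.p k * B.q l * B.ctr k l * (f k * g l)) ^ 2 ≤
    s ^ 2 * (∑ k, B.p k * f k ^ 2) * ∑ l, B.q l * g l ^ 2

/-- The `m`-th term of the chaos decomposition of the second moment of the permutation average. -/
noncomputable def chaos (m : ℕ) : ℝ := pairExp B.p B.q m fun k l => permAvg B.ctr k l ^ 2

theorem row_ctr (k : I) : ∑ l, B.q l * B.ctr k l = 0 := by
  simp [ctr, mul_sub, Finset.sum_sub_distrib, B.row, B.sum_q]

theorem col_ctr (l : J) : ∑ k, B.p k * B.ctr k l = 0 := by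
  simp [ctr, mul_sub, Finset.sum_sub_distrib, B.col, B.sum_p]

theorem pairExp_nonneg {N : ℕ} {Φ : (Fin N → I) → (Fin N → J) → ℝ} (h : ∀ k l, 0 ≤ Φ k l) :
    0 ≤ pairExp B.p B.q N Φ :=
  iidExp_nonneg B.p_nonneg fun k => iidExp_nonneg B.q_nonneg fun l => h k l

theorem chaos_nonneg (m : ℕ) : 0 ≤ B.chaos m := B.pairExp_nonneg fun _ _ => sq_nonneg _

theorem hs_eq : B.hs = (∑ k, ∑ l, B.p k * B.q l * B.M k l ^ 2) - 1 := by
  have hrow : ∀ k, ∑ l, B.p k * B.q l * B.ctr k l ^ 2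
      = (∑ l, B.p k * B.q l * B.M k l ^ 2) - B.p k := fun k => by
    have hsplit : ∀ l, B.p k * B.q l * B.ctr k l ^ 2 = B.p k * B.q l * B.M k l ^ 2
        - B.p k * (B.q l * B.M k l) - B.p k * (B.q l * B.ctr k l) := fun l => by
      rw [ctr]
      ring
    simp only [hsplit, Finset.sum_sub_distrib, ← Finset.mul_sum, B.row, B.row_ctr]
    ring
  simp only [hs, hrow, Finset.sum_sub_distrib, B.sum_p]

theorem gram_eq_add_gram_ctr (k k' : I) :
    gram B.p B.q B.M k k' = √(B.p k) * √(B.p k') + gram B.p B.q B.ctr k k' := by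
  have h : ∑ l, B.q l * (B.M k l * B.M k' l) = 1 + ∑ l, B.q l * (B.ctr k l * B.ctr k' l) := by
    have e : ∀ l, B.q l * (B.M k l * B.M k' l)
        = B.q l * B.M k l + B.q l * B.ctr k' l + B.q l * (B.ctr k l * B.ctr k' l) := fun l => by
      simp only [ctr]
      ring
    simp only [e, Finset.sum_add_distrib, B.row, B.row_ctr, add_zero]
  simp only [gram, Matrix.of_apply, h, mul_add, mul_one]

section Spectral

variable {B} {R : Type*} [Fintype R] [DecidableEq R] {a : R → ℝ} {u : R → I → ℝ}
  (h : IsSpectralDecomp (gram B.p B.q B.ctr) a u)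
include h

theorem sum_eigenvalue : ∑ r, a r = B.hs := by
  rw [h.sum_eq_trace, trace_gram B.p_nonneg, hs]

theorem sum_eigenvector_mul_sqrt {r : R} (hr : a r ≠ 0) : ∑ k, u r k * √(B.p k) = 0 := by
  have h0 : ∀ l, ∑ k, √(B.p k) * √(B.p k) * B.ctr k l = 0 := fun l => by
    simp only [Real.mul_self_sqrt (B.p_nonneg _), B.col_ctr]
  have := h.sum_mul r fun k => √(B.p k)
  rw [sum_mul_gram_mul] at this
  simpa [h0, hr] using this

theorem eigenvalue_eq (r : R) :
    a r = ∑ l, B.q l * (∑ k, √(B.p k) * u r k * B.ctr k l) ^ 2 := by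
  have := h.sum_mul r (u r)
  rw [sum_mul_gram_mul, h.orthonormal, if_pos rfl, mul_one] at this
  simpa only [pow_two] using this.symm

theorem eigenvalue_nonneg (r : R) : 0 ≤ a r := by
  rw [eigenvalue_eq h]
  exact Finset.sum_nonneg fun l _ => mul_nonneg (B.q_nonneg l) (sq_nonneg _)

theorem eigenvalue_le {s : ℝ} (hgap : B.HasGap s) (r : R) : a r ≤ s ^ 2 := by
  let g : J → ℝ := fun l => ∑ k, √(B.p k) * u r k * B.ctr k l
  have hfg : ∑ k, ∑ l, B.p k * B.q l * B.ctr k l * (u r k / √(B.p k) * g l) = a r := by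
    rw [eigenvalue_eq h, Finset.sum_comm]
    refine Finset.sum_congr rfl fun l _ => ?_
    change _ = B.q l * g l ^ 2
    rw [pow_two, ← mul_assoc, Finset.mul_sum]
    refine Finset.sum_congr rfl fun k _ => ?_
    calc B.p k * B.q l * B.ctr k l * (u r k / √(B.p k) * g l)
        = B.q l * g l * (B.p k / √(B.p k) * u r k * B.ctr k l) := by ring
      _ = B.q l * g l * (√(B.p k) * u r k * B.ctr k l) := by rw [Real.div_sqrt]
  have hf : ∑ k, B.p k * (u r k / √(B.p k)) ^ 2 ≤ 1 := by
    rw [← (h.orthonormal r r).trans (if_pos rfl)]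
    refine Finset.sum_le_sum fun k _ => ?_
    rw [div_pow, Real.sq_sqrt (B.p_nonneg k), ← pow_two]
    exact (mul_div_left_comm _ _ _).trans_le
      (mul_le_of_le_one_right (sq_nonneg _) (div_self_le_one _))
  have hle : a r * a r ≤ s ^ 2 * a r := by
    calc a r * a r ≤ s ^ 2 * (∑ k, B.p k * (u r k / √(B.p k)) ^ 2) * a r := by
          have := hgap (fun k => u r k / √(B.p k)) g
          rwa [hfg, ← eigenvalue_eq h, pow_two] at this
      _ ≤ s ^ 2 * a r :=
          mul_le_mul_of_nonneg_right (mul_le_of_le_one_right (sq_nonneg s) hf)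
            (eigenvalue_nonneg h r)
  rcases (eigenvalue_nonneg h r).eq_or_lt with hr | hr
  · exact hr ▸ sq_nonneg s
  · exact le_of_mul_le_mul_right hle hr

end Spectral

theorem pairExp_sq_eq_sum_chaos (N : ℕ) :
    pairExp B.p B.q N (fun k l => permAvg B.M k l ^ 2)
      = ∑ m ∈ Finset.range (N + 1), B.chaos m := by
  classical
  obtain ⟨t, a, u, h, ha⟩ := exists_isSpectralDecomp (isHermitian_gram B.p B.q B.ctr)
  simp only [chaos, pairExp_permAvg_sq B.p_nonneg h]
  rw [← homogSum_option_elim_one]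
  refine pairExp_permAvg_sq (u := fun o => o.elim (fun k => √(B.p k)) u) B.p_nonneg
    ⟨?_, fun k k' => ?_⟩ N
  · rintro (_ | r) (_ | r')
    · simp [Real.mul_self_sqrt (B.p_nonneg _), B.sum_p]
    · simpa [mul_comm] using sum_eigenvector_mul_sqrt h (ha r')
    · simpa using sum_eigenvector_mul_sqrt h (ha r)
    · simpa using h.orthonormal r r'
  · rw [gram_eq_add_gram_ctr, h.eq_sum, Fintype.sum_option]
    simp only [Option.elim_none, Option.elim_some, one_mul]

theorem sum_chaos_le {s : ℝ} (hgap : B.HasGap s) (hs0 : 0 ≤ s) (hs1 : s < 1) (N : ℕ) :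
    ∑ m ∈ Finset.range (N + 1), B.chaos m ≤ Real.exp (B.hs / (1 - s ^ 2)) := by
  classical
  obtain ⟨t, a, u, h, -⟩ := exists_isSpectralDecomp (isHermitian_gram B.p B.q B.ctr)
  have hs2 : s ^ 2 < 1 := pow_lt_one₀ hs0 hs1 two_ne_zero
  have hle : ∀ r, a r ≤ s ^ 2 := eigenvalue_le h hgap
  calc ∑ m ∈ Finset.range (N + 1), B.chaos m
      = ∑ m ∈ Finset.range (N + 1), homogSum a m := by
        simp only [chaos, pairExp_permAvg_sq B.p_nonneg h]
    _ ≤ ∏ r, (1 - a r)⁻¹ :=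
        sum_homogSum_le (eigenvalue_nonneg h) (fun r => (hle r).trans_lt hs2) N
    _ ≤ ∏ r, Real.exp (a r / (1 - s ^ 2)) := by
        refine Finset.prod_le_prod (fun r _ => inv_nonneg.2 (by linarith [hle r])) fun r _ => ?_
        have hpos : 0 < 1 - a r := by linarith [hle r]
        have hinv : (1 - a r)⁻¹ = a r / (1 - a r) + 1 := by
          field_simp
          ring
        rw [hinv]
        refine (Real.add_one_le_exp _).trans (Real.exp_le_exp.2 ?_)
        exact div_le_div_of_nonneg_left (eigenvalue_nonneg h r) (by linarith) (by linarith [hle r])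
    _ = Real.exp (B.hs / (1 - s ^ 2)) := by
        rw [← Real.exp_sum, ← Finset.sum_div, sum_eigenvalue h]

end BlockKernel

/-- `B'` is obtained from `B` by merging indices along `c` and `d` and averaging the kernel. -/
structure BlockKernel.Refines {I J I' J' : Type*} [Fintype I] [Fintype J] [Fintype I']
    [Fintype J'] [DecidableEq I'] [DecidableEq J'] (B : BlockKernel I J) (B' : BlockKernel I' J')
    (c : I → I') (d : J → J') : Prop where
  p_eq : ∀ k', B'.p k' = ∑ k with c k = k', B.p k
  q_eq : ∀ l', B'.q l' = ∑ l with d l = l', B.q l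
  M_eq : ∀ k' l', B'.p k' * B'.q l' * B'.M k' l'
      = ∑ k with c k = k', ∑ l with d l = l', B.p k * B.q l * B.M k l

namespace BlockKernel.Refines

variable {I J I' J' : Type*} [Fintype I] [Fintype J] [Fintype I'] [Fintype J'] [DecidableEq I']
  [DecidableEq J'] {B : BlockKernel I J} {B' : BlockKernel I' J'} {c : I → I'} {d : J → J'}

theorem chaos_le (h : B.Refines B' c d) (m : ℕ) : B'.chaos m ≤ B.chaos m := by
  have hctr : ∀ k' l', B'.p k' * B'.q l' * B'.ctr k' l'
      = ∑ k with c k = k', ∑ l with d l = l', B.p k * B.q l * B.ctr k l := fun k' l' => by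
    simp only [BlockKernel.ctr, mul_sub, mul_one, Finset.sum_sub_distrib]
    rw [h.M_eq, h.p_eq, h.q_eq, Finset.sum_mul_sum]
  rw [← sub_nonneg, chaos, chaos, ← pairExp_permAvg_sub_sq c d h.p_eq h.q_eq hctr]
  exact B.pairExp_nonneg fun _ _ => sq_nonneg _

theorem pairExp_sub_sq (h : B.Refines B' c d) (N : ℕ) :
    pairExp B.p B.q N (fun k l => (permAvg B.M k l - permAvg B'.M (c ∘ k) (d ∘ l)) ^ 2)
      = ∑ m ∈ Finset.range (N + 1), (B.chaos m - B'.chaos m) := by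
  rw [pairExp_permAvg_sub_sq c d h.p_eq h.q_eq h.M_eq, B.pairExp_sq_eq_sum_chaos,
    B'.pairExp_sq_eq_sum_chaos, Finset.sum_sub_distrib]

end BlockKernel.Refines

/-! ### Contingency tables -/

section Table

variable {I J : Type*} [Fintype I] [Fintype J]

theorem exists_labelCount_eq [DecidableEq I] {N : ℕ} {n : I → ℕ} (hn : ∑ k, n k = N) :
    ∃ z : Fin N → I, labelCount z = n := by
  let e : (Σ k, Fin (n k)) ≃ Fin N := Fintype.equivFinOfCardEq (by simpa using hn)
  refine ⟨fun i => (e.symm i).1, funext fun k => ?_⟩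
  rw [labelCount, ← Fintype.card_subtype, ← Fintype.card_fin (n k)]
  exact Fintype.card_congr <| (e.symm.subtypeEquiv fun _ => Iff.rfl).trans (Equiv.sigmaSubtype k)

theorem exists_nat_table {r : I → ℕ} {c : J → ℕ} (h : ∑ k, r k = ∑ l, c l) :
    ∃ t : I × J → ℕ, (∀ k, ∑ l, t (k, l) = r k) ∧ ∀ l, ∑ k, t (k, l) = c l := by
  classical
  obtain ⟨y, hy⟩ := exists_labelCount_eq (n := r) rfl
  obtain ⟨z, hz⟩ := exists_labelCount_eq h.symm
  exact ⟨labelCount fun i => (y i, z i), fun k => (labelCount_fst _ k).symm.trans (congrFun hy k),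
    fun l => (labelCount_snd _ l).symm.trans (congrFun hz l)⟩

theorem sum_sub_floor_le_card (x : J → ℝ) : ∑ l, (x l - ⌊x l⌋) ≤ Fintype.card J := by
  refine (Finset.sum_le_card_nsmul _ _ 1 fun l _ => ?_).trans_eq (by simp)
  linarith [Int.lt_floor_add_one (x l)]

theorem exists_int_table_near {x : I × J → ℝ} {r : I → ℤ} {c : J → ℤ}
    (hr : ∀ k, ∑ l, x (k, l) = r k) (hc : ∀ l, ∑ k, x (k, l) = c l) :
    ∃ t : I × J → ℤ, (∀ k, ∑ l, t (k, l) = r k) ∧ (∀ l, ∑ k, t (k, l) = c l) ∧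
      ∀ z, |t z - x z| ≤ Fintype.card J := by
  have hr0 : ∀ k, ∑ l, ⌊x (k, l)⌋ ≤ r k := fun k => by
    have : (∑ l, ⌊x (k, l)⌋ : ℝ) ≤ r k := hr k ▸ Finset.sum_le_sum fun l _ => Int.floor_le _
    exact_mod_cast this
  have hc0 : ∀ l, ∑ k, ⌊x (k, l)⌋ ≤ c l := fun l => by
    have : (∑ k, ⌊x (k, l)⌋ : ℝ) ≤ c l := hc l ▸ Finset.sum_le_sum fun k _ => Int.floor_le _
    exact_mod_cast this
  choose r' hr' using fun k => Int.eq_ofNat_of_zero_le (sub_nonneg.2 (hr0 k))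
  choose c' hc' using fun l => Int.eq_ofNat_of_zero_le (sub_nonneg.2 (hc0 l))
  have hrc : ∑ k, r k = ∑ l, c l := by
    have : (∑ k, r k : ℝ) = ∑ l, (c l : ℝ) := by
      simp only [← hr, ← hc]
      exact Finset.sum_comm
    exact_mod_cast this
  have hrc' : ∑ k, r' k = ∑ l, c' l := by
    zify
    simp only [← hr', ← hc', Finset.sum_sub_distrib, hrc]
    rw [Finset.sum_comm]
  obtain ⟨t, htr, htc⟩ := exists_nat_table hrc'
  refine ⟨fun z => ⌊x z⌋ + t z, fun k => ?_, fun l => ?_, fun z => ?_⟩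
  · rw [Finset.sum_add_distrib, ← Nat.cast_sum, htr, ← hr', add_sub_cancel]
  · rw [Finset.sum_add_distrib, ← Nat.cast_sum, htc, ← hc', add_sub_cancel]
  · obtain ⟨k, l⟩ := z
    have hJ : (1 : ℝ) ≤ Fintype.card J := by exact_mod_cast Fintype.card_pos_iff.2 ⟨l⟩
    have htk : (t (k, l) : ℝ) ≤ ∑ l, (x (k, l) - ⌊x (k, l)⌋) := by
      have hk : ((r k - ∑ l, ⌊x (k, l)⌋ : ℤ) : ℝ) = r' k := by rw [hr']; rfl
      rw [Finset.sum_sub_distrib, hr]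
      push_cast at hk
      rw [hk, ← htr]
      exact_mod_cast Finset.single_le_sum (f := fun l => t (k, l)) (fun _ _ => Nat.zero_le _)
        (Finset.mem_univ l)
    have hle := sum_sub_floor_le_card fun l => x (k, l)
    push_cast
    rw [abs_le]
    constructor <;> linarith [Int.floor_le (x (k, l)), Int.lt_floor_add_one (x (k, l)),
      (t (k, l)).cast_nonneg (α := ℝ)]

theorem exists_nat_table_add {n₀ : I × J → ℕ} {u : I × J → ℤ} (hu : ∀ z, 0 ≤ n₀ z + u z)
    {r : I → ℕ} {c : J → ℕ} (hr : ∀ k, ∑ l, u (k, l) = (r k : ℤ) - ∑ l, (n₀ (k, l) : ℤ))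
    (hc : ∀ l, ∑ k, u (k, l) = (c l : ℤ) - ∑ k, (n₀ (k, l) : ℤ)) :
    ∃ n : I × J → ℕ, (∀ z, (n z : ℤ) = n₀ z + u z) ∧ (∀ k, ∑ l, n (k, l) = r k) ∧
      ∀ l, ∑ k, n (k, l) = c l := by
  choose n hn using fun z => Int.eq_ofNat_of_zero_le (hu z)
  refine ⟨n, fun z => (hn z).symm, fun k => ?_, fun l => ?_⟩ <;> zify
  · simp only [← hn, Finset.sum_add_distrib, hr, add_sub_cancel]
  · simp only [← hn, Finset.sum_add_distrib, hc, add_sub_cancel]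

theorem exists_nat_table_shift {x₀ x : I × J → ℝ} {r₀ r : I → ℕ} {c₀ c : J → ℕ}
    (hr₀ : ∀ k, ∑ l, x₀ (k, l) = r₀ k) (hc₀ : ∀ l, ∑ k, x₀ (k, l) = c₀ l)
    (hr : ∀ k, ∑ l, x (k, l) = r k) (hc : ∀ l, ∑ k, x (k, l) = c l) :
    ∃ u : I × J → ℤ, ∀ n₀ : I × J → ℕ,
      (∀ k, ∑ l, n₀ (k, l) = r₀ k) → (∀ l, ∑ k, n₀ (k, l) = c₀ l) →
      (∀ z, (Fintype.card J : ℝ) ≤ n₀ z - x₀ z + x z) →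
      ∃ n : I × J → ℕ, (∀ z, (n z : ℤ) = n₀ z + u z) ∧ (∀ k, ∑ l, n (k, l) = r k) ∧
        (∀ l, ∑ k, n (k, l) = c l) ∧ ∀ z, |n z - (n₀ z - x₀ z + x z)| ≤ Fintype.card J := by
  obtain ⟨u, hur, huc, hu⟩ := exists_int_table_near (r := fun k => (r k : ℤ) - r₀ k)
    (c := fun l => (c l : ℤ) - c₀ l) (x := fun z => x z - x₀ z)
    (fun k => by push_cast; rw [Finset.sum_sub_distrib, hr, hr₀])
    (fun l => by push_cast; rw [Finset.sum_sub_distrib, hc, hc₀])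
  refine ⟨u, fun n₀ hn₀r hn₀c hpos => ?_⟩
  have hnonneg : ∀ z, 0 ≤ n₀ z + u z := fun z => by
    have : (0 : ℝ) ≤ n₀ z + u z := by linarith [hpos z, neg_le_of_abs_le (hu z)]
    exact_mod_cast this
  obtain ⟨n, hn, hnr, hnc⟩ := exists_nat_table_add (r := r) (c := c) hnonneg
    (fun k => by rw [hur, ← Nat.cast_sum, hn₀r]) (fun l => by rw [huc, ← Nat.cast_sum, hn₀c])
  refine ⟨n, hn, hnr, hnc, fun z => ?_⟩
  have hn_cast : (n z : ℝ) = n₀ z + u z := by exact_mod_cast hn z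
  rw [hn_cast]
  convert hu z using 2
  ring

end Table

theorem iidExp_exists_lt_abs_labelCount_sub_le {Z : Type*} [Fintype Z] [DecidableEq Z] {w : Z → ℝ}
    (hw : ∀ a, 0 ≤ w a) (hw1 : ∑ a, w a = 1) {N : ℕ} (hN : 0 < N) {K : ℝ} (hK : 0 < K) :
    iidExp w N (fun z => if ∃ a, K * √N < |labelCount z a - N * w a| then 1 else 0)
      ≤ Fintype.card Z / K ^ 2 := by
  have hKN : 0 < K ^ 2 * N := by positivity
  calc iidExp w N (fun z => if ∃ a, K * √N < |labelCount z a - N * w a| then 1 else 0)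
      ≤ iidExp w N (fun z => (K ^ 2 * N)⁻¹ * ∑ a, (labelCount z a - N * w a) ^ 2) := by
        refine iidExp_mono hw fun z => ?_
        split_ifs with h
        · obtain ⟨a, ha⟩ := h
          rw [le_inv_mul_iff₀ hKN, mul_one]
          calc K ^ 2 * N = (K * √N) ^ 2 := by rw [mul_pow, Real.sq_sqrt N.cast_nonneg]
            _ ≤ |labelCount z a - N * w a| ^ 2 := by gcongr
            _ = (labelCount z a - N * w a) ^ 2 := sq_abs _
            _ ≤ _ := Finset.single_le_sum (f := fun a => (labelCount z a - N * w a) ^ 2)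
                (fun _ _ => sq_nonneg _) (Finset.mem_univ a)
        · positivity
    _ = (K ^ 2 * N)⁻¹ * ∑ a, iidExp w N (fun z => (labelCount z a - N * w a) ^ 2) := by
        rw [iidExp_const_mul, iidExp_sum]
    _ ≤ (K ^ 2 * N)⁻¹ * ∑ _a : Z, (N : ℝ) := by
        gcongr with a
        exact iidExp_labelCount_sub_sq_le hw hw1 a
    _ = Fintype.card Z / K ^ 2 := by
        simp only [Finset.sum_const, Finset.card_univ, nsmul_eq_mul]
        field_simp

theorem permAvg_eq_of_labelCount_eq {I J : Type*} [DecidableEq I] [DecidableEq J] (M : I → J → ℝ)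
    {N : ℕ} {k k' : Fin N → I} {l l' : Fin N → J} (hk : labelCount k' = labelCount k)
    (hl : labelCount l' = labelCount l) : permAvg M k' l' = permAvg M k l := by
  obtain ⟨σ, rfl⟩ := exists_perm_comp_eq hk
  obtain ⟨τ, rfl⟩ := exists_perm_comp_eq hl
  rw [permAvg_comp_left, permAvg_comp_right]

theorem sum_multinomialProb_le_permAvg_mul {I J : Type*} [Fintype I] [Fintype J] [DecidableEq I]
    [DecidableEq J] {p : I → ℝ} {q : J → ℝ} {M : I → J → ℝ} {N : ℕ} (hp : ∀ k, 0 ≤ p k)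
    (hq : ∀ l, 0 ≤ q l) (hM : ∀ k l, 0 ≤ M k l) {k : Fin N → I} {l : Fin N → J}
    {T : Finset (I × J → ℕ)} (hT : ∀ t ∈ T, (∀ a, ∑ b, t (a, b) = labelCount k a) ∧
      ∀ b, ∑ a, t (a, b) = labelCount l b) :
    ∑ t ∈ T, multinomialProb (fun z => p z.1 * q z.2 * M z.1 z.2) t
      ≤ permAvg M k l * (multinomialProb p (labelCount k) * multinomialProb q (labelCount l)) := by
  let Ψ (k' : Fin N → I) (l' : Fin N → J) : ℝ :=
    (if labelCount k' = labelCount k then 1 else 0) * if labelCount l' = labelCount l then 1 else 0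
  have hΨ : ∀ k' l', permAvg M k' l' * Ψ k' l' = permAvg M k l * Ψ k' l' := fun k' l' => by
    by_cases hk : labelCount k' = labelCount k
    · by_cases hl : labelCount l' = labelCount l
      · rw [permAvg_eq_of_labelCount_eq M hk hl]
      · simp [Ψ, hl]
    · simp [Ψ, hk]
  have hpair : pairExp p q N (fun k' l' => permAvg M k' l' * Ψ k' l')
      = permAvg M k l * (multinomialProb p (labelCount k) * multinomialProb q (labelCount l)) := by
    simp only [hΨ, Ψ, pairExp, iidExp_const_mul, iidExp_labelCount_eq q (sum_labelCount l)]
    simp only [mul_comm _ (multinomialProb q _), iidExp_const_mul,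
      iidExp_labelCount_eq p (sum_labelCount k)]
  have hsum : ∀ t ∈ T, ∑ z, t z = N := fun t ht => by
    rw [Fintype.sum_prod_type, ← sum_labelCount k]
    exact Finset.sum_congr rfl fun a _ => (hT t ht).1 a
  rw [← hpair, pairExp_permAvg_mul M fun k' l' σ => by simp only [Ψ, labelCount_comp_perm],
    ← Finset.sum_congr rfl fun t ht => iidExp_labelCount_eq _ (hsum t ht), ← iidExp_sum]
  refine iidExp_mono (fun z => mul_nonneg (mul_nonneg (hp _) (hq _)) (hM _ _)) fun z => ?_
  rw [Finset.sum_ite_eq]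
  split_ifs with hz
  · have hfst : labelCount (Prod.fst ∘ z) = labelCount k := funext fun a => by
      rw [labelCount_fst, (hT _ hz).1]
    have hsnd : labelCount (Prod.snd ∘ z) = labelCount l := funext fun b => by
      rw [labelCount_snd, (hT _ hz).2]
    simp [Ψ, hfst, hsnd]
  · exact mul_nonneg (by split_ifs <;> norm_num) (by split_ifs <;> norm_num)

/-! ### Least-squares contingency tables -/

theorem chiSq_eq {Z : Type*} [Fintype Z] {w : Z → ℝ} (hw : ∀ a, 0 < w a) {N : ℕ} (hN : 0 < N)
    (hw1 : ∑ a, w a = 1) {x : Z → ℝ} (hx : ∑ a, x a = N) :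
    chiSq w N x = (∑ a, x a ^ 2 / w a) / N - N := by
  have hN' : (N : ℝ) ≠ 0 := by exact_mod_cast hN.ne'
  have hsq : ∀ a, (x a - N * w a) ^ 2 / (N * w a) = x a ^ 2 / w a / N - 2 * x a + N * w a := by
    intro a
    have := (hw a).ne'
    field_simp
    ring
  simp only [chiSq, hsq, Finset.sum_add_distrib, Finset.sum_sub_distrib, ← Finset.mul_sum,
    ← Finset.sum_div, hx, hw1]
  ring

namespace BlockKernel

variable {I J : Type*} [Fintype I] [Fintype J] (B : BlockKernel I J)

/-- The probability weights on `I × J` with density `M` with respect to the product of `p` and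
`q`: a coupling of `p` and `q`. -/
def joint (z : I × J) : ℝ := B.p z.1 * B.q z.2 * B.M z.1 z.2

theorem joint_pos (hp : ∀ k, 0 < B.p k) (hq : ∀ l, 0 < B.q l) (z : I × J) : 0 < B.joint z :=
  mul_pos (mul_pos (hp _) (hq _)) (B.M_pos _ _)

theorem sum_joint_row (k : I) : ∑ l, B.joint (k, l) = B.p k := by
  simp only [joint, mul_assoc, ← Finset.mul_sum, B.row, mul_one]

theorem sum_joint_col (l : J) : ∑ k, B.joint (k, l) = B.q l := by
  simp only [joint, mul_right_comm _ (B.q l), ← Finset.sum_mul, B.col, one_mul]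

theorem sum_joint : ∑ z, B.joint z = 1 := by
  simp only [Fintype.sum_prod_type, sum_joint_row, B.sum_p]


section LeastSquares

variable {s : ℝ}

theorem mul_sum_sq_le_of_hasGap (hgap : B.HasGap s) (hs0 : 0 ≤ s) (b : I → ℝ) (a : J → ℝ) :
    (1 - s) * (∑ k, B.p k * b k ^ 2 + ∑ l, B.q l * a l ^ 2)
      ≤ ∑ k, B.p k * (b k * (b k + ∑ l, B.q l * (B.ctr k l * a l)))
        + ∑ l, B.q l * (a l * (a l + ∑ k, B.p k * (B.ctr k l * b k))) := by
  let X := ∑ k, ∑ l, B.p k * B.q l * B.ctr k l * (b k * a l)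
  let F := ∑ k, B.p k * b k ^ 2
  let G := ∑ l, B.q l * a l ^ 2
  have hF : 0 ≤ F := Finset.sum_nonneg fun k _ => mul_nonneg (B.p_nonneg k) (sq_nonneg _)
  have hG : 0 ≤ G := Finset.sum_nonneg fun l _ => mul_nonneg (B.q_nonneg l) (sq_nonneg _)
  have hb : ∑ k, B.p k * (b k * (b k + ∑ l, B.q l * (B.ctr k l * a l))) = F + X := by
    simp only [F, X, ← Finset.sum_add_distrib]
    refine Finset.sum_congr rfl fun k _ => ?_
    rw [mul_add, mul_add, Finset.mul_sum, Finset.mul_sum, pow_two]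
    exact congrArg _ (Finset.sum_congr rfl fun l _ => by ring)
  have ha : ∑ l, B.q l * (a l * (a l + ∑ k, B.p k * (B.ctr k l * b k))) = G + X := by
    simp only [G, X]
    rw [Finset.sum_comm, ← Finset.sum_add_distrib]
    refine Finset.sum_congr rfl fun l _ => ?_
    rw [mul_add, mul_add, Finset.mul_sum, Finset.mul_sum, pow_two]
    exact congrArg _ (Finset.sum_congr rfl fun k _ => by ring)
  have hX : |2 * X| ≤ s * (F + G) := by
    refine abs_le_of_sq_le_sq ?_ (by positivity)
    calc (2 * X) ^ 2 = 4 * X ^ 2 := by ring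
      _ ≤ 4 * (s ^ 2 * F * G) := by gcongr; exact hgap b a
      _ ≤ (s * (F + G)) ^ 2 := by nlinarith [mul_nonneg (sq_nonneg s) (sq_nonneg (F - G))]
  change (1 - s) * (F + G) ≤ _
  rw [hb, ha]
  linarith [neg_le_of_abs_le hX]

theorem exists_dual_potentials (hgap : B.HasGap s) (hs0 : 0 ≤ s) (hs1 : s < 1)
    (hp : ∀ k, 0 < B.p k) (hq : ∀ l, 0 < B.q l) (u : I → ℝ) (v : J → ℝ) :
    ∃ (b : I → ℝ) (a : J → ℝ), (∀ k, b k + ∑ l, B.q l * (B.ctr k l * a l) = u k) ∧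
      ∀ l, a l + ∑ k, B.p k * (B.ctr k l * b k) = v l := by
  let A : (I → ℝ) × (J → ℝ) →ₗ[ℝ] (I → ℝ) × (J → ℝ) :=
    { toFun := fun x => (fun k => x.1 k + ∑ l, B.q l * (B.ctr k l * x.2 l),
        fun l => x.2 l + ∑ k, B.p k * (B.ctr k l * x.1 k))
      map_add' := fun x y => by
        ext <;> simp [mul_add, Finset.sum_add_distrib] <;> ring
      map_smul' := fun c x => by
        ext <;> simp only [Prod.smul_fst, Prod.smul_snd, Pi.smul_apply, smul_eq_mul,
          RingHom.id_apply, Prod.smul_mk, mul_add, Finset.mul_sum, mul_left_comm c] }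
  have hinj : Function.Injective A := by
    refine (injective_iff_map_eq_zero A).2 fun x hx => ?_
    have hrow : ∀ k, x.1 k + ∑ l, B.q l * (B.ctr k l * x.2 l) = 0 := congrFun (congrArg Prod.fst hx)
    have hcol : ∀ l, x.2 l + ∑ k, B.p k * (B.ctr k l * x.1 k) = 0 := congrFun (congrArg Prod.snd hx)
    have h0 := B.mul_sum_sq_le_of_hasGap hgap hs0 x.1 x.2
    simp only [hrow, hcol, mul_zero, Finset.sum_const_zero, add_zero] at h0
    have hF : ∀ k, 0 ≤ B.p k * x.1 k ^ 2 := fun k => mul_nonneg (B.p_nonneg k) (sq_nonneg _)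
    have hG : ∀ l, 0 ≤ B.q l * x.2 l ^ 2 := fun l => mul_nonneg (B.q_nonneg l) (sq_nonneg _)
    have hle := nonpos_of_mul_nonpos_right h0 (sub_pos.2 hs1)
    ext z
    · have := (Finset.single_le_sum (fun k _ => hF k) (Finset.mem_univ z)).trans
        (le_of_add_le_of_nonneg_left hle (Finset.sum_nonneg fun l _ => hG l))
      exact pow_eq_zero_iff two_ne_zero |>.1 (nonpos_of_mul_nonpos_right this (hp z) |>.antisymm
        (sq_nonneg _))
    · have := (Finset.single_le_sum (fun l _ => hG l) (Finset.mem_univ z)).trans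
        (le_of_add_le_of_nonneg_right hle (Finset.sum_nonneg fun k _ => hF k))
      exact pow_eq_zero_iff two_ne_zero |>.1 (nonpos_of_mul_nonpos_right this (hq z) |>.antisymm
        (sq_nonneg _))
  obtain ⟨x, hx⟩ := LinearMap.injective_iff_surjective.1 hinj (u, v)
  exact ⟨x.1, x.2, congrFun (congrArg Prod.fst hx), congrFun (congrArg Prod.snd hx)⟩

theorem dual_pairing_nonneg_le (hgap : B.HasGap s) (hs0 : 0 ≤ s) (hs1 : s < 1) {u b : I → ℝ}
    {v a : J → ℝ} (hb : ∀ k, b k + ∑ l, B.q l * (B.ctr k l * a l) = u k)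
    (ha : ∀ l, a l + ∑ k, B.p k * (B.ctr k l * b k) = v l) :
    0 ≤ ∑ k, B.p k * (b k * u k) + ∑ l, B.q l * (a l * v l) ∧
      ∑ k, B.p k * (b k * u k) + ∑ l, B.q l * (a l * v l)
        ≤ (∑ k, B.p k * u k ^ 2 + ∑ l, B.q l * v l ^ 2) / (1 - s) := by
  let F := ∑ k, B.p k * b k ^ 2 + ∑ l, B.q l * a l ^ 2
  let T := ∑ k, B.p k * u k ^ 2 + ∑ l, B.q l * v l ^ 2
  let P := ∑ k, B.p k * (b k * u k) + ∑ l, B.q l * (a l * v l)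
  have hF : 0 ≤ F := add_nonneg
    (Finset.sum_nonneg fun k _ => mul_nonneg (B.p_nonneg k) (sq_nonneg _))
    (Finset.sum_nonneg fun l _ => mul_nonneg (B.q_nonneg l) (sq_nonneg _))
  have hFP : (1 - s) * F ≤ P := by
    simpa only [hb, ha] using B.mul_sum_sq_le_of_hasGap hgap hs0 b a
  have hs : 0 < 1 - s := sub_pos.2 hs1
  -- `2 (1 - s) ⟨b, u⟩ ≤ (1 - s)² ‖b‖² + ‖u‖²`, and similarly for `a` and `v`
  have hPT : 2 * ((1 - s) * P) ≤ (1 - s) ^ 2 * F + T := by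
    simp only [P, F, T, mul_add, Finset.mul_sum]
    have hI : ∑ k, 2 * ((1 - s) * (B.p k * (b k * u k)))
        ≤ ∑ k, ((1 - s) ^ 2 * (B.p k * b k ^ 2) + B.p k * u k ^ 2) :=
      Finset.sum_le_sum fun k _ => by
        nlinarith [mul_nonneg (B.p_nonneg k) (sq_nonneg ((1 - s) * b k - u k))]
    have hJ : ∑ l, 2 * ((1 - s) * (B.q l * (a l * v l)))
        ≤ ∑ l, ((1 - s) ^ 2 * (B.q l * a l ^ 2) + B.q l * v l ^ 2) :=
      Finset.sum_le_sum fun l _ => by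
        nlinarith [mul_nonneg (B.q_nonneg l) (sq_nonneg ((1 - s) * a l - v l))]
    rw [Finset.sum_add_distrib] at hI hJ
    linarith
  refine ⟨(mul_nonneg hs.le hF).trans hFP, (le_div_iff₀ hs).2 ?_⟩
  change P * (1 - s) ≤ T
  nlinarith [mul_le_mul_of_nonneg_left hFP hs.le]

/-- The table `W (f ⊕ g)`, where `W` is the joint law. These are the tables minimising `chiSq`
among all tables with the same margins. -/
def sumTable (f : I → ℝ) (g : J → ℝ) (z : I × J) : ℝ := B.joint z * (f z.1 + g z.2)

theorem sum_sumTable_row (f : I → ℝ) (g : J → ℝ) (k : I) :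
    ∑ l, B.sumTable f g (k, l)
      = B.p k * (f k + ∑ l, B.q l * g l + ∑ l, B.q l * (B.ctr k l * g l)) := by
  simp only [sumTable, mul_add, Finset.sum_add_distrib, ← Finset.sum_mul, B.sum_joint_row]
  rw [add_assoc, ← mul_add, ← Finset.sum_add_distrib, Finset.mul_sum]
  refine congrArg _ (Finset.sum_congr rfl fun l _ => ?_)
  simp only [joint, ctr]
  ring

theorem sum_sumTable_col (f : I → ℝ) (g : J → ℝ) (l : J) :
    ∑ k, B.sumTable f g (k, l)
      = B.q l * (g l + ∑ k, B.p k * f k + ∑ k, B.p k * (B.ctr k l * f k)) := by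
  simp only [sumTable, mul_add, Finset.sum_add_distrib, ← Finset.sum_mul, B.sum_joint_col]
  rw [add_comm, add_assoc, ← mul_add, ← Finset.sum_add_distrib, Finset.mul_sum]
  refine congrArg _ (Finset.sum_congr rfl fun k _ => ?_)
  simp only [joint, ctr]
  ring

theorem sum_mul_add_eq_sum_margins (x : I × J → ℝ) (f : I → ℝ) (g : J → ℝ) :
    ∑ z, x z * (f z.1 + g z.2)
      = ∑ k, (∑ l, x (k, l)) * f k + ∑ l, (∑ k, x (k, l)) * g l := by
  simp only [mul_add, Finset.sum_add_distrib, Fintype.sum_prod_type, Finset.sum_mul]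
  rw [Finset.sum_comm (f := fun k l => x (k, l) * g l)]

theorem chiSq_add_sumTable (hp : ∀ k, 0 < B.p k) (hq : ∀ l, 0 < B.q l) {N : ℕ} {d : I × J → ℝ}
    (hr : ∀ k, ∑ l, d (k, l) = 0) (hc : ∀ l, ∑ k, d (k, l) = 0) (f : I → ℝ) (g : J → ℝ) :
    chiSq B.joint N (fun z => d z + B.sumTable f g z)
      = ∑ z, d z ^ 2 / (N * B.joint z) + chiSq B.joint N (B.sumTable f g) := by
  have horth : ∑ z, d z * ((f z.1 - N) / N + g z.2 / N) = 0 := by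
    rw [sum_mul_add_eq_sum_margins d (fun k => (f k - N) / N) fun l => g l / N]
    simp [hr, hc]
  rw [chiSq, chiSq, ← Finset.sum_add_distrib, ← add_zero (∑ z, (_ + _)), ← mul_zero 2, ← horth,
    Finset.mul_sum, ← Finset.sum_add_distrib]
  refine Finset.sum_congr rfl fun z _ => ?_
  have hW := (B.joint_pos hp hq z).ne'
  rcases eq_or_ne (N : ℝ) 0 with hN | hN
  · simp [hN]
  · simp only [sumTable]
    field_simp
    ring

theorem chiSq_sub_sumTable_add_sumTable (hp : ∀ k, 0 < B.p k) (hq : ∀ l, 0 < B.q l) (N : ℕ)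
    {x : I × J → ℝ} {f₀ : I → ℝ} {g₀ : J → ℝ}
    (hr : ∀ k, ∑ l, x (k, l) = ∑ l, B.sumTable f₀ g₀ (k, l))
    (hc : ∀ l, ∑ k, x (k, l) = ∑ k, B.sumTable f₀ g₀ (k, l)) (f : I → ℝ) (g : J → ℝ) :
    chiSq B.joint N (fun z => x z - B.sumTable f₀ g₀ z + B.sumTable f g z)
      = chiSq B.joint N x - chiSq B.joint N (B.sumTable f₀ g₀)
        + chiSq B.joint N (B.sumTable f g) := by
  have h := B.chiSq_add_sumTable hp hq (N := N) (d := fun z => x z - B.sumTable f₀ g₀ z)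
    (fun k => by rw [Finset.sum_sub_distrib, hr, sub_self])
    (fun l => by rw [Finset.sum_sub_distrib, hc, sub_self])
  have h₀ := h f₀ g₀
  simp only [sub_add_cancel] at h₀
  rw [h, h₀, add_sub_cancel_right]

/-- The interaction terms of a pair of margins that control how far the least `chiSq` of a table
with these margins is from the sum of the `chiSq` of the margins. -/
noncomputable def fluct (N : ℕ) (r : I → ℝ) (c : J → ℝ) : ℝ :=
  ((∑ k, ∑ l, B.ctr k l * (r k * c l)) / N) ^ 2 +
    (∑ k, B.p k * (∑ l, B.ctr k l * c l) ^ 2 + ∑ l, B.q l * (∑ k, B.ctr k l * r k) ^ 2) / N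

section Potentials

variable {N : ℕ} {r b : I → ℝ} {c a : J → ℝ}
  (hb : ∀ k, b k + ∑ l, B.q l * (B.ctr k l * a l) = ∑ l, B.ctr k l * c l)
  (ha : ∀ l, a l + ∑ k, B.p k * (B.ctr k l * b k) = ∑ k, B.ctr k l * r k)

include hb in
theorem sum_p_mul_dual_eq_zero : ∑ k, B.p k * b k = 0 := by
  have h : ∀ x : J → ℝ, ∑ k, B.p k * ∑ l, B.ctr k l * x l = 0 := fun x => by
    simp only [Finset.mul_sum, ← mul_assoc]
    rw [Finset.sum_comm]
    simp only [← Finset.sum_mul, B.col_ctr, zero_mul, Finset.sum_const_zero]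
  simp only [eq_sub_of_add_eq (hb _), mul_sub, Finset.sum_sub_distrib, h, zero_sub,
    mul_left_comm (B.q _), neg_zero]

include ha in
theorem sum_q_mul_dual_eq_zero : ∑ l, B.q l * a l = 0 := by
  have h : ∀ x : I → ℝ, ∑ l, B.q l * ∑ k, B.ctr k l * x k = 0 := fun x => by
    simp only [Finset.mul_sum, ← mul_assoc]
    rw [Finset.sum_comm]
    simp only [← Finset.sum_mul, B.row_ctr, zero_mul, Finset.sum_const_zero]
  simp only [eq_sub_of_add_eq (ha _), mul_sub, Finset.sum_sub_distrib, h, zero_sub,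
    mul_left_comm (B.p _), neg_zero]

variable (hp : ∀ k, 0 < B.p k) (hq : ∀ l, 0 < B.q l)

include hb ha hp hq in
theorem sum_sumTable_dual_row (hc : ∑ l, c l = N) (k : I) :
    ∑ l, B.sumTable (fun k => r k / B.p k - b k - N) (fun l => c l / B.q l - a l) (k, l) = r k := by
  have hsum : ∑ l, B.q l * (c l / B.q l - a l) = N := by
    simp only [mul_sub, mul_div_cancel₀ _ (hq _).ne', Finset.sum_sub_distrib, hc,
      B.sum_q_mul_dual_eq_zero ha, sub_zero]
  have hctr : ∑ l, B.q l * (B.ctr k l * (c l / B.q l - a l)) = b k := by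
    simp only [mul_left_comm (B.q _), mul_sub, mul_div_cancel₀ _ (hq _).ne',
      Finset.sum_sub_distrib]
    rw [sub_eq_iff_eq_add, ← hb]
    simp only [mul_left_comm (B.q _)]
  rw [sum_sumTable_row, hsum, hctr]
  field_simp [(hp k).ne']
  ring

include hb ha hp hq in
theorem sum_sumTable_dual_col (hr : ∑ k, r k = N) (l : J) :
    ∑ k, B.sumTable (fun k => r k / B.p k - b k - N) (fun l => c l / B.q l - a l) (k, l) = c l := by
  have hsum : ∑ k, B.p k * (r k / B.p k - b k - N) = 0 := by
    simp only [mul_sub, mul_div_cancel₀ _ (hp _).ne', Finset.sum_sub_distrib, hr,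
      B.sum_p_mul_dual_eq_zero hb, ← Finset.sum_mul, B.sum_p]
    ring
  have hctr : ∑ k, B.p k * (B.ctr k l * (r k / B.p k - b k - N)) = a l := by
    have h0 : ∑ k, B.ctr k l * (B.p k * N) = 0 := by
      simp only [← mul_assoc, mul_comm (B.ctr _ _) (B.p _), ← Finset.sum_mul, B.col_ctr, zero_mul]
    simp only [mul_left_comm (B.p _), mul_sub, mul_div_cancel₀ _ (hp _).ne',
      Finset.sum_sub_distrib, h0, sub_zero]
    rw [sub_eq_iff_eq_add, ← ha]
    simp only [mul_left_comm (B.p _)]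
  rw [sum_sumTable_col, hsum, hctr]
  field_simp [(hq l).ne']
  ring

include hb in
theorem sum_margin_mul_dual_row : ∑ k, r k * b k
    = ∑ k, ∑ l, B.ctr k l * (r k * c l) - ∑ l, B.q l * (a l * ∑ k, B.ctr k l * r k) := by
  simp only [Finset.mul_sum]
  rw [Finset.sum_comm (s := (Finset.univ : Finset J)), ← Finset.sum_sub_distrib]
  refine Finset.sum_congr rfl fun k _ => ?_
  rw [eq_sub_of_add_eq (hb k), mul_sub, Finset.mul_sum, Finset.mul_sum]
  congr 1 <;> exact Finset.sum_congr rfl fun l _ => by ring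

include ha in
theorem sum_margin_mul_dual_col : ∑ l, c l * a l
    = ∑ k, ∑ l, B.ctr k l * (r k * c l) - ∑ k, B.p k * (b k * ∑ l, B.ctr k l * c l) := by
  simp only [Finset.mul_sum, ← Finset.sum_sub_distrib]
  rw [Finset.sum_comm]
  refine Finset.sum_congr rfl fun l _ => ?_
  rw [eq_sub_of_add_eq (ha l), mul_sub, Finset.mul_sum, Finset.mul_sum, ← Finset.sum_sub_distrib]
  exact Finset.sum_congr rfl fun k _ => by ring

include hb ha hp hq in
theorem sum_sq_sumTable_dual_div (hr : ∑ k, r k = N) (hc : ∑ l, c l = N) :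
    ∑ z, B.sumTable (fun k => r k / B.p k - b k - N) (fun l => c l / B.q l - a l) z ^ 2
        / B.joint z
      = ∑ k, r k ^ 2 / B.p k + ∑ l, c l ^ 2 / B.q l - N * N
        + (∑ k, B.p k * (b k * ∑ l, B.ctr k l * c l) + ∑ l, B.q l * (a l * ∑ k, B.ctr k l * r k)
          - 2 * ∑ k, ∑ l, B.ctr k l * (r k * c l)) := by
  have h : ∀ f g z, B.sumTable f g z ^ 2 / B.joint z = B.sumTable f g z * (f z.1 + g z.2) :=
    fun f g z => by
      have := (B.joint_pos hp hq z).ne'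
      rw [sumTable]
      field_simp
  have hf : ∑ k, r k * (r k / B.p k - b k - N) = ∑ k, r k ^ 2 / B.p k - ∑ k, r k * b k - N * N := by
    simp only [mul_sub, Finset.sum_sub_distrib, ← Finset.sum_mul, hr, pow_two, mul_div_assoc]
  have hg : ∑ l, c l * (c l / B.q l - a l) = ∑ l, c l ^ 2 / B.q l - ∑ l, c l * a l := by
    simp only [mul_sub, Finset.sum_sub_distrib, pow_two, mul_div_assoc]
  refine ((Finset.sum_congr rfl fun z _ => h _ _ z).trans
    (sum_mul_add_eq_sum_margins _ _ _)).trans ?_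
  simp only [B.sum_sumTable_dual_row hb ha hp hq hc, B.sum_sumTable_dual_col hb ha hp hq hr, hf, hg,
    B.sum_margin_mul_dual_row hb, B.sum_margin_mul_dual_col ha]
  ring

include hb ha hp hq in
theorem chiSq_sumTable_dual_sub (hN : 0 < N) (hr : ∑ k, r k = N) (hc : ∑ l, c l = N) :
    chiSq B.joint N (B.sumTable (fun k => r k / B.p k - b k - N) fun l => c l / B.q l - a l)
        - chiSq B.p N r - chiSq B.q N c
      = (∑ k, B.p k * (b k * ∑ l, B.ctr k l * c l) + ∑ l, B.q l * (a l * ∑ k, B.ctr k l * r k)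
          - 2 * ∑ k, ∑ l, B.ctr k l * (r k * c l)) / N := by
  have hN0 : (N : ℝ) ≠ 0 := by exact_mod_cast hN.ne'
  have hsum : ∑ z, B.sumTable (fun k => r k / B.p k - b k - N) (fun l => c l / B.q l - a l) z
      = N := by
    rw [Fintype.sum_prod_type,
      Finset.sum_congr rfl fun k _ => B.sum_sumTable_dual_row hb ha hp hq hc k, hr]
  rw [chiSq_eq (B.joint_pos hp hq) hN B.sum_joint hsum, chiSq_eq hp hN B.sum_p hr,
    chiSq_eq hq hN B.sum_q hc, B.sum_sq_sumTable_dual_div hb ha hp hq hr hc]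
  field_simp
  ring

end Potentials

theorem exists_sumTable_margins (hgap : B.HasGap s) (hs0 : 0 ≤ s) (hs1 : s < 1)
    (hp : ∀ k, 0 < B.p k) (hq : ∀ l, 0 < B.q l) {N : ℕ} (hN : 0 < N) {r : I → ℝ} {c : J → ℝ}
    (hr : ∑ k, r k = N) (hc : ∑ l, c l = N) :
    ∃ (f : I → ℝ) (g : J → ℝ), (∀ k, ∑ l, B.sumTable f g (k, l) = r k) ∧
      (∀ l, ∑ k, B.sumTable f g (k, l) = c l) ∧
      |chiSq B.joint N (B.sumTable f g) - chiSq B.p N r - chiSq B.q N c|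
        ≤ 1 + B.fluct N r c / (1 - s) := by
  let S := ∑ k, ∑ l, B.ctr k l * (r k * c l)
  let u : I → ℝ := fun k => ∑ l, B.ctr k l * c l
  let v : J → ℝ := fun l => ∑ k, B.ctr k l * r k
  let T := ∑ k, B.p k * u k ^ 2 + ∑ l, B.q l * v l ^ 2
  obtain ⟨b, a, hb, ha⟩ := B.exists_dual_potentials hgap hs0 hs1 hp hq u v
  let P := ∑ k, B.p k * (b k * u k) + ∑ l, B.q l * (a l * v l)
  obtain ⟨hP0, hP⟩ : 0 ≤ P ∧ P ≤ T / (1 - s) := B.dual_pairing_nonneg_le hgap hs0 hs1 hb ha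
  have : (0 : ℝ) < N := by exact_mod_cast hN
  have hs : 0 < 1 - s := sub_pos.2 hs1
  have hrow := B.sum_sumTable_dual_row hb ha hp hq hc
  have hcol := B.sum_sumTable_dual_col hb ha hp hq hr
  refine ⟨_, _, hrow, hcol, ?_⟩
  have hchi := B.chiSq_sumTable_dual_sub hb ha hp hq hN hr hc
  have hSN : |2 * (S / N)| ≤ 1 + (S / N) ^ 2 := by
    rw [abs_le]
    constructor <;> nlinarith [sq_nonneg (S / N - 1), sq_nonneg (S / N + 1)]
  calc _ = |P / N - 2 * (S / N)| := by rw [hchi, sub_div, mul_div_assoc]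
    _ ≤ T / (1 - s) / N + (1 + (S / N) ^ 2) := by
      refine (abs_sub _ _).trans (add_le_add ?_ hSN)
      rw [abs_of_nonneg (by positivity)]
      gcongr
    _ ≤ T / (1 - s) / N + (1 + (S / N) ^ 2 / (1 - s)) := by
      gcongr
      exact le_div_self (sq_nonneg _) hs (by linarith)
    _ = 1 + B.fluct N r c / (1 - s) := by
      change _ = 1 + ((S / N) ^ 2 + T / N) / (1 - s)
      ring

end LeastSquares

end BlockKernel

/-! ### Lower tail of the permutation average -/

theorem sum_mul_labelCount {Z : Type*} [Fintype Z] [DecidableEq Z] {N : ℕ} (z : Fin N → Z)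
    (h : Z → ℝ) : ∑ a, h a * labelCount z a = ∑ i, h (z i) := by
  rw [← Finset.sum_fiberwise _ z]
  refine Finset.sum_congr rfl fun a _ => ?_
  rw [Finset.sum_congr rfl fun i hi => congrArg h (Finset.mem_filter.1 hi).2, Finset.sum_const,
    nsmul_eq_mul, labelCount, mul_comm]

theorem iidExp_sum_mul_labelCount_sq {Z : Type*} [Fintype Z] [DecidableEq Z] {w h : Z → ℝ}
    (hw : ∑ a, w a = 1) (h0 : ∑ a, w a * h a = 0) (N : ℕ) :
    iidExp w N (fun z => (∑ a, h a * labelCount z a) ^ 2) = N * ∑ a, w a * h a ^ 2 := by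
  simp only [sum_mul_labelCount]
  exact iidExp_sum_apply_sq hw h h0

theorem chiSq_le_of_abs_sub_le {Z : Type*} [Fintype Z] {w : Z → ℝ} (hw : ∀ a, 0 < w a) {N : ℕ}
    (hN : 0 < N) {K : ℝ} {x : Z → ℝ} (hx : ∀ a, |x a - N * w a| ≤ K * √N) :
    chiSq w N x ≤ ∑ a, K ^ 2 / w a := by
  have : (0 : ℝ) < N := by exact_mod_cast hN
  refine Finset.sum_le_sum fun a _ => ?_
  have ha := hw a
  rw [div_le_div_iff₀ (by positivity) ha]
  calc (x a - N * w a) ^ 2 * w a ≤ (K * √N) ^ 2 * w a := by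
        gcongr ?_ * _
        exact sq_le_sq' (neg_le_of_abs_le (hx a)) (le_of_abs_le (hx a))
    _ = K ^ 2 * (N * w a) := by
        rw [mul_pow, Real.sq_sqrt N.cast_nonneg]
        ring

theorem abs_sub_le_of_chiSq_le {Z : Type*} [Fintype Z] {w : Z → ℝ} (hw : ∀ a, 0 < w a)
    (hw1 : ∑ a, w a = 1) {N : ℕ} (hN : 0 < N) {C : ℝ} {x : Z → ℝ} (hx : chiSq w N x ≤ C) (a : Z) :
    |x a - N * w a| ≤ √C * √N := by
  have hN' : (0 : ℝ) < N := by exact_mod_cast hN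
  have hNw : 0 < N * w a := mul_pos hN' (hw a)
  have hterm : (x a - N * w a) ^ 2 / (N * w a) ≤ C :=
    (Finset.single_le_sum (f := fun a => (x a - N * w a) ^ 2 / (N * w a))
      (fun a _ => div_nonneg (sq_nonneg _) (mul_nonneg hN'.le (hw a).le))
      (Finset.mem_univ a)).trans hx
  have hC : 0 ≤ C := (div_nonneg (sq_nonneg _) hNw.le).trans hterm
  have hw_le : w a ≤ 1 := hw1 ▸ Finset.single_le_sum (fun a _ => (hw a).le) (Finset.mem_univ a)
  rw [← Real.sqrt_mul hC]
  refine Real.abs_le_sqrt (((div_le_iff₀ hNw).1 hterm).trans ?_)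
  exact mul_le_mul_of_nonneg_left (mul_le_of_le_one_right hN'.le hw_le) hC

namespace BlockKernel

variable {I J : Type*} [Fintype I] [Fintype J] (B : BlockKernel I J)

theorem hs_nonneg : 0 ≤ B.hs :=
  Finset.sum_nonneg fun k _ => Finset.sum_nonneg fun l _ =>
    mul_nonneg (mul_nonneg (B.p_nonneg k) (B.q_nonneg l)) (sq_nonneg _)

theorem fluct_nonneg (N : ℕ) (r : I → ℝ) (c : J → ℝ) : 0 ≤ B.fluct N r c := by
  have hI := Finset.sum_nonneg fun k (_ : k ∈ Finset.univ) =>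
    mul_nonneg (B.p_nonneg k) (sq_nonneg (∑ l, B.ctr k l * c l))
  have hJ := Finset.sum_nonneg fun l (_ : l ∈ Finset.univ) =>
    mul_nonneg (B.q_nonneg l) (sq_nonneg (∑ k, B.ctr k l * r k))
  unfold fluct
  positivity

section Fluct

variable [DecidableEq I] [DecidableEq J]

theorem pairExp_fluct {N : ℕ} (hN : 0 < N) :
    pairExp B.p B.q N (fun k l => B.fluct N (fun x => labelCount k x) fun y => labelCount l y)
      = 3 * B.hs := by
  have hN' : (N : ℝ) ≠ 0 := by exact_mod_cast hN.ne'
  have hJ : iidExp B.p N (fun k => ∑ y, B.q y * (∑ x, B.ctr x y * labelCount k x) ^ 2)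
      = N * B.hs := by
    simp only [iidExp_sum, iidExp_const_mul, iidExp_sum_mul_labelCount_sq B.sum_p (B.col_ctr _),
      hs, Finset.mul_sum]
    rw [Finset.sum_comm]
    exact Finset.sum_congr rfl fun k _ => Finset.sum_congr rfl fun l _ => by ring
  have hI : iidExp B.q N (fun l => ∑ x, B.p x * (∑ y, B.ctr x y * labelCount l y) ^ 2)
      = N * B.hs := by
    simp only [iidExp_sum, iidExp_const_mul, iidExp_sum_mul_labelCount_sq B.sum_q (B.row_ctr _),
      hs, Finset.mul_sum]
    exact Finset.sum_congr rfl fun k _ => Finset.sum_congr rfl fun l _ => by ring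
  have hS : ∀ k : Fin N → I, iidExp B.q N (fun l => ((∑ x, ∑ y, B.ctr x y *
      (labelCount k x * labelCount l y)) / N) ^ 2)
      = (N : ℝ)⁻¹ * ∑ y, B.q y * (∑ x, B.ctr x y * labelCount k x) ^ 2 := fun k => by
    have h : ∀ l : Fin N → J,
        ((∑ x, ∑ y, B.ctr x y * ((labelCount k x : ℝ) * labelCount l y)) / N) ^ 2
          = ((N : ℝ) ^ 2)⁻¹ * (∑ y, (∑ x, B.ctr x y * labelCount k x) * labelCount l y) ^ 2 := by
      intro l
      rw [Finset.sum_comm, div_pow, div_eq_inv_mul]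
      simp only [Finset.sum_mul, mul_assoc]
    have h0 : ∑ y, B.q y * ∑ x, B.ctr x y * labelCount k x = 0 := by
      simp only [Finset.mul_sum, ← mul_assoc]
      rw [Finset.sum_comm]
      simp only [← Finset.sum_mul, B.row_ctr, zero_mul, Finset.sum_const_zero]
    simp only [h, iidExp_const_mul, iidExp_sum_mul_labelCount_sq B.sum_q h0]
    field_simp
  simp only [fluct, pairExp, iidExp_add, hS, div_eq_inv_mul (_ + _) (N : ℝ), iidExp_const_mul, hI,
    hJ, iidExp_const B.sum_q, iidExp_const B.sum_p]
  field_simp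
  norm_num

end Fluct

/-- The margins of a table of size `N` are typical if they are within `K √N` of their means and
interact with energy at most `L`. -/
structure IsTypical (K L : ℝ) (N : ℕ) (r : I → ℕ) (c : J → ℕ) : Prop where
  sum_row : ∑ k, r k = N
  sum_col : ∑ l, c l = N
  row_near : ∀ k, |r k - N * B.p k| ≤ K * √N
  col_near : ∀ l, |c l - N * B.q l| ≤ K * √N
  fluct_le : B.fluct N (fun k => r k) (fun l => c l) ≤ L

section Shift

variable {s : ℝ} (hgap : B.HasGap s) (hs0 : 0 ≤ s) (hs1 : s < 1)
  (hp : ∀ k, 0 < B.p k) (hq : ∀ l, 0 < B.q l)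

include hgap hs0 hs1 hp hq

theorem exists_sumTable_of_isTypical (K L : ℝ) :
    ∃ C : ℝ, ∀ N : ℕ, 0 < N → ∀ (r : I → ℕ) (c : J → ℕ), B.IsTypical K L N r c →
      ∃ (f : I → ℝ) (g : J → ℝ), (∀ k, ∑ l, B.sumTable f g (k, l) = r k) ∧
        (∀ l, ∑ k, B.sumTable f g (k, l) = c l) ∧
        |chiSq B.joint N (B.sumTable f g) - chiSq B.p N (fun k => r k) -
          chiSq B.q N (fun l => c l)| ≤ 1 + L / (1 - s) ∧
        ∀ z, |B.sumTable f g z - N * B.joint z| ≤ C * √N := by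
  refine ⟨√(1 + L / (1 - s) + ∑ k, K ^ 2 / B.p k + ∑ l, K ^ 2 / B.q l),
    fun N hN r c h => ?_⟩
  obtain ⟨f, g, hr, hc, hchi⟩ := B.exists_sumTable_margins hgap hs0 hs1 hp hq hN
    (r := fun k => r k) (c := fun l => c l) (by exact_mod_cast h.sum_row)
    (by exact_mod_cast h.sum_col)
  have hchi' : _ ≤ 1 + L / (1 - s) := hchi.trans <| add_le_add_right
    (div_le_div_of_nonneg_right h.fluct_le (sub_pos.2 hs1).le) _
  refine ⟨f, g, hr, hc, hchi', abs_sub_le_of_chiSq_le (B.joint_pos hp hq) B.sum_joint hN ?_⟩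
  linarith [le_of_abs_le hchi', chiSq_le_of_abs_sub_le hp hN h.row_near,
    chiSq_le_of_abs_sub_le hq hN h.col_near]

theorem eventually_exists_shift (K L : ℝ) :
    ∃ K', ∀ᶠ N : ℕ in atTop, ∀ (r₀ r : I → ℕ) (c₀ c : J → ℕ), B.IsTypical K L N r₀ c₀ →
      B.IsTypical K L N r c → ∃ u : I × J → ℤ, ∀ n₀ : I × J → ℕ,
        (∀ k, ∑ l, n₀ (k, l) = r₀ k) → (∀ l, ∑ k, n₀ (k, l) = c₀ l) →
        (∀ z, |n₀ z - N * B.joint z| ≤ K * √N) →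
        ∃ n : I × J → ℕ, (∀ z, (n z : ℤ) = n₀ z + u z) ∧ (∀ k, ∑ l, n (k, l) = r k) ∧
          (∀ l, ∑ k, n (k, l) = c l) ∧ (∀ z, |n z - N * B.joint z| ≤ K' * √N) ∧
          chiSq B.joint N (fun z => n z) + chiSq B.p N (fun k => r₀ k) + chiSq B.q N (fun l => c₀ l)
            ≤ chiSq B.joint N (fun z => n₀ z) + chiSq B.p N (fun k => r k) +
              chiSq B.q N (fun l => c l) + (3 + 2 * L / (1 - s)) := by
  obtain ⟨C, hC⟩ := B.exists_sumTable_of_isTypical hgap hs0 hs1 hp hq K L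
  let K' := K + 2 * C
  let R : ℝ := Fintype.card J
  have hW := B.joint_pos hp hq
  refine ⟨K' + R, ?_⟩
  filter_upwards [eventually_chiSq_le_add hW K' R one_pos, eventually_gt_atTop 0,
    eventually_all.2 fun z => eventually_mul_sqrt_le_mul_half (hW z) (K' + R)]
    with N hround hN hpos r₀ r c₀ c h₀ h
  have hN1 : 1 ≤ √(N : ℝ) := Real.one_le_sqrt.2 (by exact_mod_cast hN)
  obtain ⟨f₀, g₀, hr₀, hc₀, hchi₀, hnear₀⟩ := hC N hN r₀ c₀ h₀
  obtain ⟨f, g, hr, hc, hchi, hnear⟩ := hC N hN r c h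
  obtain ⟨u, hu⟩ := exists_nat_table_shift hr₀ hc₀ hr hc
  refine ⟨u, fun n₀ hn₀r hn₀c hn₀ => ?_⟩
  let y : I × J → ℝ := fun z => n₀ z - B.sumTable f₀ g₀ z + B.sumTable f g z
  have hR : R ≤ R * √N := le_mul_of_one_le_right (Nat.cast_nonneg _) hN1
  have hy : ∀ z, |y z - N * B.joint z| ≤ K' * √N := fun z => by
    have := abs_le.1 (hn₀ z)
    have := abs_le.1 (hnear₀ z)
    have := abs_le.1 (hnear z)
    simp only [y, K', abs_le]
    constructor <;> linarith
  obtain ⟨n, hn_eq, hnr, hnc, hny⟩ := hu n₀ hn₀r hn₀c fun z => by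
    have hNw : 0 ≤ N * B.joint z := mul_nonneg N.cast_nonneg (hW z).le
    linarith [neg_le_of_abs_le (hy z), hpos z]
  have hn : ∀ z, |n z - N * B.joint z| ≤ (K' + R) * √N := fun z => by
    linarith [abs_sub_le (n z : ℝ) (y z) (N * B.joint z), hny z, hy z]
  refine ⟨n, hn_eq, hnr, hnc, hn, ?_⟩
  have hchi_n := hround y (fun z => n z) hy hny
  have hchi_y : chiSq B.joint N y = _ := B.chiSq_sub_sumTable_add_sumTable hp hq N
    (fun k => by rw [hr₀, ← Nat.cast_sum, hn₀r]) (fun l => by rw [hc₀, ← Nat.cast_sum, hn₀c]) f g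
  rw [mul_div_assoc]
  linarith [le_of_abs_le hchi, neg_le_of_abs_le hchi₀]

theorem eventually_exists_shift_multinomialProb_le (K L : ℝ) :
    ∀ᶠ N : ℕ in atTop, ∀ (r₀ r : I → ℕ) (c₀ c : J → ℕ), B.IsTypical K L N r₀ c₀ →
      B.IsTypical K L N r c → ∃ u : I × J → ℤ, ∀ n₀ : I × J → ℕ,
        (∀ k, ∑ l, n₀ (k, l) = r₀ k) → (∀ l, ∑ k, n₀ (k, l) = c₀ l) →
        (∀ z, |n₀ z - N * B.joint z| ≤ K * √N) →
        ∃ n : I × J → ℕ, (∀ z, (n z : ℤ) = n₀ z + u z) ∧ (∀ k, ∑ l, n (k, l) = r k) ∧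
          (∀ l, ∑ k, n (k, l) = c l) ∧
          multinomialProb B.joint n₀ * (multinomialProb B.p r * multinomialProb B.q c) ≤
            Real.exp (9 / 2 + L / (1 - s)) * (multinomialProb B.p r₀ * multinomialProb B.q c₀) *
              multinomialProb B.joint n := by
  obtain ⟨K', hK'⟩ := B.eventually_exists_shift hgap hs0 hs1 hp hq K L
  filter_upwards [hK', eventually_multinomialProb_le (B.joint_pos hp hq) (max K K') one_pos,
    eventually_multinomialProb_le hp K one_pos, eventually_multinomialProb_le hq K one_pos]
    with N hshift hW hP hQ r₀ r c₀ c h₀ h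
  obtain ⟨u, hu⟩ := hshift r₀ r c₀ c h₀ h
  refine ⟨u, fun n₀ hn₀r hn₀c hn₀ => ?_⟩
  obtain ⟨n, hn_eq, hnr, hnc, hn, hchi⟩ := hu n₀ hn₀r hn₀c hn₀
  refine ⟨n, hn_eq, hnr, hnc, ?_⟩
  have hsum₀ : ∑ z, n₀ z = N := by simp only [Fintype.sum_prod_type, hn₀r, h₀.sum_row]
  have hsum : ∑ z, n z = N := by simp only [Fintype.sum_prod_type, hnr, h.sum_row]
  have hWn := hW n₀ n hsum₀ hsum
    (fun z => (hn₀ z).trans (mul_le_mul_of_nonneg_right (le_max_left _ _) (Real.sqrt_nonneg _)))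
    (fun z => (hn z).trans (mul_le_mul_of_nonneg_right (le_max_right _ _) (Real.sqrt_nonneg _)))
  have hPr := hP r r₀ h.sum_row h₀.sum_row h.row_near h₀.row_near
  have hQc := hQ c c₀ h.sum_col h₀.sum_col h.col_near h₀.col_near
  have hp0 := multinomialProb_nonneg B.p_nonneg
  have hq0 := multinomialProb_nonneg B.q_nonneg
  have hW0 := multinomialProb_nonneg fun z => (B.joint_pos hp hq z).le
  calc _ ≤ _ := mul_le_mul hWn (mul_le_mul hPr hQc (hq0 _) (mul_nonneg (Real.exp_nonneg _) (hp0 _)))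
        (mul_nonneg (hp0 _) (hq0 _)) (mul_nonneg (Real.exp_nonneg _) (hW0 _))
    _ = Real.exp _ * (multinomialProb B.p r₀ * multinomialProb B.q c₀) *
          multinomialProb B.joint n := by
        rw [mul_mul_mul_comm (Real.exp _) _ (Real.exp _), ← Real.exp_add, mul_mul_mul_comm,
          ← Real.exp_add, mul_assoc (Real.exp _), mul_comm (multinomialProb B.joint n)]
    _ ≤ _ := by
        refine mul_le_mul_of_nonneg_right (mul_le_mul_of_nonneg_right (Real.exp_le_exp.2 ?_)
          (mul_nonneg (hp0 _) (hq0 _))) (hW0 _)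
        rw [mul_div_assoc] at hchi
        linarith

section Mass

variable [DecidableEq I] [DecidableEq J]

theorem eventually_sum_multinomialProb_le (K L : ℝ) :
    ∀ᶠ N : ℕ in atTop, ∀ (r₀ : I → ℕ) (c₀ : J → ℕ) (k : Fin N → I) (l : Fin N → J),
      B.IsTypical K L N r₀ c₀ → B.IsTypical K L N (labelCount k) (labelCount l) →
      ∀ T : Finset (I × J → ℕ), (∀ n₀ ∈ T, (∀ x, ∑ y, n₀ (x, y) = r₀ x) ∧
          (∀ y, ∑ x, n₀ (x, y) = c₀ y) ∧ ∀ z, |n₀ z - N * B.joint z| ≤ K * √N) →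
        ∑ n₀ ∈ T, multinomialProb B.joint n₀ ≤
          Real.exp (9 / 2 + L / (1 - s)) * permAvg B.M k l *
            (multinomialProb B.p r₀ * multinomialProb B.q c₀) := by
  filter_upwards [B.eventually_exists_shift_multinomialProb_le hgap hs0 hs1 hp hq K L]
    with N hshift r₀ c₀ k l h₀ h T hT
  obtain ⟨u, hu⟩ := hshift r₀ _ c₀ _ h₀ h
  choose! φ hφ using fun n₀ hn₀ => hu n₀ (hT n₀ hn₀).1 (hT n₀ hn₀).2.1 (hT n₀ hn₀).2.2
  have hφ_inj : Set.InjOn φ T := fun n hn n' hn' heq => funext fun z => by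
    have hz := (hφ n hn).1 z
    have hz' := (hφ n' hn').1 z
    rw [heq] at hz
    lia
  have hmult : 0 < multinomialProb B.p (labelCount k) * multinomialProb B.q (labelCount l) :=
    mul_pos (multinomialProb_pos hp _) (multinomialProb_pos hq _)
  refine le_of_mul_le_mul_right ?_ hmult
  rw [Finset.sum_mul]
  calc _ ≤ ∑ n₀ ∈ T, Real.exp (9 / 2 + L / (1 - s)) *
          (multinomialProb B.p r₀ * multinomialProb B.q c₀) * multinomialProb B.joint (φ n₀) :=
        Finset.sum_le_sum fun n₀ hn₀ => (hφ n₀ hn₀).2.2.2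
    _ = Real.exp (9 / 2 + L / (1 - s)) * (multinomialProb B.p r₀ * multinomialProb B.q c₀) *
          ∑ n ∈ T.image φ, multinomialProb B.joint n := by
        rw [← Finset.mul_sum, Finset.sum_image hφ_inj]
    _ ≤ Real.exp (9 / 2 + L / (1 - s)) * (multinomialProb B.p r₀ * multinomialProb B.q c₀) *
          (permAvg B.M k l *
            (multinomialProb B.p (labelCount k) * multinomialProb B.q (labelCount l))) := by
        refine mul_le_mul_of_nonneg_left (sum_multinomialProb_le_permAvg_mul B.p_nonneg B.q_nonneg
          (fun a b => (B.M_pos a b).le) fun n hn => ?_) (mul_nonneg (Real.exp_nonneg _)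
            (mul_nonneg (multinomialProb_nonneg B.p_nonneg _)
              (multinomialProb_nonneg B.q_nonneg _)))
        obtain ⟨n₀, hn₀, rfl⟩ := Finset.mem_image.1 hn
        exact ⟨(hφ n₀ hn₀).2.1, (hφ n₀ hn₀).2.2.1⟩
    _ = _ := by ring

open Classical in
theorem eventually_iidExp_joint_le_permAvg (K L : ℝ) :
    ∀ᶠ N : ℕ in atTop, ∀ (k : Fin N → I) (l : Fin N → J),
      B.IsTypical K L N (labelCount k) (labelCount l) →
      iidExp B.joint N (fun z =>
          if B.IsTypical K L N (labelCount (Prod.fst ∘ z)) (labelCount (Prod.snd ∘ z)) ∧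
            ∀ a, |labelCount z a - N * B.joint a| ≤ K * √N then 1 else 0)
        ≤ Real.exp (9 / 2 + L / (1 - s)) * permAvg B.M k l := by
  filter_upwards [B.eventually_sum_multinomialProb_le hgap hs0 hs1 hp hq K L] with N hN k l hkl
  let margins (n : I × J → ℕ) : (I → ℕ) × (J → ℕ) :=
    (fun x => ∑ y, n (x, y), fun y => ∑ x, n (x, y))
  let G : Finset (I × J → ℕ) := {n ∈ Finset.piAntidiag Finset.univ N |
    B.IsTypical K L N (margins n).1 (margins n).2 ∧ ∀ a, |n a - N * B.joint a| ≤ K * √N}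
  let S : Finset ((I → ℕ) × (J → ℕ)) :=
    Finset.piAntidiag Finset.univ N ×ˢ Finset.piAntidiag Finset.univ N
  have hGS : ∀ n ∈ G, margins n ∈ S := fun n hn => by
    have h := (Finset.mem_filter.1 hn).2.1
    simp [S, h.sum_row, h.sum_col]
  have hfiber : ∀ m ∈ S, ∑ n ∈ G with margins n = m, multinomialProb B.joint n ≤
      Real.exp (9 / 2 + L / (1 - s)) * permAvg B.M k l *
        (multinomialProb B.p m.1 * multinomialProb B.q m.2) := fun m _ => by
    by_cases hm : B.IsTypical K L N m.1 m.2
    · refine hN m.1 m.2 k l hm hkl _ fun n hn => ?_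
      obtain ⟨hnG, rfl⟩ := Finset.mem_filter.1 hn
      exact ⟨fun _ => rfl, fun _ => rfl, (Finset.mem_filter.1 hnG).2.2⟩
    · rw [Finset.filter_false_of_mem (s := G) (p := fun n => margins n = m) fun n hn h =>
          hm (h ▸ (Finset.mem_filter.1 hn).2.1),
        Finset.sum_empty]
      exact mul_nonneg (mul_nonneg (Real.exp_nonneg _)
        (permAvg_nonneg (fun a b => (B.M_pos a b).le) k l))
        (mul_nonneg (multinomialProb_nonneg B.p_nonneg _) (multinomialProb_nonneg B.q_nonneg _))
  calc _ = ∑ n ∈ G, multinomialProb B.joint n := by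
        simp only [funext (labelCount_fst _), funext (labelCount_snd _)]
        rw [iidExp_comp_labelCount B.joint N fun n => if B.IsTypical K L N (margins n).1
          (margins n).2 ∧ ∀ a, |n a - N * B.joint a| ≤ K * √N then 1 else 0]
        simp only [mul_ite, mul_one, mul_zero, G, Finset.sum_filter]
    _ = ∑ m ∈ S, ∑ n ∈ G with margins n = m, multinomialProb B.joint n :=
        (Finset.sum_fiberwise_of_maps_to hGS _).symm
    _ ≤ _ := Finset.sum_le_sum hfiber
    _ = _ := by
        rw [← Finset.mul_sum, Finset.sum_product, ← Finset.sum_mul_sum,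
          sum_multinomialProb B.sum_p, sum_multinomialProb B.sum_q, one_mul, mul_one]

end Mass

end Shift

theorem iidExp_joint_le {s t : ℝ} (hgap : B.HasGap s) (hs0 : 0 ≤ s) (hs1 : s < 1) (ht : 0 < t)
    {N : ℕ} {Ψ : (Fin N → I) → (Fin N → J) → ℝ}
    (hΨ : ∀ k l (σ : Equiv.Perm (Fin N)), Ψ k (l ∘ σ) = Ψ k l) :
    iidExp B.joint N (fun z => Ψ (Prod.fst ∘ z) (Prod.snd ∘ z)) ≤
      t * Real.exp (B.hs / (1 - s ^ 2)) + (4 * t)⁻¹ * pairExp B.p B.q N (fun k l => Ψ k l ^ 2) := by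
  have hD : pairExp B.p B.q N (fun k l => permAvg B.M k l ^ 2) ≤ Real.exp (B.hs / (1 - s ^ 2)) :=
    (B.pairExp_sq_eq_sum_chaos N).trans_le (B.sum_chaos_le hgap hs0 hs1 N)
  calc _ = pairExp B.p B.q N (fun k l => permAvg B.M k l * Ψ k l) :=
        (pairExp_permAvg_mul B.M hΨ).symm
    _ ≤ pairExp B.p B.q N (fun k l => t * permAvg B.M k l ^ 2 + (4 * t)⁻¹ * Ψ k l ^ 2) := by
        refine iidExp_mono B.p_nonneg fun k => iidExp_mono B.q_nonneg fun l => ?_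
        have h : t * permAvg B.M k l ^ 2 + (4 * t)⁻¹ * Ψ k l ^ 2 - permAvg B.M k l * Ψ k l
            = (4 * t)⁻¹ * (2 * t * permAvg B.M k l - Ψ k l) ^ 2 := by
          field_simp
          ring
        exact sub_nonneg.1 (h ▸ mul_nonneg (by positivity) (sq_nonneg _))
    _ = t * pairExp B.p B.q N (fun k l => permAvg B.M k l ^ 2)
          + (4 * t)⁻¹ * pairExp B.p B.q N (fun k l => Ψ k l ^ 2) := by
        simp only [pairExp, iidExp_add, iidExp_const_mul]
    _ ≤ _ := by gcongr

section Typical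

variable [DecidableEq I] [DecidableEq J]

open Classical in
theorem pairExp_not_isTypical_le {N : ℕ} (hN : 0 < N) {K L : ℝ} (hK : 0 < K) (hL : 0 < L) :
    pairExp B.p B.q N (fun k l => if B.IsTypical K L N (labelCount k) (labelCount l) then 0 else 1)
      ≤ (Fintype.card I + Fintype.card J) / K ^ 2 + 3 * B.hs / L := by
  let Φ₁ (k : Fin N → I) : ℝ := if ∃ a, K * √N < |labelCount k a - N * B.p a| then 1 else 0
  let Φ₂ (l : Fin N → J) : ℝ := if ∃ b, K * √N < |labelCount l b - N * B.q b| then 1 else 0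
  let F (k : Fin N → I) (l : Fin N → J) : ℝ :=
    B.fluct N (fun x => labelCount k x) fun y => labelCount l y
  have hbad : ∀ k l, (if B.IsTypical K L N (labelCount k) (labelCount l) then (0 : ℝ) else 1) ≤
      Φ₁ k + Φ₂ l + L⁻¹ * F k l := fun k l => by
    have hF : 0 ≤ L⁻¹ * F k l := mul_nonneg (inv_nonneg.2 hL.le) (B.fluct_nonneg _ _ _)
    have hΦ₁ : 0 ≤ Φ₁ k := by simp only [Φ₁]; positivity
    have hΦ₂ : 0 ≤ Φ₂ l := by simp only [Φ₂]; positivity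
    split_ifs with h
    · positivity
    by_contra! hlt
    refine h ⟨sum_labelCount k, sum_labelCount l, fun a => ?_, fun b => ?_, ?_⟩
    · by_contra! ha
      have : Φ₁ k = 1 := if_pos ⟨a, ha⟩
      linarith
    · by_contra! hb
      have : Φ₂ l = 1 := if_pos ⟨b, hb⟩
      linarith
    · have : L⁻¹ * F k l < 1 := by linarith
      rw [inv_mul_lt_iff₀ hL, mul_one] at this
      exact this.le
  calc _ ≤ pairExp B.p B.q N (fun k l => Φ₁ k + Φ₂ l + L⁻¹ * F k l) :=
        iidExp_mono B.p_nonneg fun k => iidExp_mono B.q_nonneg fun l => hbad k l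
    _ = iidExp B.p N Φ₁ + iidExp B.q N Φ₂ + L⁻¹ * pairExp B.p B.q N F := by
        simp only [pairExp, iidExp_add, iidExp_const_mul, iidExp_const B.sum_q,
          iidExp_const B.sum_p]
    _ ≤ Fintype.card I / K ^ 2 + Fintype.card J / K ^ 2 + L⁻¹ * (3 * B.hs) := by
        rw [B.pairExp_fluct hN]
        gcongr
        · exact iidExp_exists_lt_abs_labelCount_sub_le B.p_nonneg B.sum_p hN hK
        · exact iidExp_exists_lt_abs_labelCount_sub_le B.q_nonneg B.sum_q hN hK
    _ = _ := by ring

open Classical in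
theorem half_le_iidExp_joint_isTypical (hp : ∀ k, 0 < B.p k) (hq : ∀ l, 0 < B.q l) {s : ℝ}
    (hgap : B.HasGap s) (hs0 : 0 ≤ s) (hs1 : s < 1) {N : ℕ} (hN : 0 < N) {K L : ℝ} (hK : 0 < K)
    (hcard : Fintype.card (I × J) / K ^ 2 ≤ 1 / 4)
    (hbad : pairExp B.p B.q N
      (fun k l => if B.IsTypical K L N (labelCount k) (labelCount l) then 0 else 1)
        ≤ (16 * Real.exp (B.hs / (1 - s ^ 2)))⁻¹) :
    1 / 2 ≤ iidExp B.joint N (fun z =>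
      if B.IsTypical K L N (labelCount (Prod.fst ∘ z)) (labelCount (Prod.snd ∘ z)) ∧
        ∀ a, |labelCount z a - N * B.joint a| ≤ K * √N then 1 else 0) := by
  let E := Real.exp (B.hs / (1 - s ^ 2))
  have hE : 0 < E := Real.exp_pos _
  have hW : ∀ z, 0 ≤ B.joint z := fun z => (B.joint_pos hp hq z).le
  let good (z : Fin N → I × J) : ℝ :=
    if B.IsTypical K L N (labelCount (Prod.fst ∘ z)) (labelCount (Prod.snd ∘ z)) ∧
      ∀ a, |labelCount z a - N * B.joint a| ≤ K * √N then 1 else 0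
  let atypical (k : Fin N → I) (l : Fin N → J) : ℝ :=
    if B.IsTypical K L N (labelCount k) (labelCount l) then 0 else 1
  let far (z : Fin N → I × J) : ℝ := if ∃ a, K * √N < |labelCount z a - N * B.joint a| then 1 else 0
  have hatypical : iidExp B.joint N (fun z => atypical (Prod.fst ∘ z) (Prod.snd ∘ z)) ≤ 1 / 4 := by
    have hsq : ∀ k l, atypical k l ^ 2 = atypical k l := fun k l => by
      simp only [atypical]
      split_ifs <;> norm_num
    have h := B.iidExp_joint_le hgap hs0 hs1 (t := (8 * E)⁻¹) (by positivity) (N := N)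
      (Ψ := atypical) fun k l σ => by simp only [atypical, labelCount_comp_perm]
    simp only [hsq] at h
    calc _ ≤ _ := h
      _ ≤ (8 * E)⁻¹ * E + (4 * (8 * E)⁻¹)⁻¹ * (16 * E)⁻¹ := by gcongr
      _ = 1 / 4 := by field_simp; norm_num
  have hfar : iidExp B.joint N far ≤ 1 / 4 :=
    (iidExp_exists_lt_abs_labelCount_sub_le hW B.sum_joint hN hK).trans hcard
  have hcover : ∀ z, 1 ≤ good z + atypical (Prod.fst ∘ z) (Prod.snd ∘ z) + far z := fun z => by
    simp only [good, atypical, far, ← not_le, ← not_forall]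
    by_cases hT : B.IsTypical K L N (labelCount (Prod.fst ∘ z)) (labelCount (Prod.snd ∘ z)) <;>
      by_cases hnear : ∀ a, |labelCount z a - N * B.joint a| ≤ K * √N <;>
      simp [hT, hnear, -Prod.forall, -not_forall]
  have hle := iidExp_mono (N := N) hW hcover
  rw [iidExp_const B.sum_joint, iidExp_add, iidExp_add] at hle
  linarith

open Classical in
theorem exists_isTypical_window {H e : ℝ} (hH : B.hs ≤ H) (he : 0 < e) :
    ∃ K : ℝ, 0 < K ∧ Fintype.card (I × J) / K ^ 2 ≤ 1 / 4 ∧ ∀ N : ℕ, 0 < N →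
      pairExp B.p B.q N (fun k l =>
        if B.IsTypical K (6 * (H + 1) / e) N (labelCount k) (labelCount l) then 0 else 1) ≤ e := by
  have hH0 : 0 ≤ H := B.hs_nonneg.trans hH
  let A : ℝ := 1 + 4 * Fintype.card (I × J) + 2 * (Fintype.card I + Fintype.card J) / e
  have hA : 0 < A := by positivity
  have hK : √A ^ 2 = A := Real.sq_sqrt hA.le
  refine ⟨√A, Real.sqrt_pos.2 hA, ?_, fun N hN => ?_⟩
  · rw [hK, div_le_iff₀ hA]
    have : 0 ≤ 2 * ((Fintype.card I : ℝ) + Fintype.card J) / e := by positivity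
    linarith
  refine (B.pairExp_not_isTypical_le hN (Real.sqrt_pos.2 hA) (by positivity)).trans ?_
  have hcard : ((Fintype.card I : ℝ) + Fintype.card J) / √A ^ 2 ≤ e / 2 := by
    rw [hK, div_le_iff₀ hA]
    have hcancel : e / 2 * (2 * ((Fintype.card I : ℝ) + Fintype.card J) / e)
        = Fintype.card I + Fintype.card J := by field_simp
    have hnonneg : 0 ≤ e / 2 * (1 + 4 * Fintype.card (I × J)) := by positivity
    rw [mul_add, hcancel]
    linarith
  have hfluct : 3 * B.hs / (6 * (H + 1) / e) ≤ e / 2 := by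
    rw [div_le_iff₀ (by positivity)]
    have : e / 2 * (6 * (H + 1) / e) = 3 * (H + 1) := by
      field_simp
      ring
    linarith
  linarith

end Typical

theorem exists_pairExp_permAvg_lt_le_of_pos {s H e : ℝ} (hs0 : 0 ≤ s) (hs1 : s < 1) (he : 0 < e) :
    ∃ δ > 0, ∀ (I J : Type*) [Fintype I] [Fintype J] (B : BlockKernel I J), (∀ k, 0 < B.p k) →
      (∀ l, 0 < B.q l) → B.HasGap s → B.hs ≤ H → ∀ᶠ N : ℕ in atTop,
        pairExp B.p B.q N (fun k l => if permAvg B.M k l < δ then 1 else 0) ≤ e := by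
  classical
  let E := Real.exp (H / (1 - s ^ 2))
  let e' := min e (16 * E)⁻¹
  let L := 6 * (H + 1) / e'
  let C := Real.exp (9 / 2 + L / (1 - s))
  have he' : 0 < e' := lt_min he (inv_pos.2 (mul_pos (by norm_num) (Real.exp_pos _)))
  have hC : 0 < C := Real.exp_pos _
  refine ⟨(2 * C)⁻¹, by positivity, fun I J _ _ B hp hq hgap hH => ?_⟩
  obtain ⟨K, hK, hcard, hbad⟩ := B.exists_isTypical_window hH he'
  have hE : Real.exp (B.hs / (1 - s ^ 2)) ≤ E :=
    Real.exp_le_exp.2 (div_le_div_of_nonneg_right hH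
      (sub_nonneg.2 (pow_le_one₀ hs0 hs1.le)))
  filter_upwards [B.eventually_iidExp_joint_le_permAvg hgap hs0 hs1 hp hq K L,
    eventually_gt_atTop 0] with N hle hN
  have hgood := B.half_le_iidExp_joint_isTypical hp hq hgap hs0 hs1 hN hK hcard
    ((hbad N hN).trans ((min_le_right _ _).trans (by gcongr)))
  refine le_trans ?_ ((hbad N hN).trans (min_le_left _ _))
  refine iidExp_mono B.p_nonneg fun k => iidExp_mono B.q_nonneg fun l => ?_
  beta_reduce
  split_ifs with hlt htyp <;> try norm_num
  have h := hgood.trans (hle k l htyp)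
  have hlt' : C * permAvg B.M k l < 1 / 2 := by
    calc C * permAvg B.M k l < C * (2 * C)⁻¹ := mul_lt_mul_of_pos_left hlt hC
      _ = 1 / 2 := by field_simp
  linarith

end BlockKernel

section Support

variable {Z : Type*} [Fintype Z] {w : Z → ℝ}

open Classical in
theorem sum_support_mul (hw : ∀ a, 0 ≤ w a) (F : Z → ℝ) :
    ∑ a : {a // 0 < w a}, w a * F a = ∑ a, w a * F a := by
  rw [← Finset.sum_subtype {a | 0 < w a} (by simp) fun a => w a * F a]
  refine Finset.sum_filter_of_ne fun a _ h => (hw a).lt_of_ne' ?_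
  rintro h0
  simp [h0] at h

open Classical in
theorem iidExp_support (hw : ∀ a, 0 ≤ w a) (N : ℕ) (Φ : (Fin N → Z) → ℝ) :
    iidExp (fun a : {a // 0 < w a} => w a) N (fun z => Φ (Subtype.val ∘ z)) = iidExp w N Φ := by
  rw [iidExp_map Subtype.val]
  refine congrArg (fun v => iidExp v N Φ) (funext fun b => ?_)
  simpa [Finset.sum_filter] using sum_support_mul hw fun a => if a = b then 1 else 0

end Support

namespace BlockKernel

variable {I J : Type*} [Fintype I] [Fintype J] (B : BlockKernel I J)

open Classical in
/-- The restriction of a block kernel to the indices of positive weight. -/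
noncomputable def restrictSupport : BlockKernel {k // 0 < B.p k} {l // 0 < B.q l} where
  p k := B.p k
  q l := B.q l
  M k l := B.M k l
  p_nonneg k := k.2.le
  q_nonneg l := l.2.le
  sum_p := by simpa [B.sum_p] using sum_support_mul B.p_nonneg fun _ => 1
  sum_q := by simpa [B.sum_q] using sum_support_mul B.q_nonneg fun _ => 1
  M_pos k l := B.M_pos k l
  row k := (sum_support_mul B.q_nonneg _).trans (B.row k)
  col l := (sum_support_mul B.p_nonneg fun k => B.M k l).trans (B.col l)

theorem hs_restrictSupport : B.restrictSupport.hs = B.hs := by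
  simp only [hs, mul_assoc, ← Finset.mul_sum]
  rw [← sum_support_mul B.p_nonneg]
  exact Finset.sum_congr rfl fun k _ =>
    congrArg _ (sum_support_mul B.q_nonneg fun l => B.ctr k l ^ 2)

theorem HasGap.restrictSupport {B : BlockKernel I J} {s : ℝ} (hgap : B.HasGap s) :
    B.restrictSupport.HasGap s := fun f g => by
  let f' : I → ℝ := Function.extend Subtype.val f 0
  let g' : J → ℝ := Function.extend Subtype.val g 0
  have hf' : ∀ k : {k // 0 < B.p k}, f' k = f k := Subtype.val_injective.extend_apply f 0
  have hg' : ∀ l : {l // 0 < B.q l}, g' l = g l := Subtype.val_injective.extend_apply g 0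
  convert hgap f' g' using 2
  · simp only [mul_assoc, ← Finset.mul_sum]
    rw [← sum_support_mul B.p_nonneg]
    refine Finset.sum_congr rfl fun k _ => congrArg _ ?_
    rw [← sum_support_mul B.q_nonneg]
    simp only [hf', hg']
    rfl
  · rw [← sum_support_mul B.p_nonneg fun k => f' k ^ 2]
    simp only [hf']
    rfl
  · rw [← sum_support_mul B.q_nonneg fun l => g' l ^ 2]
    simp only [hg']
    rfl

theorem exists_pairExp_permAvg_lt_le {s H e : ℝ} (hs0 : 0 ≤ s) (hs1 : s < 1) (he : 0 < e) :
    ∃ δ > 0, ∀ (I J : Type*) [Fintype I] [Fintype J] (B : BlockKernel I J), B.HasGap s →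
      B.hs ≤ H → ∀ᶠ N : ℕ in atTop,
        pairExp B.p B.q N (fun k l => if permAvg B.M k l < δ then 1 else 0) ≤ e := by
  obtain ⟨δ, hδ, h⟩ := exists_pairExp_permAvg_lt_le_of_pos (H := H) hs0 hs1 he
  refine ⟨δ, hδ, fun I J _ _ B hgap hH => ?_⟩
  filter_upwards [h _ _ B.restrictSupport Subtype.prop Subtype.prop hgap.restrictSupport
    (B.hs_restrictSupport.trans_le hH)] with N hN
  refine le_trans (le_of_eq ?_) hN
  simp only [pairExp]
  rw [← iidExp_support B.p_nonneg]
  simp only [← iidExp_support B.q_nonneg]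
  rfl

end BlockKernel

/-! ### Spectral gap of a square integrable coupling -/

theorem integral_comp_measurePreserving {α Ω : Type*} [MeasurableSpace α] [MeasurableSpace Ω]
    {μ : Measure α} {P : Measure Ω} {T : Ω → α} (hT : MeasurePreserving T P μ) {f : α → ℝ}
    (hf : AEStronglyMeasurable f μ) : ∫ z, f (T z) ∂P = ∫ x, f x ∂μ := by
  rw [← hT.map_eq] at hf ⊢
  exact (integral_map hT.measurable.aemeasurable hf).symm

theorem setIntegral_comp_measurePreserving {α Ω : Type*} [MeasurableSpace α] [MeasurableSpace Ω]
    {μ : Measure α} {P : Measure Ω} {T : Ω → α} (hT : MeasurePreserving T P μ) {f : α → ℝ}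
    (hf : AEStronglyMeasurable f μ) {A : Set α} (hA : MeasurableSet A) :
    ∫ z in T ⁻¹' A, f (T z) ∂P = ∫ x in A, f x ∂μ :=
  integral_comp_measurePreserving (hT.restrict_preimage hA) hf.restrict

theorem integral_mul_le_sqrt_mul_sqrt {Ω : Type*} [MeasurableSpace Ω] {P : Measure Ω}
    {u v : Ω → ℝ} (hu : MemLp u 2 P) (hv : MemLp v 2 P) :
    ∫ x, u x * v x ∂P ≤ √(∫ x, u x ^ 2 ∂P) * √(∫ x, v x ^ 2 ∂P) := by
  have hHolder := integral_mul_norm_le_Lp_mul_Lq (μ := P) Real.HolderConjugate.two_two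
    (by simpa using hu) (by simpa using hv)
  simp only [Real.norm_eq_abs, Real.rpow_two, sq_abs, ← Real.sqrt_eq_rpow] at hHolder
  refine (le_abs_self _).trans (abs_integral_le_integral_abs.trans ?_)
  simpa only [abs_mul] using hHolder

theorem integral_sub_sq {Ω : Type*} [MeasurableSpace Ω] {P : Measure Ω} {u v : Ω → ℝ}
    (hu : MemLp u 2 P) (hv : MemLp v 2 P) :
    ∫ x, (u x - v x) ^ 2 ∂P
      = (∫ x, u x ^ 2 ∂P) - 2 * (∫ x, u x * v x ∂P) + ∫ x, v x ^ 2 ∂P := by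
  have hmul : Integrable (fun x => 2 * (u x * v x)) P := (hu.integrable_mul hv).const_mul 2
  have hsub : Integrable (fun x => u x ^ 2 - 2 * (u x * v x)) P := hu.integrable_sq.sub hmul
  simp only [sub_sq, mul_assoc]
  rw [integral_add hsub hv.integrable_sq, integral_sub hu.integrable_sq hmul, integral_const_mul]

theorem tendsto_setIntegral_zero {Ω ι : Type*} [MeasurableSpace Ω] {P : Measure Ω}
    {l : Filter ι} [l.IsCountablyGenerated] {S : ι → Set Ω} (hS : ∀ i, MeasurableSet (S i))
    (hlim : ∀ z, ∀ᶠ i in l, z ∉ S i) {f : Ω → ℝ} (hf : Integrable f P) :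
    Tendsto (fun i => ∫ z in S i, f z ∂P) l (𝓝 0) := by
  simp only [← integral_indicator (hS _)]
  have hdom := tendsto_integral_filter_of_dominated_convergence (l := l)
    (F := fun i => (S i).indicator f) (f := fun _ => 0) (fun z => ‖f z‖)
    (Eventually.of_forall fun i => (hf.indicator (hS i)).aestronglyMeasurable)
    (Eventually.of_forall fun i => ae_of_all _ fun z => norm_indicator_le_norm_self f z)
    hf.norm (ae_of_all _ fun z => tendsto_const_nhds.congr' <| (hlim z).mono fun i hi =>
      (Set.indicator_of_notMem hi f).symm)
  simpa using hdom

section CouplingDensity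

variable {α β : Type*} [MeasurableSpace α] [MeasurableSpace β] {μ : Measure α} {ν : Measure β}
  {ξ : α × β → ℝ}

/-- The measure `ξ(x, y) μ(dx) ν(dy)`. -/
noncomputable def densityProd (μ : Measure α) (ν : Measure β) (ξ : α × β → ℝ) : Measure (α × β) :=
  (μ.prod ν).withDensity fun z => ENNReal.ofReal (ξ z)

/-- A positive square integrable function which is the density of a coupling of `μ` and `ν` with
respect to the product measure. -/
structure IsCouplingDensity (μ : Measure α) (ν : Measure β) (ξ : α × β → ℝ) : Prop where
  measurable : Measurable ξ
  pos : ∀ z, 0 < ξ z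
  memLp : MemLp ξ 2 (μ.prod ν)
  map_fst : (densityProd μ ν ξ).map Prod.fst = μ
  map_snd : (densityProd μ ν ξ).map Prod.snd = ν

namespace IsCouplingDensity

theorem measurePreserving_fst (h : IsCouplingDensity μ ν ξ) :
    MeasurePreserving Prod.fst (densityProd μ ν ξ) μ :=
  ⟨_root_.measurable_fst, h.map_fst⟩

theorem measurePreserving_snd (h : IsCouplingDensity μ ν ξ) :
    MeasurePreserving Prod.snd (densityProd μ ν ξ) ν :=
  ⟨_root_.measurable_snd, h.map_snd⟩

theorem isProbabilityMeasure [IsProbabilityMeasure μ] (h : IsCouplingDensity μ ν ξ) :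
    IsProbabilityMeasure (densityProd μ ν ξ) :=
  ⟨by simpa using h.measurePreserving_fst.measure_preimage MeasurableSet.univ.nullMeasurableSet⟩

theorem integrable_densityProd_iff (h : IsCouplingDensity μ ν ξ) {F : α × β → ℝ} :
    Integrable F (densityProd μ ν ξ) ↔ Integrable (fun z => ξ z * F z) (μ.prod ν) := by
  rw [densityProd, integrable_withDensity_iff_integrable_smul' h.measurable.ennreal_ofReal
    (ae_of_all _ fun _ => ENNReal.ofReal_lt_top)]
  simp only [ENNReal.toReal_ofReal (h.pos _).le, smul_eq_mul]

theorem integral_densityProd (h : IsCouplingDensity μ ν ξ) (F : α × β → ℝ) :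
    ∫ z, F z ∂(densityProd μ ν ξ) = ∫ z, ξ z * F z ∂(μ.prod ν) := by
  rw [densityProd, integral_withDensity_eq_integral_toReal_smul h.measurable.ennreal_ofReal
    (ae_of_all _ fun _ => ENNReal.ofReal_lt_top)]
  simp only [ENNReal.toReal_ofReal (h.pos _).le, smul_eq_mul]

theorem setIntegral_densityProd (h : IsCouplingDensity μ ν ξ) (F : α × β → ℝ)
    {S : Set (α × β)} (hS : MeasurableSet S) :
    ∫ z in S, F z ∂(densityProd μ ν ξ) = ∫ z in S, ξ z * F z ∂(μ.prod ν) := by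
  rw [densityProd, restrict_withDensity hS,
    integral_withDensity_eq_integral_toReal_smul h.measurable.ennreal_ofReal
    (ae_of_all _ fun _ => ENNReal.ofReal_lt_top)]
  simp only [ENNReal.toReal_ofReal (h.pos _).le, smul_eq_mul]

variable {f : α → ℝ} {g : β → ℝ} (h : IsCouplingDensity μ ν ξ)
include h

theorem memLp_comp_fst (hf : MemLp f 2 μ) :
    MemLp (fun z : α × β => f z.1) 2 (densityProd μ ν ξ) :=
  hf.comp_measurePreserving h.measurePreserving_fst

theorem memLp_comp_snd (hg : MemLp g 2 ν) :
    MemLp (fun z : α × β => g z.2) 2 (densityProd μ ν ξ) :=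
  hg.comp_measurePreserving h.measurePreserving_snd

theorem integral_fst_sq (hf : MemLp f 2 μ) :
    ∫ z, f z.1 ^ 2 ∂(densityProd μ ν ξ) = ∫ x, f x ^ 2 ∂μ :=
  integral_comp_measurePreserving h.measurePreserving_fst hf.integrable_sq.aestronglyMeasurable

theorem integral_snd_sq (hg : MemLp g 2 ν) :
    ∫ z, g z.2 ^ 2 ∂(densityProd μ ν ξ) = ∫ y, g y ^ 2 ∂ν :=
  integral_comp_measurePreserving h.measurePreserving_snd hg.integrable_sq.aestronglyMeasurable

theorem mul_setIntegral_le_integral {c : ℝ} {F : α × β → ℝ} (hF0 : ∀ z, 0 ≤ F z)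
    (hF : Integrable F (μ.prod ν)) (hFξ : Integrable F (densityProd μ ν ξ)) :
    c * ∫ z in {z | ξ z < c}ᶜ, F z ∂(μ.prod ν) ≤ ∫ z, F z ∂(densityProd μ ν ξ) := by
  have hthick : MeasurableSet {z | ξ z < c}ᶜ :=
    (measurableSet_lt h.measurable measurable_const).compl
  rw [← integral_const_mul, h.integral_densityProd]
  have hint := h.integrable_densityProd_iff.1 hFξ
  calc ∫ z in {z | ξ z < c}ᶜ, c * F z ∂(μ.prod ν)
      ≤ ∫ z in {z | ξ z < c}ᶜ, ξ z * F z ∂(μ.prod ν) :=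
        setIntegral_mono_on (hF.const_mul c).restrict hint.restrict hthick fun z hz =>
          mul_le_mul_of_nonneg_right (not_lt.1 hz) (hF0 z)
    _ ≤ ∫ z, ξ z * F z ∂(μ.prod ν) :=
        setIntegral_le_integral hint (ae_of_all _ fun z => mul_nonneg (h.pos z).le (hF0 z))

theorem setIntegral_mul_le (hf : MemLp f 2 μ) (hg : MemLp g 2 ν) {A : Set α} {B : Set β}
    (hA : MeasurableSet A) (hB : MeasurableSet B) :
    ∫ z in A ×ˢ B, f z.1 * g z.2 ∂(densityProd μ ν ξ) ≤
      1 / 2 * ((∫ x in A, f x ^ 2 ∂μ) + ∫ y in B, g y ^ 2 ∂ν) := by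
  have hfst := (h.memLp_comp_fst hf).integrable_sq
  have hsnd := (h.memLp_comp_snd hg).integrable_sq
  have hleft : ∫ z in A ×ˢ B, f z.1 ^ 2 ∂(densityProd μ ν ξ) ≤ ∫ x in A, f x ^ 2 ∂μ := by
    rw [← setIntegral_comp_measurePreserving h.measurePreserving_fst
      hf.integrable_sq.aestronglyMeasurable hA]
    exact setIntegral_mono_set hfst.restrict (ae_of_all _ fun z => sq_nonneg _)
      (ae_of_all _ fun z hz => hz.1)
  have hright : ∫ z in A ×ˢ B, g z.2 ^ 2 ∂(densityProd μ ν ξ) ≤ ∫ y in B, g y ^ 2 ∂ν := by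
    rw [← setIntegral_comp_measurePreserving h.measurePreserving_snd
      hg.integrable_sq.aestronglyMeasurable hB]
    exact setIntegral_mono_set hsnd.restrict (ae_of_all _ fun z => sq_nonneg _)
      (ae_of_all _ fun z hz => hz.2)
  calc ∫ z in A ×ˢ B, f z.1 * g z.2 ∂(densityProd μ ν ξ)
      ≤ ∫ z in A ×ˢ B, 1 / 2 * (f z.1 ^ 2 + g z.2 ^ 2) ∂(densityProd μ ν ξ) := by
        refine integral_mono ((h.memLp_comp_fst hf).integrable_mul (h.memLp_comp_snd hg)).restrict
          ((hfst.add hsnd).const_mul (1 / 2)).restrict fun z => ?_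
        change f z.1 * g z.2 ≤ _
        linarith [two_mul_le_add_sq (f z.1) (g z.2)]
    _ ≤ 1 / 2 * ((∫ x in A, f x ^ 2 ∂μ) + ∫ y in B, g y ^ 2 ∂ν) := by
        rw [integral_const_mul, integral_add hfst.restrict hsnd.restrict]
        gcongr

end IsCouplingDensity

end CouplingDensity

section Gap

variable {α β : Type*} [MeasurableSpace α] [MeasurableSpace β] {μ : Measure α} {ν : Measure β}
  [IsProbabilityMeasure μ] [IsProbabilityMeasure ν] {ξ : α × β → ℝ} {f : α → ℝ} {g : β → ℝ}

theorem memLp_comp_fst_prod {μ : Measure α} (hf : MemLp f 2 μ) :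
    MemLp (fun z : α × β => f z.1) 2 (μ.prod ν) :=
  hf.comp_measurePreserving measurePreserving_fst

theorem memLp_comp_snd_prod {ν : Measure β} [SFinite ν] (hg : MemLp g 2 ν) :
    MemLp (fun z : α × β => g z.2) 2 (μ.prod ν) :=
  hg.comp_measurePreserving measurePreserving_snd

theorem setIntegral_fst_le {S : Set (α × β)} (hS : MeasurableSet S) {A : Set α}
    (hA : MeasurableSet A) {δ : ℝ} (hδ0 : 0 ≤ δ) (hδ : ∀ x ∈ A, ν.real (Prod.mk x ⁻¹' S) ≤ δ)
    {u : α → ℝ} (hu0 : ∀ x, 0 ≤ u x) (hu : Integrable u μ) :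
    ∫ z in S, u z.1 ∂(μ.prod ν) ≤ δ * (∫ x, u x ∂μ) + ∫ x in Aᶜ, u x ∂μ := by
  have hsection : ∀ x, ∫ y, S.indicator (fun z => u z.1) (x, y) ∂ν
      = ν.real (Prod.mk x ⁻¹' S) * u x := fun x => by
    rw [← smul_eq_mul, ← integral_indicator_const (u x) (measurable_prodMk_left hS)]
    rfl
  have hint := (hu.comp_fst ν).indicator hS
  rw [← integral_indicator hS, integral_prod _ hint, ← integral_indicator hA.compl,
    ← integral_const_mul, ← integral_add (hu.const_mul δ) (hu.indicator hA.compl)]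
  refine integral_mono hint.integral_prod_left
    ((hu.const_mul δ).add (hu.indicator hA.compl)) fun x => ?_
  simp only [hsection]
  by_cases hx : x ∈ A
  · simpa [hx] using mul_le_mul_of_nonneg_right (hδ x hx) (hu0 x)
  · rw [Set.indicator_of_mem (Set.mem_compl hx)]
    nlinarith [hu0 x, measureReal_le_one (μ := ν) (s := Prod.mk x ⁻¹' S), mul_nonneg hδ0 (hu0 x)]

theorem setIntegral_snd_le {S : Set (α × β)} (hS : MeasurableSet S) {B : Set β}
    (hB : MeasurableSet B) {δ : ℝ} (hδ0 : 0 ≤ δ)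
    (hδ : ∀ y ∈ B, μ.real ((fun x => (x, y)) ⁻¹' S) ≤ δ)
    {v : β → ℝ} (hv0 : ∀ y, 0 ≤ v y) (hv : Integrable v ν) :
    ∫ z in S, v z.2 ∂(μ.prod ν) ≤ δ * (∫ y, v y ∂ν) + ∫ y in Bᶜ, v y ∂ν := by
  have hswap := setIntegral_comp_measurePreserving
    (Measure.measurePreserving_swap (μ := ν) (ν := μ)) (hv.comp_snd μ).aestronglyMeasurable hS
  rw [← hswap]
  exact setIntegral_fst_le (measurable_swap hS) hB hδ0 hδ hv0 hv

/-- Sets carrying most of the mass of a density `ξ`, in whose points most of the sections of `ξ`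
are at least `c`. -/
structure IsThick (μ : Measure α) (ν : Measure β) (ξ : α × β → ℝ) (c : ℝ) (A : Set α) (B : Set β) :
    Prop where
  left : ∀ x ∈ A, ν.real {y | ξ (x, y) < c} ≤ 1 / 8
  right : ∀ y ∈ B, μ.real {x | ξ (x, y) < c} ≤ 1 / 8
  measurableSet_left : MeasurableSet A
  measurableSet_right : MeasurableSet B
  setIntegral_sq_le : ∫ z in (A ×ˢ B)ᶜ, ξ z ^ 2 ∂(μ.prod ν) ≤ 1 / 64

theorem eventually_measureReal_lt_le {Ω : Type*} [MeasurableSpace Ω] (P : Measure Ω)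
    [IsFiniteMeasure P] {u : Ω → ℝ} (hu : Measurable u) (hu0 : ∀ z, 0 < u z) {e : ℝ}
    (he : 0 < e) : ∀ᶠ c in 𝓝[>] (0 : ℝ), P.real {z | u z < c} ≤ e := by
  have hlim := tendsto_setIntegral_zero (l := 𝓝[>] (0 : ℝ)) (P := P) (S := fun c => {z | u z < c})
    (fun c => measurableSet_lt hu measurable_const)
    (fun z => nhdsWithin_le_nhds <| (gt_mem_nhds (hu0 z)).mono fun c hc => not_lt.2 hc.le)
    (integrable_const (1 : ℝ))
  simpa using hlim.eventually_le_const he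

theorem IsCouplingDensity.exists_isThick (h : IsCouplingDensity μ ν ξ) :
    ∃ c, 0 < c ∧ c ≤ 1 / 2 ∧ ∃ A B, IsThick μ ν ξ c A B := by
  let A : ℝ → Set α := fun c => {x | ν.real {y | ξ (x, y) < c} ≤ 1 / 8}
  let B : ℝ → Set β := fun c => {y | μ.real {x | ξ (x, y) < c} ≤ 1 / 8}
  have hsub : ∀ c, MeasurableSet {z | ξ z < c} := fun c => measurableSet_lt h.measurable
    measurable_const
  have hA : ∀ c, MeasurableSet (A c) := fun c =>
    measurableSet_le (measurable_measure_prodMk_left (hsub c)).ennreal_toReal measurable_const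
  have hB : ∀ c, MeasurableSet (B c) := fun c =>
    measurableSet_le (measurable_measure_prodMk_right (hsub c)).ennreal_toReal measurable_const
  have hlim : Tendsto (fun c => ∫ z in (A c ×ˢ B c)ᶜ, ξ z ^ 2 ∂(μ.prod ν)) (𝓝[>] 0) (𝓝 0) := by
    refine tendsto_setIntegral_zero (fun c => ((hA c).prod (hB c)).compl) (fun z => ?_)
      h.memLp.integrable_sq
    filter_upwards [eventually_measureReal_lt_le ν (h.measurable.comp measurable_prodMk_left)
        (fun y => h.pos (z.1, y)) (by norm_num : (0 : ℝ) < 1 / 8),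
      eventually_measureReal_lt_le μ (h.measurable.comp measurable_prodMk_right)
        (fun x => h.pos (x, z.2)) (by norm_num : (0 : ℝ) < 1 / 8)] with c hleft hright
    exact not_not_intro ⟨hleft, hright⟩
  obtain ⟨c, ⟨hc, hc2⟩, hc0⟩ := ((hlim.eventually_le_const (by norm_num : (0 : ℝ) < 1 / 64)).and
    (nhdsWithin_le_nhds (Iic_mem_nhds (by norm_num : (0 : ℝ) < 1 / 2)))).and
      self_mem_nhdsWithin |>.exists
  exact ⟨c, hc0, hc2, A c, B c, fun _ hx => hx, fun _ hy => hy, hA c, hB c, hc⟩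


theorem integral_prod_sub_sq (hf : MemLp f 2 μ) (hg : MemLp g 2 ν) (hf0 : ∫ x, f x ∂μ = 0) :
    ∫ z, (f z.1 - g z.2) ^ 2 ∂(μ.prod ν) = (∫ x, f x ^ 2 ∂μ) + ∫ y, g y ^ 2 ∂ν := by
  rw [integral_sub_sq (memLp_comp_fst_prod hf) (memLp_comp_snd_prod hg), integral_prod_mul f g,
    hf0, zero_mul, mul_zero, sub_zero,
    integral_comp_measurePreserving measurePreserving_fst hf.integrable_sq.aestronglyMeasurable,
    integral_comp_measurePreserving measurePreserving_snd hg.integrable_sq.aestronglyMeasurable]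

theorem IsThick.setIntegral_sub_sq_le {c : ℝ} {A : Set α} {B : Set β}
    (hthick : IsThick μ ν ξ c A B) (hξ : Measurable ξ) (hf : MemLp f 2 μ) (hg : MemLp g 2 ν) :
    ∫ z in {z | ξ z < c}, (f z.1 - g z.2) ^ 2 ∂(μ.prod ν) ≤
      1 / 4 * ((∫ x, f x ^ 2 ∂μ) + ∫ y, g y ^ 2 ∂ν)
        + 2 * ((∫ x in Aᶜ, f x ^ 2 ∂μ) + ∫ y in Bᶜ, g y ^ 2 ∂ν) := by
  have hfst := memLp_comp_fst_prod (ν := ν) hf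
  have hsnd := memLp_comp_snd_prod (μ := μ) hg
  have hthin : MeasurableSet {z | ξ z < c} := measurableSet_lt hξ measurable_const
  have hleft := setIntegral_fst_le hthin hthick.measurableSet_left (by norm_num) hthick.left
    (fun x => sq_nonneg (f x)) hf.integrable_sq
  have hright := setIntegral_snd_le hthin hthick.measurableSet_right (by norm_num) hthick.right
    (fun y => sq_nonneg (g y)) hg.integrable_sq
  calc ∫ z in {z | ξ z < c}, (f z.1 - g z.2) ^ 2 ∂(μ.prod ν)
      ≤ ∫ z in {z | ξ z < c}, (2 * f z.1 ^ 2 + 2 * g z.2 ^ 2) ∂(μ.prod ν) := by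
        refine integral_mono (hfst.sub hsnd).integrable_sq.restrict
          ((hfst.integrable_sq.const_mul 2).add (hsnd.integrable_sq.const_mul 2)).restrict
          fun z => ?_
        nlinarith [sq_nonneg (f z.1 + g z.2)]
    _ = 2 * (∫ z in {z | ξ z < c}, f z.1 ^ 2 ∂(μ.prod ν))
          + 2 * ∫ z in {z | ξ z < c}, g z.2 ^ 2 ∂(μ.prod ν) := by
        rw [integral_add (hfst.integrable_sq.const_mul 2).restrict
          (hsnd.integrable_sq.const_mul 2).restrict, integral_const_mul, integral_const_mul]
    _ ≤ _ := by linarith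

/-- The maximal correlation of the two coordinates under `densityProd μ ν ξ` is at most `s`. Second
moments in place of variances give an equivalent condition, by centring `f` and `g`. -/
def HasCorrelationLE (μ : Measure α) (ν : Measure β) (ξ : α × β → ℝ) (s : ℝ) : Prop :=
  ∀ (f : α → ℝ) (g : β → ℝ), MemLp f 2 μ → MemLp g 2 ν →
    ((∫ z, f z.1 * g z.2 ∂(densityProd μ ν ξ)) - (∫ x, f x ∂μ) * ∫ y, g y ∂ν) ^ 2
      ≤ s ^ 2 * (∫ x, f x ^ 2 ∂μ) * ∫ y, g y ^ 2 ∂ν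

namespace IsCouplingDensity

variable (h : IsCouplingDensity μ ν ξ)
include h

theorem integral_mul_le_of_tail_le {c : ℝ} (hc : 0 ≤ c) {A : Set α} {B : Set β}
    (hthick : IsThick μ ν ξ c A B) (hf : MemLp f 2 μ) (hg : MemLp g 2 ν)
    (hf0 : ∫ x, f x ∂μ = 0) (htail : (∫ x in Aᶜ, f x ^ 2 ∂μ) + ∫ y in Bᶜ, g y ^ 2 ∂ν
      ≤ 1 / 4 * ((∫ x, f x ^ 2 ∂μ) + ∫ y, g y ^ 2 ∂ν)) :
    ∫ z, f z.1 * g z.2 ∂(densityProd μ ν ξ) ≤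
      (1 / 2 - c / 8) * ((∫ x, f x ^ 2 ∂μ) + ∫ y, g y ^ 2 ∂ν) := by
  have hfst := h.memLp_comp_fst hf
  have hsnd := h.memLp_comp_snd hg
  have hprod : Integrable (fun z : α × β => (f z.1 - g z.2) ^ 2) (μ.prod ν) :=
    ((memLp_comp_fst_prod hf).sub (memLp_comp_snd_prod hg)).integrable_sq
  have hsplit := integral_add_compl (measurableSet_lt h.measurable (measurable_const (a := c)))
    hprod
  rw [integral_prod_sub_sq hf hg hf0] at hsplit
  have hthin := hthick.setIntegral_sub_sq_le h.measurable hf hg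
  have hlower := h.mul_setIntegral_le_integral (c := c) (fun z => sq_nonneg (f z.1 - g z.2)) hprod
    (hfst.sub hsnd).integrable_sq
  rw [integral_sub_sq hfst hsnd, h.integral_fst_sq hf, h.integral_snd_sq hg] at hlower
  have hbulk : 1 / 4 * ((∫ x, f x ^ 2 ∂μ) + ∫ y, g y ^ 2 ∂ν)
      ≤ ∫ z in {z | ξ z < c}ᶜ, (f z.1 - g z.2) ^ 2 ∂(μ.prod ν) := by linarith
  linarith [mul_le_mul_of_nonneg_left hbulk hc]

theorem setIntegral_mul_le_of_setIntegral_sq_le (hf : MemLp f 2 μ) (hg : MemLp g 2 ν)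
    {S : Set (α × β)} (hS : MeasurableSet S) {r : ℝ} (hr : 0 ≤ r)
    (hξ : ∫ z in S, ξ z ^ 2 ∂(μ.prod ν) ≤ r ^ 2) :
    ∫ z in S, f z.1 * g z.2 ∂(densityProd μ ν ξ) ≤
      r / 2 * ((∫ x, f x ^ 2 ∂μ) + ∫ y, g y ^ 2 ∂ν) := by
  have hF : 0 ≤ ∫ x, f x ^ 2 ∂μ := integral_nonneg fun x => sq_nonneg _
  have hG : 0 ≤ ∫ y, g y ^ 2 ∂ν := integral_nonneg fun y => sq_nonneg _
  have hfg : MemLp (fun z : α × β => f z.1 * g z.2) 2 (μ.prod ν) := by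
    refine (memLp_two_iff_integrable_sq ?_).2 ?_
    · exact (memLp_comp_fst_prod hf).aestronglyMeasurable.mul
        (memLp_comp_snd_prod hg).aestronglyMeasurable
    · simp only [mul_pow]
      exact hf.integrable_sq.mul_prod hg.integrable_sq
  have hfgS : ∫ z in S, (f z.1 * g z.2) ^ 2 ∂(μ.prod ν)
      ≤ (∫ x, f x ^ 2 ∂μ) * ∫ y, g y ^ 2 ∂ν := by
    rw [← integral_prod_mul]
    simp only [← mul_pow]
    exact setIntegral_le_integral hfg.integrable_sq (ae_of_all _ fun z => sq_nonneg _)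
  rw [h.setIntegral_densityProd _ hS]
  calc ∫ z in S, ξ z * (f z.1 * g z.2) ∂(μ.prod ν)
      ≤ √(∫ z in S, ξ z ^ 2 ∂(μ.prod ν)) * √(∫ z in S, (f z.1 * g z.2) ^ 2 ∂(μ.prod ν)) :=
        integral_mul_le_sqrt_mul_sqrt (h.memLp.restrict S) (hfg.restrict S)
    _ ≤ r * (√(∫ x, f x ^ 2 ∂μ) * √(∫ y, g y ^ 2 ∂ν)) := by
        rw [← Real.sqrt_mul hF]
        exact mul_le_mul (Real.sqrt_le_iff.2 ⟨hr, hξ⟩) (Real.sqrt_le_sqrt hfgS)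
          (Real.sqrt_nonneg _) hr
    _ ≤ r / 2 * ((∫ x, f x ^ 2 ∂μ) + ∫ y, g y ^ 2 ∂ν) := by
        have hamgm := two_mul_le_add_sq √(∫ x, f x ^ 2 ∂μ) √(∫ y, g y ^ 2 ∂ν)
        rw [Real.sq_sqrt hF, Real.sq_sqrt hG] at hamgm
        linarith [mul_le_mul_of_nonneg_left hamgm hr]

theorem integral_mul_le {c : ℝ} (hc0 : 0 ≤ c) (hc : c ≤ 1 / 2) {A : Set α} {B : Set β}
    (hthick : IsThick μ ν ξ c A B) (hf : MemLp f 2 μ) (hg : MemLp g 2 ν)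
    (hf0 : ∫ x, f x ∂μ = 0) :
    ∫ z, f z.1 * g z.2 ∂(densityProd μ ν ξ) ≤
      (1 / 2 - c / 8) * ((∫ x, f x ^ 2 ∂μ) + ∫ y, g y ^ 2 ∂ν) := by
  have hA := hthick.measurableSet_left
  have hB := hthick.measurableSet_right
  rcases le_total ((∫ x in Aᶜ, f x ^ 2 ∂μ) + ∫ y in Bᶜ, g y ^ 2 ∂ν)
    (1 / 4 * ((∫ x, f x ^ 2 ∂μ) + ∫ y, g y ^ 2 ∂ν)) with htail | htail
  · exact h.integral_mul_le_of_tail_le hc0 hthick hf hg hf0 htail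
  · have hF : 0 ≤ ∫ x, f x ^ 2 ∂μ := integral_nonneg fun x => sq_nonneg _
    have hG : 0 ≤ ∫ y, g y ^ 2 ∂ν := integral_nonneg fun y => sq_nonneg _
    have hsplit := integral_add_compl (hA.prod hB)
      ((h.memLp_comp_fst hf).integrable_mul (h.memLp_comp_snd hg))
    simp only [Pi.mul_apply] at hsplit
    have hbulk := h.setIntegral_mul_le hf hg hA hB
    have hrest := h.setIntegral_mul_le_of_setIntegral_sq_le hf hg (hA.prod hB).compl
      (r := 1 / 8) (by norm_num) (hthick.setIntegral_sq_le.trans_eq (by norm_num))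
    have hfA := integral_add_compl hA hf.integrable_sq
    have hgB := integral_add_compl hB hg.integrable_sq
    nlinarith

theorem sq_integral_mul_le {c : ℝ} (hc0 : 0 ≤ c) (hc : c ≤ 1 / 2) {A : Set α} {B : Set β}
    (hthick : IsThick μ ν ξ c A B) (hf : MemLp f 2 μ) (hg : MemLp g 2 ν)
    (hf0 : ∫ x, f x ∂μ = 0) :
    (∫ z, f z.1 * g z.2 ∂(densityProd μ ν ξ)) ^ 2
      ≤ (1 - c / 4) ^ 2 * (∫ x, f x ^ 2 ∂μ) * ∫ y, g y ^ 2 ∂ν := by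
  have hquad : ∀ t : ℝ, 0 ≤ (1 / 2 - c / 8) * (∫ x, f x ^ 2 ∂μ) * (t * t)
      + -(∫ z, f z.1 * g z.2 ∂(densityProd μ ν ξ)) * t
      + (1 / 2 - c / 8) * ∫ y, g y ^ 2 ∂ν := fun t => by
    have hscaled := h.integral_mul_le hc0 hc hthick (hf.const_mul t) hg
      (by rw [integral_const_mul, hf0, mul_zero])
    simp only [mul_assoc, mul_pow, integral_const_mul] at hscaled
    linarith
  have hdiscrim := discrim_le_zero hquad
  simp only [discrim] at hdiscrim
  linarith

theorem exists_hasCorrelationLE : ∃ s : ℝ, 0 ≤ s ∧ s < 1 ∧ HasCorrelationLE μ ν ξ s := by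
  obtain ⟨c, hc0, hc, A, B, hthick⟩ := h.exists_isThick
  refine ⟨1 - c / 4, by linarith, by linarith, fun f g hf hg => ?_⟩
  have hmean : MemLp (fun _ : α => ∫ x, f x ∂μ) 2 μ := memLp_const _
  have hcentred : ∫ x, (f x - ∫ x, f x ∂μ) ∂μ = 0 := by
    rw [integral_sub (hf.integrable one_le_two) (integrable_const _)]
    simp
  have hvar : ∫ x, (f x - ∫ x, f x ∂μ) ^ 2 ∂μ ≤ ∫ x, f x ^ 2 ∂μ := by
    rw [integral_sub_sq hf hmean, integral_mul_const]
    simp only [integral_const, probReal_univ, one_smul]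
    nlinarith [sq_nonneg (∫ x, f x ∂μ)]
  have hcov : ∫ z, (f z.1 - ∫ x, f x ∂μ) * g z.2 ∂(densityProd μ ν ξ)
      = (∫ z, f z.1 * g z.2 ∂(densityProd μ ν ξ)) - (∫ x, f x ∂μ) * ∫ y, g y ∂ν := by
    have hmul : Integrable (fun z => f z.1 * g z.2) (densityProd μ ν ξ) :=
      (h.memLp_comp_fst hf).integrable_mul (h.memLp_comp_snd hg)
    have hsnd : Integrable (fun z : α × β => g z.2) (densityProd μ ν ξ) :=
      h.measurePreserving_snd.integrable_comp_of_integrable (hg.integrable one_le_two)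
    simp only [sub_mul]
    rw [integral_sub hmul (hsnd.const_mul _), integral_const_mul,
      integral_comp_measurePreserving h.measurePreserving_snd hg.aestronglyMeasurable]
  rw [← hcov]
  refine (h.sq_integral_mul_le hc0.le hc hthick (hf.sub hmean) hg hcentred).trans ?_
  exact mul_le_mul_of_nonneg_right (mul_le_mul_of_nonneg_left hvar (sq_nonneg _))
    (integral_nonneg fun y => sq_nonneg _)

end IsCouplingDensity

end Gap

/-! ### Finite partitions -/

section Label

variable {Ω I : Type*} [MeasurableSpace Ω] [MeasurableSpace I] [MeasurableSingletonClass I]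
  {P : Measure Ω} {ℓ : Ω → I}

theorem setIntegral_preimage_label (hℓ : Measurable ℓ) {F : Ω → ℝ} (hF : Integrable F P)
    (S : Finset I) : ∫ z in ℓ ⁻¹' S, F z ∂P = ∑ i ∈ S, ∫ z in ℓ ⁻¹' {i}, F z ∂P := by
  have hunion : ℓ ⁻¹' S = ⋃ i ∈ S, ℓ ⁻¹' {i} := by
    ext z
    simp
  rw [hunion]
  exact integral_biUnion_finset S (fun i _ => hℓ (measurableSet_singleton i))
    (fun i _ j _ hij => Disjoint.preimage ℓ (Set.disjoint_singleton.2 hij))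
    fun i _ => hF.integrableOn

variable [IsFiniteMeasure P]

theorem memLp_comp_label [Finite I] (hℓ : Measurable ℓ) (u : I → ℝ) :
    MemLp (fun z => u (ℓ z)) 2 P :=
  (MemLp.of_discrete (f := u) (μ := P.map ℓ)).comp_of_map hℓ.aemeasurable

theorem integral_comp_label [Fintype I] (hℓ : Measurable ℓ) (u : I → ℝ) :
    ∫ z, u (ℓ z) ∂P = ∑ i, P.real (ℓ ⁻¹' {i}) * u i := by
  rw [← integral_map hℓ.aemeasurable .of_discrete, integral_fintype .of_finite]
  simp [map_measureReal_apply hℓ (measurableSet_singleton _)]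

theorem comp_label_ae_eq_condExp [Finite I] (hℓ : Measurable ℓ) {F : Ω → ℝ}
    (hF : Integrable F P) {u : I → ℝ}
    (hu : ∀ i, P.real (ℓ ⁻¹' {i}) * u i = ∫ z in ℓ ⁻¹' {i}, F z ∂P) :
    (fun z => u (ℓ z)) =ᵐ[P] P[F | MeasurableSpace.comap ℓ inferInstance] := by
  have hint := (memLp_comp_label (P := P) hℓ u).integrable one_le_two
  refine ae_eq_condExp_of_forall_setIntegral_eq hℓ.comap_le hF
    (fun s _ _ => hint.integrableOn) ?_
    ((measurable_of_finite u).comp (comap_measurable ℓ)).aestronglyMeasurable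
  rintro _ ⟨S, -, rfl⟩ -
  rw [← S.toFinite.coe_toFinset, setIntegral_preimage_label hℓ hint,
    setIntegral_preimage_label hℓ hF]
  refine Finset.sum_congr rfl fun i _ => ?_
  rw [← hu, setIntegral_congr_fun (hℓ (measurableSet_singleton i))
    fun z (hz : ℓ z = i) => congrArg u hz, setIntegral_const, smul_eq_mul]

end Label

theorem prodMap_preimage_singleton {α β I J : Type*} (cl : α → I) (cl' : β → J) (k : I)
    (l : J) :
    Prod.map cl cl' ⁻¹' {(k, l)} = (cl ⁻¹' {k}) ×ˢ (cl' ⁻¹' {l}) := by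
  rw [← Set.singleton_prod_singleton, Set.preimage_prod_map_prod]

theorem sum_measureReal_cell {α β I J : Type*} [MeasurableSpace α] [MeasurableSpace β]
    [MeasurableSpace I] [MeasurableSingletonClass I] [MeasurableSpace J]
    [MeasurableSingletonClass J] {cl : α → I} {cl' : β → J} (P : Measure (α × β))
    [IsFiniteMeasure P] (hcl : Measurable cl) (hcl' : Measurable cl') (K : Finset I)
    (L : Finset J) :
    ∑ k ∈ K, ∑ l ∈ L, P.real ((cl ⁻¹' {k}) ×ˢ (cl' ⁻¹' {l}))
      = P.real ((cl ⁻¹' K) ×ˢ (cl' ⁻¹' L)) := by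
  simp only [← prodMap_preimage_singleton]
  rw [← Finset.sum_product', sum_measureReal_preimage_singleton _ fun z _ =>
    (hcl.prodMap hcl') (measurableSet_singleton z)]
  congr 1
  ext z
  simp

/-! ### Block approximations of a coupling density -/

section Blocks

variable {α β I J : Type*} [MeasurableSpace α] [MeasurableSpace β]

/-- The averages of `ξ` over the cells of a product partition, with the value one on null cells so
that they form a positive kernel. -/
noncomputable def blockDensity (μ : Measure α) (ν : Measure β) (ξ : α × β → ℝ) (cl : α → I)
    (cl' : β → J) (k : I) (l : J) : ℝ :=
  if μ.real (cl ⁻¹' {k}) * ν.real (cl' ⁻¹' {l}) = 0 then 1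
  else (densityProd μ ν ξ).real ((cl ⁻¹' {k}) ×ˢ (cl' ⁻¹' {l}))
    / (μ.real (cl ⁻¹' {k}) * ν.real (cl' ⁻¹' {l}))

theorem IsCouplingDensity.blockDensity_pos {μ : Measure α} {ν : Measure β}
    [IsProbabilityMeasure μ] [IsFiniteMeasure ν] {ξ : α × β → ℝ} (h : IsCouplingDensity μ ν ξ)
    (cl : α → I) (cl' : β → J) (k : I) (l : J) : 0 < blockDensity μ ν ξ cl cl' k l := by
  have := h.isProbabilityMeasure
  rw [blockDensity]
  split_ifs with h0
  · exact one_pos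
  · refine div_pos (measureReal_nonneg.lt_of_ne' fun hcell => h0 ?_)
      ((mul_nonneg measureReal_nonneg measureReal_nonneg).lt_of_ne' h0)
    have hcell' : densityProd μ ν ξ ((cl ⁻¹' {k}) ×ˢ (cl' ⁻¹' {l})) = 0 :=
      (measureReal_eq_zero_iff (measure_ne_top _ _)).1 hcell
    rw [← measureReal_prod_prod, measureReal_eq_zero_iff (measure_ne_top _ _)]
    exact withDensity_absolutelyContinuous' h.measurable.ennreal_ofReal.aemeasurable
      (ae_of_all _ fun z => (ENNReal.ofReal_pos.2 (h.pos z)).ne') hcell'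

variable [MeasurableSpace I] [MeasurableSingletonClass I] [MeasurableSpace J]
  [MeasurableSingletonClass J] {μ : Measure α} {ν : Measure β}
  [IsProbabilityMeasure μ] {ξ : α × β → ℝ} {cl : α → I} {cl' : β → J}

namespace IsCouplingDensity

variable (h : IsCouplingDensity μ ν ξ) (hcl : Measurable cl) (hcl' : Measurable cl')
include h hcl hcl'

theorem mul_blockDensity (k : I) (l : J) :
    μ.real (cl ⁻¹' {k}) * ν.real (cl' ⁻¹' {l}) * blockDensity μ ν ξ cl cl' k l
      = (densityProd μ ν ξ).real ((cl ⁻¹' {k}) ×ˢ (cl' ⁻¹' {l})) := by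
  have := h.isProbabilityMeasure
  rw [blockDensity]
  split_ifs with h0
  · refine le_antisymm (by rw [h0, zero_mul]; exact measureReal_nonneg) ?_
    rw [h0, zero_mul]
    rcases mul_eq_zero.1 h0 with h0 | h0
    · rw [← h0, ← h.measurePreserving_fst.measureReal_preimage
        (hcl (measurableSet_singleton k)).nullMeasurableSet]
      exact measureReal_mono fun z hz => hz.1
    · rw [← h0, ← h.measurePreserving_snd.measureReal_preimage
        (hcl' (measurableSet_singleton l)).nullMeasurableSet]
      exact measureReal_mono fun z hz => hz.2
  · exact mul_div_cancel₀ _ h0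

theorem sum_measureReal_cell_right [Fintype J] (k : I) :
    ∑ l, (densityProd μ ν ξ).real ((cl ⁻¹' {k}) ×ˢ (cl' ⁻¹' {l})) = μ.real (cl ⁻¹' {k}) := by
  have := h.isProbabilityMeasure
  have hsum := sum_measureReal_cell (densityProd μ ν ξ) hcl hcl' {k} Finset.univ
  rw [Finset.sum_singleton] at hsum
  rw [hsum, ← h.measurePreserving_fst.measureReal_preimage
    (hcl (measurableSet_singleton k)).nullMeasurableSet]
  simp [Set.prod_univ]

theorem sum_measureReal_cell_left [Fintype I] (l : J) :
    ∑ k, (densityProd μ ν ξ).real ((cl ⁻¹' {k}) ×ˢ (cl' ⁻¹' {l})) = ν.real (cl' ⁻¹' {l}) := by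
  have := h.isProbabilityMeasure
  have hsum := sum_measureReal_cell (densityProd μ ν ξ) hcl hcl' Finset.univ {l}
  simp only [Finset.sum_singleton] at hsum
  rw [hsum, ← h.measurePreserving_snd.measureReal_preimage
    (hcl' (measurableSet_singleton l)).nullMeasurableSet]
  simp [Set.univ_prod]

theorem blockDensity_ae_eq_condExp [IsProbabilityMeasure ν] [Finite I] [Finite J] :
    (fun z => blockDensity μ ν ξ cl cl' (cl z.1) (cl' z.2)) =ᵐ[μ.prod ν]
      (μ.prod ν)[ξ | MeasurableSpace.comap (Prod.map cl cl') inferInstance] := by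
  refine comp_label_ae_eq_condExp (hcl.prodMap hcl') (h.memLp.integrable one_le_two)
    (u := fun z => blockDensity μ ν ξ cl cl' z.1 z.2) fun ⟨k, l⟩ => ?_
  have := h.isProbabilityMeasure
  rw [prodMap_preimage_singleton, measureReal_prod_prod, h.mul_blockDensity hcl hcl']
  simpa using h.setIntegral_densityProd (fun _ => 1)
    ((hcl (measurableSet_singleton k)).prod (hcl' (measurableSet_singleton l)))

variable [IsProbabilityMeasure ν] [Fintype I] [Fintype J]

/-- The block kernel associated with a pair of finite measurable partitions. -/
noncomputable def blockKernel : BlockKernel I J where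
  p k := μ.real (cl ⁻¹' {k})
  q l := ν.real (cl' ⁻¹' {l})
  M := blockDensity μ ν ξ cl cl'
  p_nonneg _ := measureReal_nonneg
  q_nonneg _ := measureReal_nonneg
  sum_p := by simpa using (integral_comp_label (P := μ) hcl fun _ => 1).symm
  sum_q := by simpa using (integral_comp_label (P := ν) hcl' fun _ => 1).symm
  M_pos := h.blockDensity_pos cl cl'
  row k := by
    rcases eq_or_ne (μ.real (cl ⁻¹' {k})) 0 with hk | hk
    · simpa [blockDensity, hk] using (integral_comp_label (P := ν) hcl' fun _ => 1).symm
    · refine mul_left_cancel₀ hk ?_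
      simp only [Finset.mul_sum, mul_one, ← mul_assoc, h.mul_blockDensity hcl hcl']
      exact h.sum_measureReal_cell_right hcl hcl' k
  col l := by
    rcases eq_or_ne (ν.real (cl' ⁻¹' {l})) 0 with hl | hl
    · simpa [blockDensity, hl] using (integral_comp_label (P := μ) hcl fun _ => 1).symm
    · refine mul_left_cancel₀ hl ?_
      have hcell : ∀ k, ν.real (cl' ⁻¹' {l}) * (μ.real (cl ⁻¹' {k})
          * blockDensity μ ν ξ cl cl' k l)
          = (densityProd μ ν ξ).real ((cl ⁻¹' {k}) ×ˢ (cl' ⁻¹' {l})) := fun k => by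
        rw [← h.mul_blockDensity hcl hcl']
        ring
      simp only [Finset.mul_sum, mul_one, hcell]
      exact h.sum_measureReal_cell_left hcl hcl' l

theorem hasGap_blockKernel {s : ℝ} (hs : HasCorrelationLE μ ν ξ s) :
    (h.blockKernel hcl hcl').HasGap s := by
  intro f g
  have := h.isProbabilityMeasure
  have hcov := hs _ _ (memLp_comp_label hcl f) (memLp_comp_label hcl' g)
  have hprod := integral_comp_label (P := densityProd μ ν ξ) (hcl.prodMap hcl')
    fun z => f z.1 * g z.2
  simp only [Fintype.sum_prod_type, prodMap_preimage_singleton, Prod.map_fst, Prod.map_snd]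
    at hprod
  rw [hprod, integral_comp_label hcl f, integral_comp_label hcl' g,
    integral_comp_label hcl fun k => f k ^ 2, integral_comp_label hcl' fun l => g l ^ 2,
    Finset.sum_mul_sum] at hcov
  refine Eq.trans_le (congrArg (· ^ 2) ?_) hcov
  simp only [← Finset.sum_sub_distrib, ← h.mul_blockDensity hcl hcl', BlockKernel.ctr,
    blockKernel]
  refine Finset.sum_congr rfl fun k _ => Finset.sum_congr rfl fun l _ => ?_
  ring

theorem hs_blockKernel_le : (h.blockKernel hcl hcl').hs ≤ ∫ z, ξ z ^ 2 ∂(μ.prod ν) := by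
  have := h.isProbabilityMeasure
  let M : I × J → ℝ := fun z => blockDensity μ ν ξ cl cl' z.1 z.2
  have hM := memLp_comp_label (P := μ.prod ν) (hcl.prodMap hcl') M
  have hsq : ∫ z, M (Prod.map cl cl' z) ^ 2 ∂(μ.prod ν) = (h.blockKernel hcl hcl').hs + 1 := by
    rw [integral_comp_label (hcl.prodMap hcl') fun z => M z ^ 2, BlockKernel.hs_eq]
    simp only [Fintype.sum_prod_type, prodMap_preimage_singleton, measureReal_prod_prod,
      sub_add_cancel]
    rfl
  have hmul : ∫ z, ξ z * M (Prod.map cl cl' z) ∂(μ.prod ν)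
      = ∫ z, M (Prod.map cl cl' z) ^ 2 ∂(μ.prod ν) := by
    rw [← h.integral_densityProd, integral_comp_label (hcl.prodMap hcl') M,
      integral_comp_label (hcl.prodMap hcl') fun z => M z ^ 2]
    refine Finset.sum_congr rfl fun ⟨k, l⟩ _ => ?_
    rw [prodMap_preimage_singleton, ← h.mul_blockDensity hcl hcl', measureReal_prod_prod, pow_two,
      mul_assoc]
  have hnonneg : 0 ≤ ∫ z, (ξ z - M (Prod.map cl cl' z)) ^ 2 ∂(μ.prod ν) :=
    integral_nonneg fun z => sq_nonneg _
  rw [integral_sub_sq h.memLp hM, hmul, hsq] at hnonneg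
  linarith

theorem refines {I' J' : Type*} [Fintype I'] [DecidableEq I'] [MeasurableSpace I']
    [MeasurableSingletonClass I'] [Fintype J'] [DecidableEq J'] [MeasurableSpace J']
    [MeasurableSingletonClass J'] {c : I → I'} {d : J → J'} (hc : Measurable (c ∘ cl))
    (hd : Measurable (d ∘ cl')) :
    (h.blockKernel hcl hcl').Refines (h.blockKernel hc hd) c d where
  p_eq k' := by
    simp only [blockKernel]
    rw [sum_measureReal_preimage_singleton _ fun k _ => hcl (measurableSet_singleton k)]
    congr 1
    ext x
    simp
  q_eq l' := by
    simp only [blockKernel]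
    rw [sum_measureReal_preimage_singleton _ fun l _ => hcl' (measurableSet_singleton l)]
    congr 1
    ext y
    simp
  M_eq k' l' := by
    have := h.isProbabilityMeasure
    simp only [blockKernel, h.mul_blockDensity hcl hcl', h.mul_blockDensity hc hd]
    rw [sum_measureReal_cell _ hcl hcl']
    congr 1
    ext z
    simp

end IsCouplingDensity

end Blocks

section BinLabel

variable {α β : Type*} [MeasurableSpace α] [MeasurableSpace.CountablyGenerated α]
  [MeasurableSpace β] [MeasurableSpace.CountablyGenerated β]

/-- The finite partition of `α` according to membership in the first `r` sets of a generating
sequence. -/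
noncomputable def binLabel (r : ℕ) (x : α) : Fin r → Bool :=
  fun i => MeasurableSpace.mapNatBool α x i

theorem measurable_binLabel (r : ℕ) : Measurable (binLabel r : α → Fin r → Bool) :=
  measurable_pi_lambda _ fun i =>
    (measurable_pi_apply (i : ℕ)).comp (MeasurableSpace.measurable_mapNatBool α)

theorem measurable_of_measurable_binLabel_comp {Ω : Type*} [MeasurableSpace Ω] {T : Ω → α}
    (hT : ∀ r, Measurable fun z => binLabel r (T z)) : Measurable T := by
  refine measurable_iff_le_map.2
    ((MeasurableSpace.generateFrom_natGeneratingSequence α).ge.trans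
      (MeasurableSpace.generateFrom_le ?_))
  rintro _ ⟨n, rfl⟩
  have hpre : T ⁻¹' MeasurableSpace.natGeneratingSequence α n
      = (fun z => binLabel (n + 1) (T z) (Fin.last n)) ⁻¹' {true} := by
    ext z
    simp [binLabel, MeasurableSpace.mapNatBool]
  rw [MeasurableSpace.map_def, hpre]
  exact (measurable_pi_apply (Fin.last n)).comp (hT (n + 1)) (measurableSet_singleton true)

variable (α β) in
/-- The filtration generated by the labels of both coordinates. -/
noncomputable def labelFiltration : Filtration ℕ (inferInstance : MeasurableSpace (α × β)) where
  seq r := MeasurableSpace.comap (Prod.map (binLabel r) (binLabel r)) inferInstance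
  mono' r r' hr := by
    rintro _ ⟨S, -, rfl⟩
    exact ⟨Prod.map (· ∘ Fin.castLE hr) (· ∘ Fin.castLE hr) ⁻¹' S, .of_discrete, rfl⟩
  le' r := ((measurable_binLabel r).prodMap (measurable_binLabel r)).comap_le

theorem iSup_labelFiltration :
    ⨆ r, labelFiltration α β r = (inferInstance : MeasurableSpace (α × β)) := by
  refine le_antisymm (iSup_le (labelFiltration α β).le) ?_
  have hlabel : ∀ r, Measurable[⨆ r, labelFiltration α β r]
      (Prod.map (binLabel r) (binLabel r) : α × β → _) := fun r =>
    (comap_measurable _).mono (le_iSup (fun r => labelFiltration α β r) r) le_rfl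
  exact sup_le
    (@measurable_of_measurable_binLabel_comp _ _ _ _ (_) _ fun r =>
      measurable_fst.comp (hlabel r)).comap_le
    (@measurable_of_measurable_binLabel_comp _ _ _ _ (_) _ fun r =>
      measurable_snd.comp (hlabel r)).comap_le

variable {μ : Measure α} {ν : Measure β} [IsProbabilityMeasure μ] [IsProbabilityMeasure ν]
  {ξ : α × β → ℝ}

namespace IsCouplingDensity

/-- The block kernel of the partitions of level `r`. -/
noncomputable def kernel (h : IsCouplingDensity μ ν ξ) (r : ℕ) :
    BlockKernel (Fin r → Bool) (Fin r → Bool) :=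
  h.blockKernel (measurable_binLabel r) (measurable_binLabel r)

variable (h : IsCouplingDensity μ ν ξ)
include h

theorem ae_tendsto_kernel :
    ∀ᵐ z ∂(μ.prod ν), Tendsto (fun r => (h.kernel r).M (binLabel r z.1) (binLabel r z.2)) atTop
      (𝓝 (ξ z)) := by
  have hcond : ∀ᵐ z ∂(μ.prod ν), ∀ r, (h.kernel r).M (binLabel r z.1) (binLabel r z.2)
      = ((μ.prod ν)[ξ | labelFiltration α β r]) z :=
    ae_all_iff.2 fun r =>
      h.blockDensity_ae_eq_condExp (measurable_binLabel r) (measurable_binLabel r)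
  have hlevy := (h.memLp.integrable one_le_two).tendsto_ae_condExp (ℱ := labelFiltration α β)
    (by rw [iSup_labelFiltration]; exact h.measurable.stronglyMeasurable)
  filter_upwards [hcond, hlevy] with z hz hlim
  simpa only [hz] using hlim

theorem kernel_refines {r r' : ℕ} (hr : r ≤ r') :
    (h.kernel r').Refines (h.kernel r) (· ∘ Fin.castLE hr) (· ∘ Fin.castLE hr) :=
  h.refines (c := (· ∘ Fin.castLE hr)) (d := (· ∘ Fin.castLE hr)) (measurable_binLabel r')
    (measurable_binLabel r') (measurable_binLabel r) (measurable_binLabel r)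

variable {s : ℝ} (hs : HasCorrelationLE μ ν ξ s) (hs0 : 0 ≤ s) (hs1 : s < 1)
include hs hs0 hs1

theorem sum_chaos_kernel_le (r N : ℕ) : ∑ m ∈ Finset.range N, (h.kernel r).chaos m
    ≤ Real.exp ((∫ z, ξ z ^ 2 ∂(μ.prod ν)) / (1 - s ^ 2)) := by
  have hs2 : 0 < 1 - s ^ 2 := sub_pos.2 (pow_lt_one₀ hs0 hs1 two_ne_zero)
  calc ∑ m ∈ Finset.range N, (h.kernel r).chaos m
      ≤ ∑ m ∈ Finset.range (N + 1), (h.kernel r).chaos m :=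
        Finset.sum_le_sum_of_subset_of_nonneg (Finset.range_mono N.le_succ)
          fun m _ _ => (h.kernel r).chaos_nonneg m
    _ ≤ Real.exp ((h.kernel r).hs / (1 - s ^ 2)) :=
        (h.kernel r).sum_chaos_le (h.hasGap_blockKernel _ _ hs) hs0 hs1 N
    _ ≤ Real.exp ((∫ z, ξ z ^ 2 ∂(μ.prod ν)) / (1 - s ^ 2)) := by
        gcongr
        exact h.hs_blockKernel_le _ _

-- The total chaos energies increase with `r` and are bounded, so their increments are small.
theorem exists_sum_chaos_sub_le {e : ℝ} (he : 0 < e) :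
    ∃ r, ∀ r', r ≤ r' → ∀ N,
      ∑ m ∈ Finset.range N, ((h.kernel r').chaos m - (h.kernel r).chaos m) ≤ e := by
  let energy : ℕ → ℝ := fun r => ∑' m, (h.kernel r).chaos m
  have hsum : ∀ r, Summable (h.kernel r).chaos := fun r =>
    summable_of_sum_range_le (h.kernel r).chaos_nonneg (h.sum_chaos_kernel_le hs hs0 hs1 r)
  have hmono : Monotone energy := fun r r' hr =>
    (hsum r).tsum_le_tsum (h.kernel_refines hr).chaos_le (hsum r')
  have hbdd : BddAbove (Set.range energy) :=
    ⟨_, Set.forall_mem_range.2 fun r => Real.tsum_le_of_sum_range_le (h.kernel r).chaos_nonneg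
      (h.sum_chaos_kernel_le hs hs0 hs1 r)⟩
  obtain ⟨r, hr⟩ := ((tendsto_atTop_ciSup hmono hbdd).eventually
    (lt_mem_nhds (sub_lt_self (⨆ r, energy r) he))).exists
  refine ⟨r, fun r' hr' N => ?_⟩
  calc ∑ m ∈ Finset.range N, ((h.kernel r').chaos m - (h.kernel r).chaos m)
      ≤ ∑' m, ((h.kernel r').chaos m - (h.kernel r).chaos m) :=
        ((hsum r').sub (hsum r)).sum_le_tsum _
          fun m _ => sub_nonneg.2 ((h.kernel_refines hr').chaos_le m)
    _ = energy r' - energy r := (hsum r').tsum_sub (hsum r)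
    _ ≤ e := by linarith [le_ciSup hbdd r']

end IsCouplingDensity

end BinLabel

/-! ### Lower bound for the permutation averages -/

theorem measureReal_le_of_lintegral_ofReal_le {Ω : Type*} [MeasurableSpace Ω] {P : Measure Ω}
    [IsFiniteMeasure P] {F : Ω → ℝ} (hF : Measurable F) {t e : ℝ} (ht : 0 < t) (he : 0 ≤ e)
    (h : ∫⁻ z, ENNReal.ofReal (F z) ∂P ≤ ENNReal.ofReal (e * t)) : P.real {z | t ≤ F z} ≤ e := by
  have hmarkov : ENNReal.ofReal (t * P.real {z | t ≤ F z}) ≤ ENNReal.ofReal (e * t) := by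
    rw [ENNReal.ofReal_mul ht.le, ofReal_measureReal]
    refine le_trans ?_ ((mul_meas_ge_le_lintegral hF.ennreal_ofReal (ENNReal.ofReal t)).trans h)
    gcongr
    exact fun hz => ENNReal.ofReal_le_ofReal hz
  rw [ENNReal.ofReal_le_ofReal_iff (by positivity), mul_comm] at hmarkov
  exact le_of_mul_le_mul_right hmarkov ht

section Sample

variable {α β : Type*} [MeasurableSpace α] [MeasurableSpace β]

/-- The joint law of two independent samples of size `N`. -/
noncomputable def sampleLaw (μ : Measure α) (ν : Measure β) (N : ℕ) :
    Measure ((Fin N → α) × (Fin N → β)) :=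
  (Measure.pi fun _ => μ).prod (Measure.pi fun _ => ν)

theorem measurable_permAvg {N : ℕ} {ξ : α × β → ℝ} (hξ : Measurable ξ) :
    Measurable fun z : (Fin N → α) × (Fin N → β) => permAvg (fun x y => ξ (x, y)) z.1 z.2 := by
  unfold permAvg
  fun_prop

variable {μ : Measure α} {ν : Measure β} [IsProbabilityMeasure μ] [IsProbabilityMeasure ν] {N : ℕ}

instance : IsProbabilityMeasure (sampleLaw μ ν N) := by
  unfold sampleLaw
  infer_instance

theorem measurePreserving_sampleLaw (i j : Fin N) :
    MeasurePreserving (fun z : (Fin N → α) × (Fin N → β) => (z.1 i, z.2 j)) (sampleLaw μ ν N)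
      (μ.prod ν) :=
  (measurePreserving_eval (fun _ => μ) i).prod (measurePreserving_eval (fun _ => ν) j)

theorem measureReal_pi_label {I : Type*} (cl : α → I) (k : Fin N → I) :
    (Measure.pi fun _ : Fin N => μ).real ((cl ∘ ·) ⁻¹' {k}) = ∏ i, μ.real (cl ⁻¹' {k i}) := by
  have hpre : ((cl ∘ ·) : (Fin N → α) → _) ⁻¹' {k} = Set.univ.pi fun i => cl ⁻¹' {k i} := by
    ext x
    simp [funext_iff]
  rw [hpre, measureReal_def, Measure.pi_pi, ENNReal.toReal_prod]
  rfl

theorem integral_label_sampleLaw {I J : Type*} [Fintype I] [MeasurableSpace I]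
    [MeasurableSingletonClass I] [Fintype J] [MeasurableSpace J] [MeasurableSingletonClass J]
    {cl : α → I} {cl' : β → J} (hcl : Measurable cl) (hcl' : Measurable cl')
    (Φ : (Fin N → I) → (Fin N → J) → ℝ) :
    ∫ z, Φ (cl ∘ z.1) (cl' ∘ z.2) ∂(sampleLaw μ ν N)
      = pairExp (fun k => μ.real (cl ⁻¹' {k})) (fun l => ν.real (cl' ⁻¹' {l})) N Φ := by
  classical
  have hpi : Measurable fun x : Fin N → α => cl ∘ x := by fun_prop
  have hpi' : Measurable fun x : Fin N → β => cl' ∘ x := by fun_prop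
  refine (integral_comp_label (P := sampleLaw μ ν N) (hpi.prodMap hpi')
    fun z => Φ z.1 z.2).trans ?_
  simp only [sampleLaw, Fintype.sum_prod_type, prodMap_preimage_singleton, measureReal_prod_prod,
    measureReal_pi_label, pairExp, iidExp, Finset.mul_sum, mul_assoc]

variable [MeasurableSpace.CountablyGenerated α] [MeasurableSpace.CountablyGenerated β]
  {ξ : α × β → ℝ}

namespace IsCouplingDensity

/-- The permutation average of the block kernel of level `r`. -/
noncomputable def blockAvg (h : IsCouplingDensity μ ν ξ) (r : ℕ)
    (z : (Fin N → α) × (Fin N → β)) : ℝ :=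
  permAvg (h.kernel r).M (binLabel r ∘ z.1) (binLabel r ∘ z.2)

variable (h : IsCouplingDensity μ ν ξ)
include h

theorem measurable_blockAvg (r : ℕ) :
    Measurable fun z : (Fin N → α) × (Fin N → β) => h.blockAvg r z := by
  have hM : Measurable fun k : (Fin r → Bool) × (Fin r → Bool) => (h.kernel r).M k.1 k.2 :=
    .of_discrete
  have hα := measurable_binLabel (α := α) r
  have hβ := measurable_binLabel (α := β) r
  simp only [blockAvg, permAvg, Function.comp_apply]
  fun_prop

theorem memLp_blockAvg (r : ℕ) : MemLp (h.blockAvg r) 2 (sampleLaw μ ν N) := by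
  have hα := measurable_binLabel (α := α) r
  have hβ := measurable_binLabel (α := β) r
  exact memLp_comp_label (ℓ := fun z : (Fin N → α) × (Fin N → β) =>
    (binLabel r ∘ z.1, binLabel r ∘ z.2)) (by fun_prop)
    fun z => permAvg (h.kernel r).M z.1 z.2

theorem ae_tendsto_blockAvg :
    ∀ᵐ z ∂(sampleLaw μ ν N), Tendsto (fun r => h.blockAvg r z) atTop
      (𝓝 (permAvg (fun x y => ξ (x, y)) z.1 z.2)) := by
  have hij : ∀ᵐ z ∂(sampleLaw μ ν N), ∀ i j : Fin N,
      Tendsto (fun r => (h.kernel r).M (binLabel r (z.1 i)) (binLabel r (z.2 j))) atTop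
        (𝓝 (ξ (z.1 i, z.2 j))) :=
    ae_all_iff.2 fun i => ae_all_iff.2 fun j =>
      (measurePreserving_sampleLaw i j).quasiMeasurePreserving.ae h.ae_tendsto_kernel
  filter_upwards [hij] with z hz
  exact (tendsto_finsetSum _ fun σ _ => tendsto_finsetProd _ fun i _ => hz i (σ i)).const_mul _

theorem integral_blockAvg_sub_sq {r r' : ℕ} (hr : r ≤ r') :
    ∫ z, (h.blockAvg r' z - h.blockAvg r z) ^ 2 ∂(sampleLaw μ ν N)
      = ∑ m ∈ Finset.range (N + 1), ((h.kernel r').chaos m - (h.kernel r).chaos m) := by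
  rw [← (h.kernel_refines hr).pairExp_sub_sq N]
  exact integral_label_sampleLaw (measurable_binLabel r') (measurable_binLabel r')
    fun k l => (permAvg (h.kernel r').M k l - permAvg (h.kernel r).M
      ((· ∘ Fin.castLE hr) ∘ k) ((· ∘ Fin.castLE hr) ∘ l)) ^ 2

theorem lintegral_permAvg_sub_blockAvg_sq_le {e : ℝ} {r : ℕ} (hr : ∀ r', r ≤ r' →
      ∑ m ∈ Finset.range (N + 1), ((h.kernel r').chaos m - (h.kernel r).chaos m) ≤ e) :
    ∫⁻ z, ENNReal.ofReal ((permAvg (fun x y => ξ (x, y)) z.1 z.2 - h.blockAvg r z) ^ 2)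
      ∂(sampleLaw μ ν N) ≤ ENNReal.ofReal e := by
  have hmeas : ∀ r', Measurable fun z : (Fin N → α) × (Fin N → β) =>
      ENNReal.ofReal ((h.blockAvg r' z - h.blockAvg r z) ^ 2) := fun r' =>
    (((h.measurable_blockAvg r').sub (h.measurable_blockAvg r)).pow_const 2).ennreal_ofReal
  have hint : ∀ r', Integrable (fun z => (h.blockAvg r' z - h.blockAvg r z) ^ 2)
      (sampleLaw μ ν N) := fun r' => ((h.memLp_blockAvg r').sub (h.memLp_blockAvg r)).integrable_sq
  calc ∫⁻ z, ENNReal.ofReal ((permAvg (fun x y => ξ (x, y)) z.1 z.2 - h.blockAvg r z) ^ 2)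
      ∂(sampleLaw μ ν N)
      ≤ ∫⁻ z, liminf (fun r' => ENNReal.ofReal ((h.blockAvg r' z - h.blockAvg r z) ^ 2)) atTop
        ∂(sampleLaw μ ν N) := by
        refine lintegral_mono_ae ?_
        filter_upwards [h.ae_tendsto_blockAvg] with z hz
        exact (ENNReal.tendsto_ofReal ((hz.sub_const _).pow 2)).liminf_eq.ge
    _ ≤ liminf (fun r' => ∫⁻ z, ENNReal.ofReal ((h.blockAvg r' z - h.blockAvg r z) ^ 2)
        ∂(sampleLaw μ ν N)) atTop := lintegral_liminf_le hmeas
    _ ≤ ENNReal.ofReal e := by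
        refine liminf_le_of_frequently_le' (Eventually.frequently ?_)
        filter_upwards [eventually_ge_atTop r] with r' hr'
        rw [← ofReal_integral_eq_lintegral_ofReal (hint r') (ae_of_all _ fun z => sq_nonneg _)]
        exact ENNReal.ofReal_le_ofReal ((h.integral_blockAvg_sub_sq hr').trans_le (hr r' hr'))

theorem measureReal_blockAvg_lt (r : ℕ) (δ : ℝ) :
    (sampleLaw μ ν N).real {z | h.blockAvg r z < δ}
      = pairExp (h.kernel r).p (h.kernel r).q N
          fun k l => if permAvg (h.kernel r).M k l < δ then 1 else 0 := by
  rw [← integral_indicator_one (measurableSet_lt (h.measurable_blockAvg r) measurable_const)]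
  refine Eq.trans (integral_congr_ae (ae_of_all _ fun z => ?_))
    (integral_label_sampleLaw (measurable_binLabel r) (measurable_binLabel r)
      fun k l => if permAvg (h.kernel r).M k l < δ then 1 else 0)
  simp only [Set.indicator_apply, Set.mem_ofPred_eq, blockAvg, Pi.one_apply]

theorem measureReal_le_abs_permAvg_sub_blockAvg_le {e δ : ℝ} (he : 0 ≤ e)
    (hδ : 0 < δ) {r : ℕ}
    (hr : ∀ r', r ≤ r' → ∑ m ∈ Finset.range (N + 1),
      ((h.kernel r').chaos m - (h.kernel r).chaos m) ≤ e * δ ^ 2) :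
    (sampleLaw μ ν N).real
      {z | δ ≤ |permAvg (fun x y => ξ (x, y)) z.1 z.2 - h.blockAvg r z|} ≤ e := by
  have hmeas : Measurable fun z : (Fin N → α) × (Fin N → β) =>
      (permAvg (fun x y => ξ (x, y)) z.1 z.2 - h.blockAvg r z) ^ 2 :=
    ((measurable_permAvg h.measurable).sub (h.measurable_blockAvg r)).pow_const 2
  refine le_trans (measureReal_mono fun z hz => ?_) (measureReal_le_of_lintegral_ofReal_le hmeas
    (by positivity) he (h.lintegral_permAvg_sub_blockAvg_sq_le hr))
  exact (pow_le_pow_left₀ hδ.le hz 2).trans_eq (sq_abs _)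

theorem exists_measureReal_permAvg_lt_le {s : ℝ} (hs : HasCorrelationLE μ ν ξ s) (hs0 : 0 ≤ s)
    (hs1 : s < 1) {e : ℝ} (he : 0 < e) :
    ∃ δ > 0, ∀ᶠ N : ℕ in atTop, (sampleLaw μ ν N).real
      {z | permAvg (fun x y => ξ (x, y)) z.1 z.2 < δ} ≤ e := by
  obtain ⟨δ, hδ, hblock⟩ := BlockKernel.exists_pairExp_permAvg_lt_le
    (H := ∫ z, ξ z ^ 2 ∂(μ.prod ν)) hs0 hs1 (half_pos he)
  obtain ⟨r, hr⟩ := h.exists_sum_chaos_sub_le hs hs0 hs1 (e := e / 2 * (δ / 2) ^ 2) (by positivity)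
  refine ⟨δ / 2, half_pos hδ, ?_⟩
  filter_upwards [hblock _ _ (h.kernel r) (h.hasGap_blockKernel _ _ hs)
    (h.hs_blockKernel_le _ _)] with N hN
  rw [← h.measureReal_blockAvg_lt] at hN
  have hdiff := h.measureReal_le_abs_permAvg_sub_blockAvg_le (half_pos he).le (half_pos hδ)
    fun r' hr' => hr r' hr' (N + 1)
  calc (sampleLaw μ ν N).real {z | permAvg (fun x y => ξ (x, y)) z.1 z.2 < δ / 2}
      ≤ (sampleLaw μ ν N).real ({z | h.blockAvg r z < δ} ∪
        {z | δ / 2 ≤ |permAvg (fun x y => ξ (x, y)) z.1 z.2 - h.blockAvg r z|}) := by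
        refine measureReal_mono fun z hz => ?_
        by_contra hcon
        simp only [Set.mem_union, Set.mem_ofPred_eq, not_or, not_lt, not_le, abs_lt] at hz hcon
        linarith
    _ ≤ e / 2 + e / 2 := (measureReal_union_le _ _).trans (add_le_add hN hdiff)
    _ = e := add_halves e

end IsCouplingDensity

end Sample

/-! ### Comparison with samples of the coupling -/

section Tilt

variable {Z : Type*} [MeasurableSpace Z]

theorem lintegral_prod_pi {ρ : Measure Z} [IsProbabilityMeasure ρ] {N : ℕ}
    {g : Fin N → Z → ENNReal} (hg : ∀ i, Measurable (g i)) :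
    ∫⁻ w, ∏ i, g i (w i) ∂(Measure.pi fun _ => ρ) = ∏ i, ∫⁻ z, g i z ∂ρ := by
  refine (lintegral_prod_eq_prod_lintegral_of_indepFun Finset.univ
    (fun i (w : Fin N → Z) => g i (w i))
    (iIndepFun_pi fun i => (hg i).aemeasurable)
    fun i => (hg i).comp (measurable_pi_apply i)).trans ?_
  exact Finset.prod_congr rfl fun i _ =>
    (measurePreserving_eval (fun _ => ρ) i).lintegral_comp (hg i)

theorem pi_withDensity {ρ : Measure Z} [IsProbabilityMeasure ρ] {f : Z → ENNReal}
    (hf : Measurable f) [IsProbabilityMeasure (ρ.withDensity f)] (N : ℕ) :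
    (Measure.pi fun _ : Fin N => ρ.withDensity f)
      = (Measure.pi fun _ => ρ).withDensity fun w => ∏ i, f (w i) := by
  refine Measure.pi_eq fun s hs => ?_
  have hind : ∀ w : Fin N → Z, (Set.univ.pi s).indicator (fun w => ∏ i, f (w i)) w
      = ∏ i, (s i).indicator f (w i) := fun w => by
    by_cases hw : w ∈ Set.univ.pi s
    · rw [Set.indicator_of_mem hw]
      exact Finset.prod_congr rfl fun i _ => (Set.indicator_of_mem (hw i (Set.mem_univ i)) f).symm
    · obtain ⟨i, hi⟩ : ∃ i, w i ∉ s i := by simpa [Set.mem_pi] using hw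
      rw [Set.indicator_of_notMem hw]
      exact (Finset.prod_eq_zero (Finset.mem_univ i) (Set.indicator_of_notMem hi f)).symm
  rw [withDensity_apply _ (MeasurableSet.univ_pi hs),
    ← lintegral_indicator (MeasurableSet.univ_pi hs), lintegral_congr hind,
    lintegral_prod_pi fun i => hf.indicator (hs i)]
  exact Finset.prod_congr rfl fun i _ => by
    rw [lintegral_indicator (hs i), withDensity_apply _ (hs i)]

theorem tendsto_lintegral_abs_average_sub {κ : Measure Z} [IsProbabilityMeasure κ] {η : Z → ℝ}
    (hm : Measurable η) (hη : Integrable η κ) :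
    Tendsto (fun N : ℕ => ∫⁻ w, ENNReal.ofReal |(N : ℝ)⁻¹ * ∑ i, η (w i) - ∫ z, η z ∂κ|
      ∂(Measure.pi fun _ : Fin N => κ)) atTop (𝓝 0) := by
  obtain ⟨Ω, _, P, X, hX, hlaw, hind, _⟩ := exists_iid ℕ κ
  have hlln := strong_law_Lp (μ := P) le_rfl ENNReal.one_ne_top (fun i ω => η (X i ω))
    (memLp_one_iff_integrable.2 
      (((hlaw 0).map_eq ▸ hη).comp_measurable (hX 0)))
    (fun i j hij => (hind.indepFun hij).comp hm hm)
    (fun i => ((hlaw i).identDistrib (hlaw 0)).comp hm)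
  refine hlln.congr fun N => ?_
  have hsample : HasLaw (fun ω (i : Fin N) => X i ω) (Measure.pi fun _ => κ) P :=
    (hind.precomp Fin.val_injective).hasLaw_pi fun i => hlaw i
  have hmean : ∫ ω, η (X 0 ω) ∂P = ∫ z, η z ∂κ :=
    (hlaw 0).integral_comp hη.aestronglyMeasurable
  rw [eLpNorm_one_eq_lintegral_enorm, hmean,
    ← hsample.lintegral_comp (by fun_prop : Measurable _).aemeasurable]
  refine lintegral_congr fun ω => ?_
  simp only [Real.enorm_eq_ofReal_abs, smul_eq_mul, Finset.sum_range]

end Tilt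

section Matching

variable {α β : Type*} [MeasurableSpace α] [MeasurableSpace β] {N : ℕ}

/-- The average over permutations of the likelihood of a matching times the deviation from `θ` of
the mean of `η` over the matched pairs. -/
noncomputable def weightedDeviation (ξ η : α × β → ℝ) (θ : ℝ) (z : (Fin N → α) × (Fin N → β)) : ℝ :=
  (N.factorial : ℝ)⁻¹ * ∑ σ : Equiv.Perm (Fin N), (∏ i, ξ (z.1 i, z.2 (σ i))) *
    |(N : ℝ)⁻¹ * ∑ i, η (z.1 i, z.2 (σ i)) - θ|

/-- The mean of `η` over the pairs matched by a random permutation whose probability is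
proportional to the likelihood `∏ᵢ ξ(xᵢ, y_{σ(i)})`. -/
noncomputable def matchingAverage (ξ η : α × β → ℝ) (z : (Fin N → α) × (Fin N → β)) : ℝ :=
  (∑ σ : Equiv.Perm (Fin N), (∏ i, ξ (z.1 i, z.2 (σ i))) *
    ((N : ℝ)⁻¹ * ∑ i, η (z.1 i, z.2 (σ i)))) /
  ∑ σ : Equiv.Perm (Fin N), ∏ i, ξ (z.1 i, z.2 (σ i))

variable {ξ η : α × β → ℝ}

theorem measurable_weightedDeviation (hξ : Measurable ξ) (hη : Measurable η) (θ : ℝ) :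
    Measurable fun z : (Fin N → α) × (Fin N → β) => weightedDeviation ξ η θ z := by
  unfold weightedDeviation
  fun_prop

theorem measurable_matchingAverage (hξ : Measurable ξ) (hη : Measurable η) :
    Measurable fun z : (Fin N → α) × (Fin N → β) => matchingAverage ξ η z := by
  unfold matchingAverage
  fun_prop

omit [MeasurableSpace α] [MeasurableSpace β] in
theorem abs_matchingAverage_sub_mul_permAvg_le (hξ : ∀ z, 0 < ξ z) (θ : ℝ)
    (z : (Fin N → α) × (Fin N → β)) :
    |matchingAverage ξ η z - θ| * permAvg (fun x y => ξ (x, y)) z.1 z.2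
      ≤ weightedDeviation ξ η θ z := by
  let w : Equiv.Perm (Fin N) → ℝ := fun σ => ∏ i, ξ (z.1 i, z.2 (σ i))
  let m : Equiv.Perm (Fin N) → ℝ := fun σ => (N : ℝ)⁻¹ * ∑ i, η (z.1 i, z.2 (σ i))
  have hw : ∀ σ, 0 < w σ := fun σ => Finset.prod_pos fun i _ => hξ _
  have htotal : 0 < ∑ σ, w σ := Finset.sum_pos (fun σ _ => hw σ) Finset.univ_nonempty
  have hsub : matchingAverage ξ η z - θ = (∑ σ, w σ * (m σ - θ)) / ∑ σ, w σ := by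
    rw [eq_div_iff htotal.ne', sub_mul, matchingAverage, div_mul_cancel₀ _ htotal.ne', mul_comm θ,
      Finset.sum_mul]
    simp only [mul_sub, Finset.sum_sub_distrib, w, m]
  calc |matchingAverage ξ η z - θ| * ((N.factorial : ℝ)⁻¹ * ∑ σ, w σ)
      = (N.factorial : ℝ)⁻¹ * |∑ σ, w σ * (m σ - θ)| := by
        rw [hsub, abs_div, abs_of_pos htotal]
        field_simp
    _ ≤ (N.factorial : ℝ)⁻¹ * ∑ σ, |w σ * (m σ - θ)| := by
        gcongr
        exact Finset.abs_sum_le_sum_abs _ _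
    _ = (N.factorial : ℝ)⁻¹ * ∑ σ, w σ * |m σ - θ| := by
        simp only [abs_mul, abs_of_pos (hw _)]

variable {μ : Measure α} {ν : Measure β} [IsProbabilityMeasure μ] [IsProbabilityMeasure ν]

theorem measurePreserving_comp_perm (σ : Equiv.Perm (Fin N)) :
    MeasurePreserving (fun (y : Fin N → β) i => y (σ i)) (Measure.pi fun _ => ν)
      (Measure.pi fun _ => ν) := by
  convert measurePreserving_piCongrLeft (fun _ : Fin N => ν) σ.symm using 1
  funext y i
  simpa only [Equiv.symm_apply_apply] using
    (MeasurableEquiv.piCongrLeft_apply_apply (β := fun _ : Fin N => β) σ.symm y (σ i)).symm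

theorem measurePreserving_matching (σ : Equiv.Perm (Fin N)) :
    MeasurePreserving (fun (z : (Fin N → α) × (Fin N → β)) i => (z.1 i, z.2 (σ i)))
      (sampleLaw μ ν N) (Measure.pi fun _ => μ.prod ν) :=
  (measurePreserving_arrowProdEquivProdArrow α β (Fin N) (fun _ => μ) fun _ => ν).symm.comp
    ((MeasurePreserving.id _).prod (measurePreserving_comp_perm σ))

theorem lintegral_permAvg_matching {G : (Fin N → α × β) → ENNReal} (hG : Measurable G) :
    ∫⁻ z, ENNReal.ofReal (N.factorial : ℝ)⁻¹ *
        ∑ σ : Equiv.Perm (Fin N), G (fun i => (z.1 i, z.2 (σ i))) ∂(sampleLaw μ ν N)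
      = ∫⁻ w, G w ∂(Measure.pi fun _ => μ.prod ν) := by
  have hmeas : ∀ σ : Equiv.Perm (Fin N), Measurable fun z : (Fin N → α) × (Fin N → β) =>
      G fun i => (z.1 i, z.2 (σ i)) := fun σ => hG.comp (measurePreserving_matching
        (μ := μ) (ν := ν) σ).measurable
  rw [lintegral_const_mul _ (Finset.measurable_sum _ fun σ _ => hmeas σ),
    lintegral_finsetSum _ fun σ _ => hmeas σ]
  simp only [(measurePreserving_matching (μ := μ) (ν := ν) _).lintegral_comp hG, Finset.sum_const,
    Finset.card_univ, Fintype.card_perm, Fintype.card_fin, nsmul_eq_mul]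
  rw [← mul_assoc, ENNReal.ofReal_inv_of_pos (by positivity), ENNReal.ofReal_natCast,
    ENNReal.inv_mul_cancel (by positivity) (ENNReal.natCast_ne_top _), one_mul]

namespace IsCouplingDensity

variable (h : IsCouplingDensity μ ν ξ)
include h

theorem lintegral_weightedDeviation (hη : Measurable η) (θ : ℝ) (N : ℕ) :
    ∫⁻ z, ENNReal.ofReal (weightedDeviation ξ η θ z) ∂(sampleLaw μ ν N)
      = ∫⁻ w, ENNReal.ofReal |(N : ℝ)⁻¹ * ∑ i, η (w i) - θ|
        ∂(Measure.pi fun _ : Fin N => densityProd μ ν ξ) := by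
  have hprob : IsProbabilityMeasure ((μ.prod ν).withDensity fun z => ENNReal.ofReal (ξ z)) :=
    h.isProbabilityMeasure
  have hξ := h.measurable
  have hlik : ∀ w : Fin N → α × β, 0 ≤ ∏ i, ξ (w i) := fun w =>
    Finset.prod_nonneg fun i _ => (h.pos _).le
  let G : (Fin N → α × β) → ENNReal := fun w =>
    (∏ i, ENNReal.ofReal (ξ (w i))) * ENNReal.ofReal |(N : ℝ)⁻¹ * ∑ i, η (w i) - θ|
  have hG : Measurable G := by
    unfold G
    fun_prop
  calc ∫⁻ z, ENNReal.ofReal (weightedDeviation ξ η θ z) ∂(sampleLaw μ ν N)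
      = ∫⁻ z, ENNReal.ofReal (N.factorial : ℝ)⁻¹ *
          ∑ σ : Equiv.Perm (Fin N), G (fun i => (z.1 i, z.2 (σ i))) ∂(sampleLaw μ ν N) := by
        refine lintegral_congr fun z => ?_
        rw [weightedDeviation, ENNReal.ofReal_mul (by positivity), ENNReal.ofReal_sum_of_nonneg
          fun σ _ => mul_nonneg (hlik fun i => (z.1 i, z.2 (σ i))) (abs_nonneg _)]
        simp only [G, ENNReal.ofReal_mul (hlik fun i => (z.1 i, z.2 _)),
          ENNReal.ofReal_prod_of_nonneg fun _ _ => (h.pos _).le]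
    _ = ∫⁻ w, G w ∂(Measure.pi fun _ => μ.prod ν) := lintegral_permAvg_matching hG
    _ = ∫⁻ w, ENNReal.ofReal |(N : ℝ)⁻¹ * ∑ i, η (w i) - θ|
        ∂(Measure.pi fun _ : Fin N => densityProd μ ν ξ) := by
        rw [densityProd, pi_withDensity hξ.ennreal_ofReal,
          lintegral_withDensity_eq_lintegral_mul _ (by fun_prop) (by fun_prop)]
        rfl

variable [MeasurableSpace.CountablyGenerated α] [MeasurableSpace.CountablyGenerated β]

theorem tendsto_measureReal_mul_permAvg_le_weightedDeviation (hη : Measurable η)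
    (hint : Integrable η (densityProd μ ν ξ)) {t : ℝ} (ht : 0 < t) :
    Tendsto (fun N => (sampleLaw μ ν N).real {z | t * permAvg (fun x y => ξ (x, y)) z.1 z.2
      ≤ weightedDeviation ξ η (∫ z, η z ∂(densityProd μ ν ξ)) z}) atTop (𝓝 0) := by
  have hprob := h.isProbabilityMeasure
  obtain ⟨s, hs0, hs1, hs⟩ := h.exists_hasCorrelationLE
  let D : ∀ N, (Fin N → α) × (Fin N → β) → ℝ := fun N =>
    weightedDeviation ξ η (∫ z, η z ∂(densityProd μ ν ξ))
  have hlim : Tendsto (fun N : ℕ => ∫⁻ z, ENNReal.ofReal (D N z) ∂(sampleLaw μ ν N)) atTop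
      (𝓝 0) := by
    simp only [D, h.lintegral_weightedDeviation hη]
    exact tendsto_lintegral_abs_average_sub hη hint
  refine tendsto_order.2 ⟨fun a ha => .of_forall fun N => ha.trans_le measureReal_nonneg,
    fun e he => ?_⟩
  obtain ⟨δ, hδ, hlower⟩ := h.exists_measureReal_permAvg_lt_le hs hs0 hs1 (e := e / 3)
    (by positivity)
  have hsmall := hlim.eventually (ge_mem_nhds
    (ENNReal.ofReal_pos.2 (by positivity : 0 < e / 3 * (t * δ))))
  filter_upwards [hlower, hsmall] with N hlowerN hsmallN
  have hdev := measureReal_le_of_lintegral_ofReal_le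
    (measurable_weightedDeviation h.measurable hη _) (mul_pos ht hδ) (by positivity) hsmallN
  calc (sampleLaw μ ν N).real {z | t * permAvg (fun x y => ξ (x, y)) z.1 z.2 ≤ D N z}
      ≤ (sampleLaw μ ν N).real
          ({z | permAvg (fun x y => ξ (x, y)) z.1 z.2 < δ} ∪ {z | t * δ ≤ D N z}) := by
        refine measureReal_mono fun z hz => or_iff_not_imp_left.2 fun hlt => ?_
        exact (mul_le_mul_of_nonneg_left (not_lt.1 hlt) ht.le).trans hz
    _ ≤ e / 3 + e / 3 := (measureReal_union_le _ _).trans (add_le_add hlowerN hdev)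
    _ < e := by linarith

theorem tendsto_measureReal_matchingAverage (hη : Measurable η)
    (hint : Integrable η (densityProd μ ν ξ)) {t : ℝ} (ht : 0 < t) :
    Tendsto (fun N => (sampleLaw μ ν N).real
      {z | t ≤ |matchingAverage ξ η z - ∫ z, η z ∂(densityProd μ ν ξ)|}) atTop (𝓝 0) := by
  refine squeeze_zero (fun N => measureReal_nonneg) (fun N => measureReal_mono fun z hz => ?_)
    (h.tendsto_measureReal_mul_permAvg_le_weightedDeviation hη hint ht)
  exact (mul_le_mul_of_nonneg_right hz (permAvg_nonneg (fun x y => (h.pos (x, y)).le) _ _)).trans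
    (abs_matchingAverage_sub_mul_permAvg_le h.pos _ z)

omit [MeasurableSpace.CountablyGenerated α] [MeasurableSpace.CountablyGenerated β] in
theorem matchingAverage_ae_eq {η' : α × β → ℝ} (hη : η =ᵐ[densityProd μ ν ξ] η') :
    (matchingAverage ξ η : (Fin N → α) × (Fin N → β) → ℝ) =ᵐ[sampleLaw μ ν N]
      matchingAverage ξ η' := by
  have hprod : ∀ᵐ z ∂(μ.prod ν), η z = η' z :=
    (withDensity_absolutelyContinuous' h.measurable.ennreal_ofReal.aemeasurable
      (ae_of_all _ fun z => (ENNReal.ofReal_pos.2 (h.pos z)).ne')).ae_le hη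
  have hpairs : ∀ᵐ z ∂(sampleLaw μ ν N), ∀ i j : Fin N, η (z.1 i, z.2 j) = η' (z.1 i, z.2 j) :=
    ae_all_iff.2 fun i => ae_all_iff.2 fun j =>
      (measurePreserving_sampleLaw i j).quasiMeasurePreserving.ae hprod
  filter_upwards [hpairs] with z hz
  simp only [matchingAverage, hz]

end IsCouplingDensity

theorem hasLaw_sample {Ω : Type*} [MeasurableSpace Ω] {P : Measure Ω} {X : ℕ → Ω → α}
    {Y : ℕ → Ω → β} (hlaw : ∀ i, HasLaw (fun ω => (X i ω, Y i ω)) (μ.prod ν) P)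
    (hind : iIndepFun (fun i ω => (X i ω, Y i ω)) P) (N : ℕ) :
    HasLaw (fun ω => (fun i : Fin N => X i ω, fun i : Fin N => Y i ω)) (sampleLaw μ ν N) P :=
  (measurePreserving_arrowProdEquivProdArrow α β (Fin N) (fun _ => μ) fun _ => ν).comp_hasLaw
    ((hind.precomp Fin.val_injective).hasLaw_pi fun i => hlaw i)

end Matching

/-! ### Schrödinger bridges -/

section Schrodinger

variable {d : ℕ} {c : EuclideanSpace ℝ (Fin d) → EuclideanSpace ℝ (Fin d) → ℝ} {ε : ℝ}
  {ρ₀ ρ₁ : Measure (EuclideanSpace ℝ (Fin d))} {a b : EuclideanSpace ℝ (Fin d) → ℝ}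

theorem measurable_schrodingerXi (hc : Continuous (Function.uncurry c)) (ha : Measurable a)
    (hb : Measurable b) : Measurable (schrodingerXi c ε a b) := by
  have hcost : Measurable fun z : EuclideanSpace ℝ (Fin d) × EuclideanSpace ℝ (Fin d) =>
      c z.1 z.2 := hc.measurable
  unfold schrodingerXi
  fun_prop

theorem IsSchrodingerPotentials.isCouplingDensity (hab : IsSchrodingerPotentials c ε ρ₀ ρ₁ a b)
    (hc : Continuous (Function.uncurry c)) (hξ : MemLp (schrodingerXi c ε a b) 2 (ρ₀.prod ρ₁)) :
    IsCouplingDensity ρ₀ ρ₁ (schrodingerXi c ε a b) where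
  measurable := measurable_schrodingerXi hc hab.measurable_left hab.measurable_right
  pos _ := Real.exp_pos _
  memLp := hξ
  map_fst := hab.mem_couplings.1
  map_snd := hab.mem_couplings.2

variable {N : ℕ} {x y : Fin N → EuclideanSpace ℝ (Fin d)}

theorem integral_discreteBridge (η : EuclideanSpace ℝ (Fin d) × EuclideanSpace ℝ (Fin d) → ℝ) :
    ∫ z, η z ∂(discreteBridge c ε x y)
      = ∑ σ, gibbsProb c ε x y σ * ((N : ℝ)⁻¹ * ∑ i, η (x i, y (σ i))) := by
  rcases N.eq_zero_or_pos with rfl | hN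
  · simp [discreteBridge]
  have hdirac : ∀ z : EuclideanSpace ℝ (Fin d) × EuclideanSpace ℝ (Fin d),
      Integrable η (Measure.dirac z) := fun z => integrable_dirac enorm_lt_top
  have hmatching : ∀ σ : Equiv.Perm (Fin N), Integrable η ((N : ENNReal)⁻¹ •
      ∑ i, Measure.dirac (x i, y (σ i))) := fun σ =>
    (integrable_finsetSum_measure.2 fun i _ => hdirac _).smul_measure
      (ENNReal.inv_ne_top.2 (Nat.cast_ne_zero.2 hN.ne'))
  have hgibbs : ∀ σ, 0 ≤ gibbsProb c ε x y σ := fun σ =>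
    div_nonneg (Real.exp_pos _).le (Finset.sum_nonneg fun _ _ => (Real.exp_pos _).le)
  rw [discreteBridge, integral_finsetSum_measure fun σ _ =>
    (hmatching σ).smul_measure ENNReal.ofReal_ne_top]
  refine Finset.sum_congr rfl fun σ _ => ?_
  rw [integral_smul_measure, integral_smul_measure, integral_finsetSum_measure fun i _ => hdirac _,
    ENNReal.toReal_ofReal (hgibbs σ)]
  simp

-- Replacing `c` by `c - a - b` multiplies the weights of all permutations by the same factor.
theorem prod_schrodingerXi (a b : EuclideanSpace ℝ (Fin d) → ℝ) (σ : Equiv.Perm (Fin N)) :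
    ∏ i, schrodingerXi c ε a b (x i, y (σ i))
      = permWeight c ε x y σ * Real.exp (1 / ε * (∑ i, a (x i) + ∑ i, b (y i))) := by
  simp only [schrodingerXi, permWeight]
  rw [← Real.exp_sum, ← Real.exp_add, ← Finset.mul_sum, Finset.sum_sub_distrib,
    Finset.sum_sub_distrib, Equiv.sum_comp σ fun i => b (y i)]
  ring_nf

theorem integral_discreteBridge_eq_matchingAverage (a b : EuclideanSpace ℝ (Fin d) → ℝ)
    (η : EuclideanSpace ℝ (Fin d) × EuclideanSpace ℝ (Fin d) → ℝ) :
    ∫ z, η z ∂(discreteBridge c ε x y) = matchingAverage (schrodingerXi c ε a b) η (x, y) := by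
  rw [integral_discreteBridge, matchingAverage, Finset.sum_div]
  simp only [prod_schrodingerXi, ← Finset.sum_mul]
  refine Finset.sum_congr rfl fun σ _ => ?_
  rw [gibbsProb, mul_right_comm, mul_div_mul_right _ _ (Real.exp_ne_zero _), div_mul_eq_mul_div]

end Schrodinger

theorem theorem1_general {α β : Type*} [MeasurableSpace α] [MeasurableSpace β]
    [MeasurableSpace.CountablyGenerated α] [MeasurableSpace.CountablyGenerated β]
    {μ : Measure α} {ν : Measure β} [IsProbabilityMeasure μ] [IsProbabilityMeasure ν]
    {ξ η : α × β → ℝ} (h : IsCouplingDensity μ ν ξ) (hη : Integrable η (densityProd μ ν ξ))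
    {Ω : Type*} [MeasurableSpace Ω] {P : Measure Ω} {X : ℕ → Ω → α} {Y : ℕ → Ω → β}
    (hlaw : ∀ i, HasLaw (fun ω => (X i ω, Y i ω)) (μ.prod ν) P)
    (hind : iIndepFun (fun i ω => (X i ω, Y i ω)) P) :
    TendstoInMeasure P
      (fun (N : ℕ) ω => matchingAverage ξ η (fun i : Fin N => X i ω, fun i : Fin N => Y i ω))
      atTop (fun _ => ∫ z, η z ∂(densityProd μ ν ξ)) := by
  have hP : IsProbabilityMeasure P := hind.isProbabilityMeasure
  obtain ⟨η', hη', hae⟩ := hη.aestronglyMeasurable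
  have hsample := hasLaw_sample hlaw hind
  have hae_sample : ∀ N : ℕ, ∀ᵐ ω ∂P,
      matchingAverage ξ η' (fun i : Fin N => X i ω, fun i : Fin N => Y i ω)
        = matchingAverage ξ η (fun i : Fin N => X i ω, fun i : Fin N => Y i ω) := fun N =>
    ae_of_ae_map (hsample N).aemeasurable
      ((hsample N).map_eq.symm ▸ h.matchingAverage_ae_eq hae.symm)
  rw [integral_congr_ae hae]
  refine TendstoInMeasure.congr_left hae_sample ?_
  refine tendstoInMeasure_iff_measureReal_norm.2 fun t ht => ?_
  have hlim := h.tendsto_measureReal_matchingAverage hη'.measurable (hη.congr hae) ht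
  refine hlim.congr fun N =>
    ((hsample N).measureReal_eq (measurableSet_le measurable_const ?_)).symm
  exact ((measurable_matchingAverage h.measurable hη'.measurable).sub_const _).abs

theorem theorem1 {d : ℕ} {p ε : ℝ} (hp : 1 ≤ p) (hε : 0 < ε)
    (c : EuclideanSpace ℝ (Fin d) → EuclideanSpace ℝ (Fin d) → ℝ)
    (hc : IsTransportCost p c)
    (ρ₀ ρ₁ : Measure (EuclideanSpace ℝ (Fin d)))
    [IsProbabilityMeasure ρ₀] [IsProbabilityMeasure ρ₁]
    (hρ₀ : ρ₀ ≪ volume) (hρ₁ : ρ₁ ≪ volume)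
    (hmom₀ : Integrable (fun x => ‖x‖ ^ p) ρ₀)
    (hmom₁ : Integrable (fun y => ‖y‖ ^ p) ρ₁)
    (a b : EuclideanSpace ℝ (Fin d) → ℝ)
    (hab : IsSchrodingerPotentials c ε ρ₀ ρ₁ a b)
    (ha : Integrable a ρ₀) (hb : Integrable b ρ₁)
    (hξ : MemLp (schrodingerXi c ε a b) 2 (ρ₀.prod ρ₁))
    {Ω : Type*} [MeasurableSpace Ω] (P : Measure Ω) [IsProbabilityMeasure P]
    (X Y : ℕ → Ω → EuclideanSpace ℝ (Fin d))
    (hlaw : ∀ i, HasLaw (fun ω => (X i ω, Y i ω)) (ρ₀.prod ρ₁) P)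
    (hind : iIndepFun (fun i ω => (X i ω, Y i ω)) P)
    (η : EuclideanSpace ℝ (Fin d) × EuclideanSpace ℝ (Fin d) → ℝ)
    (hη : Integrable η (schrodingerMeasure c ε ρ₀ ρ₁ a b)) :
    TendstoInMeasure P
      (fun (N : ℕ) ω => ∫ z, η z
        ∂(discreteBridge c ε (fun i : Fin N => X i ω) (fun i : Fin N => Y i ω)))
      atTop
      (fun _ => ∫ z, η z ∂(schrodingerMeasure c ε ρ₀ ρ₁ a b)) := by
  simp only [integral_discreteBridge_eq_matchingAverage a b]
  exact theorem1_general (hab.isCouplingDensity hc.continuous hξ) hη hlaw hind
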